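/- **Setting.** Fix a path-loss exponent $\alpha\ge 2$, an SNR threshold $\gamma>0$, a gain constant $G>0$ and a number $K\ge1$ of channel uses per time slot. Nodes $1,\dots,N$ have independent positions $\mathbf r_1,\dots,\mathbf r_N$, uniform on the unit square $[0,1]^2$. Every node transmits in every time slot with power $P=\frac{\gamma}{G}r_N^{\alpha}$, and two distinct nodes $m,n$ are neighbors if $P\ge\frac{\gamma}{G}\|\mathbf r_m-\mathbf r_n\|_2^{\alpha}$, i.e. if $\|\mathbf r_m-\mathbf r_n\|_2\le r_N$. The radius $r_N\ge 0$ is a connectivity radius: $r_N=\Theta(\sqrt{\log N/N})$, and the resulting graph $\mathcal G$ is connected with probability tending to $1$ as $N\to\infty$. *Synchronous randomized gossip.* In each time slot $t=1,2,\dots$, independently of the other slots and with the same law, the nodes are randomly paired up with neighbors: a random permutation $\sigma_t$ with $\sigma_t\circ\sigma_t=\mathrm{id}$ is drawn such that $\sigma_t(n)\ne n$ only if $n$ and $\sigma_t(n)$ are neighbors, and each pair of neighbors is matched with probability at least $\kappa/\Delta$, where $\Delta$ is the maximum degree of $\mathcal G$ and $\kappa>0$ is a constant. With $\mathbf W(t)$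 the permutation matrix of $\sigma_t$, the estimates evolve by $\mathbf z(t)=\frac12(\mathbf W(t)+\mathbf I)\mathbf z(t-1)$. *Metrics.* Given the positions and the law of the pairings, let $z_{\rm ave}$ be the average of the entries of $\mathbf z(0)$ and $$T_\epsilon=\sup_{\mathbf z(0)\ne 0}\inf\Big\{t:\Pr\Big(\frac{\|\mathbf z(t)-z_{\rm ave}\mathbf 1\|_2}{\|\mathbf z(0)\|_2}\ge\epsilon\Big)\le\epsilon\Big\},\qquad E_\epsilon=K\sum_{t=1}^{T_\epsilon}\sum_{n=1}^N P,\qquad B_\epsilon=K\sum_{t=1}^{T_\epsilon}\chi(\mathcal G_2),$$ where $\mathcal G_2$ joins distinct nodes that are neighbors or have a common neighbor in $\mathcal G$, and $\chi$ is the chromatic number. **Theorem.** For every $\epsilon_0<1$ there are constants $c,C>0$, not depending on $N$, on $\epsilon$, on the positions or on the law of the pairings (they may depend on $\alpha,\gamma,G,K,\kappa,\epsilon_0$ and the sequence $(r_N)$), such that with probability tending to $1$ as $N\to\infty$ over the positions, for all laws of the pairings as above and all $\epsilon\in(0,\epsilon_0]$ simultaneously, $$c\,\frac{N\log\epsilon^{-1}}{\log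 N}\le T_\epsilon\le C\,\frac{N\log\epsilon^{-1}}{\log N},\qquad B_\epsilon\ge c\,N\log\epsilon^{-1},$$ $$c\,N^{2-\alpha/2}(\log N)^{\alpha/2-1}\log\epsilon^{-1}\le E_\epsilon\le C\,N^{2-\alpha/2}(\log N)^{\alpha/2-1}\log\epsilon^{-1}.$$ -/

import Mathlib

open Filter Topology MeasureTheory Asymptotics
open scoped ENNReal

noncomputable section

/-! ### Node placement -/

/-- The Euclidean plane. -/
abbrev Plane : Type := EuclideanSpace ℝ (Fin 2)

/-- The unit square `[0,1] × [0,1]`. -/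
def unitSquare : Set Plane := {p | ∀ i, p i ∈ Set.Icc (0 : ℝ) 1}

/-- The law of `N` independent points, each uniformly distributed on the unit square. -/
def placementLaw (N : ℕ) : Measure (Fin N → Plane) :=
  Measure.pi fun _ => (volume : Measure Plane).restrict unitSquare

/-! ### Path-loss model, connectivity and frequency slots -/

/-- The nodes `m` whose signal, sent with power `P m`, is received at `n` with power at least the
threshold `γ`, when the squared channel gain at distance `d` is `G * d ^ (-α)`. -/
def neighborhood {V : Type*} (α γ G : ℝ) (P : V → ℝ) (x : V → Plane) (n : V) : Set V :=
  {m | γ / G * dist (x m) (x n) ^ α ≤ P m}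

/-- The graph of links: distinct nodes that are in each other's neighborhood. -/
def linkGraph {V : Type*} (α γ G : ℝ) (P : V → ℝ) (x : V → Plane) : SimpleGraph V where
  Adj m n := m ≠ n ∧ m ∈ neighborhood α γ G P x n ∧ n ∈ neighborhood α γ G P x m
  symm := ⟨fun _ _ h => ⟨h.1.symm, h.2.2, h.2.1⟩⟩
  loopless := ⟨fun _ h => h.1 rfl⟩

/-- The graph of two-hop neighbors: distinct nodes at graph distance one or two. -/
def twoHopGraph {V : Type*} (H : SimpleGraph V) : SimpleGraph V where
  Adj m n := m ≠ n ∧ (H.Adj m n ∨ ∃ k, H.Adj m k ∧ H.Adj k n)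
  symm := ⟨fun _ _ h => ⟨h.1.symm,
    h.2.imp (fun e => e.symm) (fun ⟨k, e₁, e₂⟩ => ⟨k, e₂.symm, e₁.symm⟩)⟩⟩
  loopless := ⟨fun _ h => h.1 rfl⟩

/-- The number of frequency slots needed in a time slot with link graph `H`. -/
def bandwidth {V : Type*} (H : SimpleGraph V) : ℕ∞ := (twoHopGraph H).chromaticNumber

/-- The power with which a transmission reaches exactly the nodes within distance `r`. -/
def transmitPower (α γ G r : ℝ) : ℝ := γ / G * r ^ α

/-- The link graph when every node transmits with the power for radius `r`. -/
def radiusGraph {V : Type*} (α γ G r : ℝ) (x : V → Plane) : SimpleGraph V :=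
  linkGraph α γ G (fun _ => transmitPower α γ G r) x

/-! ### Synchronous randomized gossip -/

/-- `σ` pairs nodes up along edges of `H`; a fixed point is a node that stays single. -/
def IsPairing {V : Type*} (H : SimpleGraph V) (σ : Equiv.Perm V) : Prop :=
  (∀ n, σ (σ n) = n) ∧ ∀ n, σ n ≠ n → H.Adj n (σ n)

open Classical in
/-- The law `μ` pairs nodes up randomly with their neighbors: it is supported on pairings, and each
pair of neighbors is matched with a probability of at least `κ` over the maximum degree. -/
structure IsRandomPairing {V : Type*} [Fintype V] (H : SimpleGraph V) (κ : ℝ)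
    (μ : PMF (Equiv.Perm V)) : Prop where
  isPairing : ∀ σ ∈ μ.support, IsPairing H σ
  balanced : ∀ m n, H.Adj m n →
    ENNReal.ofReal (κ / (H.maxDegree : ℝ)) ≤ μ.toOuterMeasure {σ | σ m = n}

/-- One round: `z` becomes `½ (W + I) z`, with `W` the permutation matrix of `σ`, so that the
estimate of `n` becomes `(z n + z (σ n)) / 2`. -/
def gossipStep {V : Type*} [Fintype V] [DecidableEq V] (σ : Equiv.Perm V) (z : V → ℝ) : V → ℝ :=
  Matrix.mulVec ((1 / 2 : ℝ) • (σ.permMatrix ℝ + 1)) z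

/-- The law of the vector of estimates after `t` rounds, with independent pairings of law `μ`. -/
def gossipState {V : Type*} [Fintype V] [DecidableEq V] (μ : PMF (Equiv.Perm V)) (z₀ : V → ℝ) :
    ℕ → PMF (V → ℝ)
  | 0 => PMF.pure z₀
  | t + 1 => (gossipState μ z₀ t).bind fun z => μ.map fun σ => gossipStep σ z

/-- The Euclidean norm of a vector of estimates. -/
def euclNorm {V : Type*} [Fintype V] (z : V → ℝ) : ℝ := ‖WithLp.toLp 2 z‖

/-- The average of a vector of estimates. -/
def average {V : Type*} [Fintype V] (z : V → ℝ) : ℝ := (∑ n, z n) / (Fintype.card V : ℝ)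

/-! ### Resource metrics -/

/-- The `ε`-averaging time; it is infinite if consensus is not achieved. -/
def averagingTime {V : Type*} [Fintype V] [DecidableEq V] (μ : PMF (Equiv.Perm V)) (ε : ℝ) : ℕ∞ :=
  ⨆ (z₀ : V → ℝ) (_ : z₀ ≠ 0),
    ⨅ (t : ℕ) (_ : (gossipState μ z₀ t).toOuterMeasure
        {z | ε ≤ euclNorm (fun n => z n - average z₀) / euclNorm z₀} ≤ ENNReal.ofReal ε), (t : ℕ∞)

/-- The energy `K ∑ₜ ∑ₙ P t n` over the time slots `t = 1, …, T`. -/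
def totalEnergy {V : Type*} [Fintype V] (K : ℕ) (T : ℕ∞) (P : ℕ → V → ℝ) : ℝ≥0∞ :=
  K * ∑' t : {t : ℕ // 1 ≤ t ∧ (t : ℕ∞) ≤ T}, ∑ n, ENNReal.ofReal (P t n)

/-- The time-bandwidth product `K ∑ₜ B t` over the time slots `t = 1, …, T`. -/
def timeBandwidth (K : ℕ) (T : ℕ∞) (B : ℕ → ℕ∞) : ℝ≥0∞ :=
  K * ∑' t : {t : ℕ // 1 ≤ t ∧ (t : ℕ∞) ≤ T}, (B t : ℝ≥0∞)

/-- The averaging time as an extended nonnegative real number. -/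
def gossipTime {V : Type*} [Fintype V] [DecidableEq V] (μ : PMF (Equiv.Perm V)) (ε : ℝ) : ℝ≥0∞ :=
  (averagingTime μ ε : ℝ≥0∞)

/-- The time-bandwidth product of gossip with radius `r`. -/
def gossipBandwidth {V : Type*} [Fintype V] [DecidableEq V] (α γ G : ℝ) (K : ℕ) (r : ℝ)
    (x : V → Plane) (μ : PMF (Equiv.Perm V)) (ε : ℝ) : ℝ≥0∞ :=
  timeBandwidth K (averagingTime μ ε) fun _ => bandwidth (radiusGraph α γ G r x)

/-- The transmit energy of gossip with radius `r`; every node transmits in every time slot. -/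
def gossipEnergy {V : Type*} [Fintype V] [DecidableEq V] (α γ G : ℝ) (K : ℕ) (r : ℝ)
    (μ : PMF (Equiv.Perm V)) (ε : ℝ) : ℝ≥0∞ :=
  totalEnergy (V := V) K (averagingTime μ ε) fun _ _ => transmitPower α γ G r

end

/-! The averaging time is controlled by the spectral gap of the expected round, which turns out to
be of order log N / N.

Upper bound. A round preserves the sum and lowers the sum of squares by a quarter of ∑ (z n - z (σ
n))². Each edge is matched with probability at least κ/Δ, so the expected loss is at least κ/(4Δ)
times the Dirichlet energy. A Poincaré inequality with constant C therefore contracts the expected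
squared error by 1 - κ/(4ΔC), and Markov's inequality gives T_ε ≤ 12 Δ C κ⁻¹ log ε⁻¹ + 1. As Δ =
O(log N), what is needed is C = O(N / log² N).

Poincaré inequality (`WellOccupied.sum_sub_average_sq_le_dirichletEnergy`). The square is cut into
m² cells, m² of order N / log N, of side at most a third of the radius. The constant in the
connectivity radius is arbitrary, so some cells may be nearly empty. But k given cells are jointly
sparse with probability O(N⁻²) once k is a large constant, so with high probability every window of
3 by 3 blocks of side L = kR cells has fewer than k sparse cells. By pigeonhole each block then
contains R consecutive rows, and R consecutive columns, free of sparse cells. Along such lines,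
neighboring cell means are compared through about log² N edges, which makes the block means obey a
grid Poincaré inequality of the right order. A node in a sparse region is reached by connectivity:
edges span at most R cells, so a path of the graph cannot leave the window without landing on a
frame of good strips. Every node is thus joined, inside its window, to the representative cell of
its block. The resulting estimate is crude, but its contribution log³ N is dominated by N / log² N.

Lower bound. The expected round is self-adjoint, and the norms of its iterates are log-convex, so
the decay of a test vector is never faster than in the first round. The centered first coordinate of
the positions varies by at most r along an edge and has total variance of order N, so a round in
expectation keeps a factor 1 - O(r²). A small error with high probability forces a small expected
state, which converts this into a bound on T_ε.

The energy is K T_ε N P. The bandwidth is at least the size of a clique, and an occupied cell is a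
clique with at least a constant times log N nodes. -/

noncomputable section

/-! ### Expectations of nonnegative functions under a `PMF` -/

/-- The expectation of a nonnegative function under a probability mass function. -/
def pmfExp {α : Type*} (p : PMF α) (F : α → ℝ≥0∞) : ℝ≥0∞ := ∑' a, p a * F a

theorem pmfExp_pure {α : Type*} (a : α) (F : α → ℝ≥0∞) : pmfExp (PMF.pure a) F = F a := by
  unfold pmfExp
  rw [tsum_eq_single a]
  · simp
  · intro b hb
    simp [PMF.pure_apply, hb]

theorem pmfExp_bind {α β : Type*} (p : PMF α) (f : α → PMF β) (F : β → ℝ≥0∞) :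
    pmfExp (p.bind f) F = pmfExp p fun a => pmfExp (f a) F := by
  unfold pmfExp
  simp only [PMF.bind_apply, ← ENNReal.tsum_mul_right, ← ENNReal.tsum_mul_left]
  rw [ENNReal.tsum_comm]
  simp only [mul_assoc]

theorem pmfExp_map {α β : Type*} (p : PMF α) (g : α → β) (F : β → ℝ≥0∞) :
    pmfExp (p.map g) F = pmfExp p fun a => F (g a) := by
  unfold PMF.map
  rw [pmfExp_bind]
  simp only [Function.comp, pmfExp_pure]

theorem pmfExp_mono {α : Type*} (p : PMF α) {F F' : α → ℝ≥0∞}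
    (h : ∀ a ∈ p.support, F a ≤ F' a) : pmfExp p F ≤ pmfExp p F' := by
  refine ENNReal.tsum_le_tsum fun a => ?_
  by_cases ha : a ∈ p.support
  · exact mul_le_mul_right (h a ha) _
  · rw [PMF.mem_support_iff, not_not] at ha
    simp [ha]

theorem pmfExp_congr {α : Type*} (p : PMF α) {F F' : α → ℝ≥0∞}
    (h : ∀ a ∈ p.support, F a = F' a) : pmfExp p F = pmfExp p F' :=
  le_antisymm (pmfExp_mono p fun a ha => (h a ha).le) (pmfExp_mono p fun a ha => (h a ha).ge)

theorem pmfExp_const_mul {α : Type*} (p : PMF α) (c : ℝ≥0∞) (F : α → ℝ≥0∞) :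
    pmfExp p (fun a => c * F a) = c * pmfExp p F := by
  unfold pmfExp
  rw [← ENNReal.tsum_mul_left]
  exact tsum_congr fun a => by ring

theorem pmfExp_add {α : Type*} (p : PMF α) (F F' : α → ℝ≥0∞) :
    pmfExp p (fun a => F a + F' a) = pmfExp p F + pmfExp p F' := by
  unfold pmfExp
  rw [← ENNReal.tsum_add]
  exact tsum_congr fun a => by ring

theorem pmfExp_const {α : Type*} (p : PMF α) (c : ℝ≥0∞) : pmfExp p (fun _ => c) = c := by
  unfold pmfExp
  rw [ENNReal.tsum_mul_right, p.tsum_coe, one_mul]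

theorem pmfExp_indicator {α : Type*} (p : PMF α) (s : Set α) :
    pmfExp p (s.indicator 1) = p.toOuterMeasure s := by
  rw [PMF.toOuterMeasure_apply]
  refine tsum_congr fun a => ?_
  by_cases ha : a ∈ s <;> simp [ha]

/-- Markov's inequality: c times the indicator of {c ≤ F} is at most F. -/
theorem toOuterMeasure_ge_mul_le_pmfExp {α : Type*} (p : PMF α) (F : α → ℝ≥0∞) (c : ℝ≥0∞) :
    c * p.toOuterMeasure {a | c ≤ F a} ≤ pmfExp p F := by
  rw [← pmfExp_indicator, ← pmfExp_const_mul]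
  refine pmfExp_mono p fun a _ => ?_
  by_cases ha : c ≤ F a <;> simp [ha]

/-! ### One round of gossip -/

section Gossip

variable {V : Type*} [Fintype V] [DecidableEq V]

theorem gossipStep_apply (σ : Equiv.Perm V) (z : V → ℝ) (n : V) :
    gossipStep σ z n = (z n + z (σ n)) / 2 := by
  unfold gossipStep
  rw [Matrix.smul_mulVec, Matrix.add_mulVec, Matrix.one_mulVec, Matrix.permMatrix_mulVec]
  simp
  ring

theorem euclNorm_eq_sqrt {V : Type*} [Fintype V] (z : V → ℝ) :
    euclNorm z = Real.sqrt (∑ n, z n ^ 2) := by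
  simp [euclNorm, EuclideanSpace.norm_eq]

theorem sum_gossipStep (σ : Equiv.Perm V) (z : V → ℝ) :
    ∑ n, gossipStep σ z n = ∑ n, z n := by
  simp only [gossipStep_apply, ← Finset.sum_div, Finset.sum_add_distrib]
  rw [Equiv.sum_comp σ z]
  ring

theorem gossipStep_sub_const (σ : Equiv.Perm V) (z : V → ℝ) (c : ℝ) (n : V) :
    gossipStep σ z n - c = gossipStep σ (fun k => z k - c) n := by
  simp only [gossipStep_apply]
  ring

/-- The parallelogram identity at each node, summed; only the bijectivity of σ is used to reindex.
-/
theorem sum_gossipStep_sq (σ : Equiv.Perm V) (z : V → ℝ) :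
    ∑ n, gossipStep σ z n ^ 2 = ∑ n, z n ^ 2 - (1 / 4) * ∑ n, (z n - z (σ n)) ^ 2 := by
  have h := Equiv.sum_comp σ fun n => z n ^ 2
  have : ∑ n, gossipStep σ z n ^ 2 + (1 / 4) * ∑ n, (z n - z (σ n)) ^ 2
      = (1 / 2) * (∑ n, z n ^ 2 + ∑ n, z (σ n) ^ 2) := by
    rw [← Finset.sum_add_distrib, Finset.mul_sum, Finset.mul_sum, ← Finset.sum_add_distrib]
    refine Finset.sum_congr rfl fun n _ => ?_
    rw [gossipStep_apply]
    ring
  rw [h] at this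
  linarith

theorem sum_gossipStep_sq_le (σ : Equiv.Perm V) (z : V → ℝ) :
    ∑ n, gossipStep σ z n ^ 2 ≤ ∑ n, z n ^ 2 := by
  rw [sum_gossipStep_sq]
  have : 0 ≤ ∑ n, (z n - z (σ n)) ^ 2 := Finset.sum_nonneg fun _ _ => sq_nonneg _
  linarith

/-- An involution has a symmetric permutation matrix, so the round is self-adjoint. -/
theorem sum_mul_gossipStep {σ : Equiv.Perm V} (hσ : ∀ n, σ (σ n) = n) (w z : V → ℝ) :
    ∑ n, w n * gossipStep σ z n = ∑ n, gossipStep σ w n * z n := by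
  simp only [gossipStep_apply]
  have h := Equiv.sum_comp σ fun n => w n * z (σ n)
  simp only [hσ] at h
  have h1 : ∑ n, w n * ((z n + z (σ n)) / 2)
      = (1 / 2) * (∑ n, w n * z n + ∑ n, w n * z (σ n)) := by
    rw [← Finset.sum_add_distrib, Finset.mul_sum]
    exact Finset.sum_congr rfl fun n _ => by ring
  have h2 : ∑ n, (w n + w (σ n)) / 2 * z n
      = (1 / 2) * (∑ n, w n * z n + ∑ n, w (σ n) * z n) := by
    rw [← Finset.sum_add_distrib, Finset.mul_sum]
    exact Finset.sum_congr rfl fun n _ => by ring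
  rw [h1, h2, h]

/-- Carries invariants such as the zero sum of the deviations and the norm bound through the
process, so that later estimates are needed only on the support. -/
theorem gossipState_support_induction (μ : PMF (Equiv.Perm V)) (z₀ : V → ℝ)
    (Q : (V → ℝ) → Prop) (h₀ : Q z₀) (hstep : ∀ σ ∈ μ.support, ∀ z, Q z → Q (gossipStep σ z))
    (t : ℕ) : ∀ z ∈ (gossipState μ z₀ t).support, Q z := by
  induction t with
  | zero =>
    intro z hz
    simp only [gossipState, PMF.support_pure, Set.mem_singleton_iff] at hz
    rwa [hz]
  | succ t ih =>
    intro z hz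
    simp only [gossipState, PMF.mem_support_bind_iff, PMF.support_map, Set.mem_image] at hz
    obtain ⟨z', hz', σ, hσ, rfl⟩ := hz
    exact hstep σ hσ z' (ih z' hz')

theorem pmfExp_gossipState_succ (μ : PMF (Equiv.Perm V)) (z₀ : V → ℝ) (t : ℕ)
    (F : (V → ℝ) → ℝ≥0∞) : pmfExp (gossipState μ z₀ (t + 1)) F =
      pmfExp (gossipState μ z₀ t) fun z => pmfExp μ fun σ => F (gossipStep σ z) := by
  rw [gossipState, pmfExp_bind]
  simp only [pmfExp_map]

/-! ### Upper bound on the averaging time -/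

theorem pmfExp_gossipState_sq_le (μ : PMF (Equiv.Perm V)) (ℓ : ℝ)
    (hgap : ∀ z : V → ℝ, ∑ n, z n = 0 →
      pmfExp μ (fun σ => ENNReal.ofReal (∑ n, gossipStep σ z n ^ 2)) ≤
        ENNReal.ofReal (1 - ℓ) * ENNReal.ofReal (∑ n, z n ^ 2))
    (z₀ : V → ℝ) (t : ℕ) :
    pmfExp (gossipState μ z₀ t) (fun z => ENNReal.ofReal (∑ n, (z n - average z₀) ^ 2)) ≤
      ENNReal.ofReal (1 - ℓ) ^ t * ENNReal.ofReal (∑ n, (z₀ n - average z₀) ^ 2) := by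
  have hsupp := gossipState_support_induction μ z₀ (fun z => ∑ n, (z n - average z₀) = 0)
    (by
      rcases isEmpty_or_nonempty V with hV | hV
      · simp
      · have : (Fintype.card V : ℝ) ≠ 0 := by exact_mod_cast Fintype.card_ne_zero
        simp only [Finset.sum_sub_distrib, Finset.sum_const, Finset.card_univ, nsmul_eq_mul,
          _root_.average]
        field_simp
        ring)
    (fun σ _ z hz => by
      rw [← hz]
      simp only [gossipStep_sub_const]
      exact sum_gossipStep σ _)
  induction t with
  | zero => simp [gossipState, pmfExp_pure]
  | succ t ih =>
    rw [pmfExp_gossipState_succ]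
    calc _ ≤ pmfExp (gossipState μ z₀ t) (fun z => ENNReal.ofReal (1 - ℓ) *
            ENNReal.ofReal (∑ n, (z n - average z₀) ^ 2)) := by
          refine pmfExp_mono _ fun z hz => ?_
          simp only [gossipStep_sub_const]
          exact hgap _ (hsupp t z hz)
      _ ≤ _ := by
          rw [pmfExp_const_mul, pow_succ', mul_assoc]
          gcongr

/-- The average minimizes the sum of squared deviations; this allows a Poincaré inequality to be
proved with any convenient center. -/
theorem sum_sub_average_sq_le {V : Type*} [Fintype V] (z : V → ℝ) (c : ℝ) :
    ∑ n, (z n - average z) ^ 2 ≤ ∑ n, (z n - c) ^ 2 := by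
  rcases isEmpty_or_nonempty V with hV | hV
  · simp
  have hc : (Fintype.card V : ℝ) ≠ 0 := by exact_mod_cast Fintype.card_ne_zero
  have h1 : ∑ n, (z n - average z) = 0 := by
    simp only [Finset.sum_sub_distrib, Finset.sum_const, Finset.card_univ, nsmul_eq_mul,
      _root_.average]
    field_simp
    ring
  have h2 : ∑ n, (z n - c) ^ 2 = ∑ n, (z n - average z) ^ 2
      + 2 * (average z - c) * ∑ n, (z n - average z) + ∑ _n : V, (average z - c) ^ 2 := by
    rw [Finset.mul_sum, ← Finset.sum_add_distrib, ← Finset.sum_add_distrib]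
    exact Finset.sum_congr rfl fun n _ => by ring
  have h3 : 0 ≤ ∑ _n : V, (average z - c) ^ 2 := Finset.sum_nonneg fun _ _ => sq_nonneg _
  rw [h2, h1]
  linarith

/-- The exponent 3 comes from Markov's inequality: the squared error is compared with the level ε²
‖z₀‖², which uses ε², and the failure probability ε uses one more factor. -/
theorem averagingTime_le (μ : PMF (Equiv.Perm V)) (ℓ : ℝ)
    (hgap : ∀ z : V → ℝ, ∑ n, z n = 0 →
      pmfExp μ (fun σ => ENNReal.ofReal (∑ n, gossipStep σ z n ^ 2)) ≤
        ENNReal.ofReal (1 - ℓ) * ENNReal.ofReal (∑ n, z n ^ 2))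
    (ε : ℝ) (hε : 0 < ε) (t : ℕ) (ht : Real.exp (-ℓ * t) ≤ ε ^ 3) :
    averagingTime μ ε ≤ t := by
  refine iSup₂_le fun z₀ hz₀ => iInf₂_le t ?_
  have hpos : 0 < ∑ n, z₀ n ^ 2 := by
    obtain ⟨n, hn⟩ := Function.ne_iff.mp hz₀
    exact Finset.sum_pos' (fun _ _ => sq_nonneg _) ⟨n, Finset.mem_univ _, by
      have : z₀ n ≠ 0 := hn
      positivity⟩
  have hexp := pmfExp_gossipState_sq_le μ ℓ hgap z₀ t
  have hle : ∑ n, (z₀ n - average z₀) ^ 2 ≤ ∑ n, z₀ n ^ 2 := by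
    simpa using sum_sub_average_sq_le z₀ 0
  have hpow : ENNReal.ofReal (1 - ℓ) ^ t ≤ ENNReal.ofReal (ε ^ 3) := by
    calc _ ≤ ENNReal.ofReal (Real.exp (-ℓ)) ^ t := by
          gcongr
          linarith [Real.add_one_le_exp (-ℓ)]
      _ = ENNReal.ofReal (Real.exp (-ℓ * t)) := by
          rw [← ENNReal.ofReal_pow (Real.exp_pos _).le, ← Real.exp_nat_mul]
          congr 2
          ring
      _ ≤ _ := ENNReal.ofReal_le_ofReal ht
  have hmarkov := toOuterMeasure_ge_mul_le_pmfExp (gossipState μ z₀ t)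
    (fun z => ENNReal.ofReal (∑ n, (z n - average z₀) ^ 2))
    (ENNReal.ofReal (ε ^ 2 * ∑ n, z₀ n ^ 2))
  have hset : {z : V → ℝ | ε ≤ euclNorm (fun n => z n - average z₀) / euclNorm z₀} =
      {z | ENNReal.ofReal (ε ^ 2 * ∑ n, z₀ n ^ 2) ≤
        ENNReal.ofReal (∑ n, (z n - average z₀) ^ 2)} := by
    ext z
    have h0 : 0 ≤ ∑ n, (z n - average z₀) ^ 2 := Finset.sum_nonneg fun _ _ => sq_nonneg _
    rw [Set.mem_ofPred_eq, Set.mem_ofPred_eq, ENNReal.ofReal_le_ofReal_iff h0, euclNorm_eq_sqrt,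
      euclNorm_eq_sqrt, le_div_iff₀ (Real.sqrt_pos.mpr hpos), Real.le_sqrt' (mul_pos hε (Real.sqrt_pos.mpr hpos)), mul_pow,
      Real.sq_sqrt hpos.le]
  rw [← hset] at hmarkov
  have hall := hmarkov.trans (hexp.trans (mul_le_mul' hpow (ENNReal.ofReal_le_ofReal hle)))
  rw [← ENNReal.ofReal_mul (by positivity), show ε ^ 3 * ∑ n, z₀ n ^ 2
    = (ε ^ 2 * ∑ n, z₀ n ^ 2) * ε by ring, ENNReal.ofReal_mul (q := ε) (by positivity)] at hall
  exact (ENNReal.mul_le_mul_iff_right (by simpa using by positivity) ENNReal.ofReal_ne_top).mp hall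

/-! ### Lower bound on the averaging time -/

/-- The expected result of one round of gossip. -/
def meanStep (μ : PMF (Equiv.Perm V)) (z : V → ℝ) (n : V) : ℝ :=
  ∑ σ, (μ σ).toReal * gossipStep σ z n

theorem sum_toReal_eq_one {α : Type*} [Fintype α] (p : PMF α) : ∑ a, (p a).toReal = 1 := by
  rw [← ENNReal.toReal_sum fun a _ => p.apply_ne_top a, ← tsum_fintype (L := .unconditional _), p.tsum_coe,
    ENNReal.toReal_one]

theorem sum_meanStep_mul (μ : PMF (Equiv.Perm V)) (w z : V → ℝ) :
    ∑ n, meanStep μ w n * z n = ∑ σ, (μ σ).toReal * ∑ n, gossipStep σ w n * z n := by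
  simp only [meanStep, Finset.sum_mul, Finset.mul_sum, mul_assoc]
  exact Finset.sum_comm

theorem sum_mul_meanStep (μ : PMF (Equiv.Perm V)) (hμ : ∀ σ ∈ μ.support, ∀ n, σ (σ n) = n)
    (w z : V → ℝ) : ∑ n, w n * meanStep μ z n = ∑ n, meanStep μ w n * z n := by
  have h := sum_meanStep_mul μ z w
  rw [sum_meanStep_mul]
  simp only [mul_comm (w _)]
  rw [h]
  refine Finset.sum_congr rfl fun σ _ => ?_
  by_cases hσ : σ ∈ μ.support
  · rw [← sum_mul_gossipStep (hμ σ hσ)]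
    simp only [mul_comm]
  · rw [PMF.mem_support_iff, not_not] at hσ
    simp [hσ]

theorem sum_meanStep_sq_le (μ : PMF (Equiv.Perm V)) (w : V → ℝ) :
    ∑ n, meanStep μ w n ^ 2 ≤ ∑ n, w n ^ 2 := by
  have key : ∀ n, meanStep μ w n ^ 2 ≤ ∑ σ, (μ σ).toReal * gossipStep σ w n ^ 2 := by
    intro n
    simpa [meanStep] using (Even.convexOn_pow (even_two : Even 2)).map_sum_le (t := Finset.univ)
      (w := fun σ => (μ σ).toReal) (p := fun σ => gossipStep σ w n)
      (fun _ _ => ENNReal.toReal_nonneg) (sum_toReal_eq_one μ) (fun _ _ => Set.mem_univ _)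
  calc _ ≤ ∑ n, ∑ σ, (μ σ).toReal * gossipStep σ w n ^ 2 := Finset.sum_le_sum fun n _ => key n
    _ = ∑ σ, (μ σ).toReal * ∑ n, gossipStep σ w n ^ 2 := by
        rw [Finset.sum_comm]
        simp only [Finset.mul_sum]
    _ ≤ ∑ σ, (μ σ).toReal * ∑ n, w n ^ 2 := by
        exact Finset.sum_le_sum fun σ _ =>
          mul_le_mul_of_nonneg_left (sum_gossipStep_sq_le σ w) ENNReal.toReal_nonneg
    _ = _ := by rw [← Finset.sum_mul, sum_toReal_eq_one, one_mul]

theorem abs_sum_mul_le {V : Type*} [Fintype V] {w z : V → ℝ} {b : ℝ} (hb : 0 ≤ b) (hw : ∑ n, w n ^ 2 ≤ 1)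
    (hz : ∑ n, z n ^ 2 ≤ b ^ 2) : |∑ n, w n * z n| ≤ b := by
  apply abs_le_of_sq_le_sq _ hb
  calc _ ≤ (∑ n, w n ^ 2) * ∑ n, z n ^ 2 := Finset.sum_mul_sq_le_sq_mul_sq _ _ _
    _ ≤ 1 * b ^ 2 := by gcongr
    _ = _ := one_mul _

/-- By Cauchy–Schwarz the linear functional has absolute value at most b, so adding b makes it
nonnegative. A signed expectation can then be handled with values in `ℝ≥0∞`. -/
theorem pmfExp_gossipStep_linear (μ : PMF (Equiv.Perm V))
    (hμ : ∀ σ ∈ μ.support, ∀ n, σ (σ n) = n) (w z : V → ℝ) (b : ℝ) (hb : 0 ≤ b)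
    (hw : ∑ n, w n ^ 2 ≤ 1) (hz : ∑ n, z n ^ 2 ≤ b ^ 2) :
    pmfExp μ (fun σ => ENNReal.ofReal (b + ∑ n, w n * gossipStep σ z n)) =
      ENNReal.ofReal (b + ∑ n, meanStep μ w n * z n) := by
  have hnn : ∀ σ, 0 ≤ b + ∑ n, w n * gossipStep σ z n := fun σ => by
    have := abs_le.mp (abs_sum_mul_le hb hw ((sum_gossipStep_sq_le σ z).trans hz))
    linarith
  unfold pmfExp
  rw [tsum_fintype]
  have h1 : ∀ σ, μ σ * ENNReal.ofReal (b + ∑ n, w n * gossipStep σ z n) =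
      ENNReal.ofReal ((μ σ).toReal * (b + ∑ n, w n * gossipStep σ z n)) := fun σ => by
    rw [ENNReal.ofReal_mul ENNReal.toReal_nonneg, ENNReal.ofReal_toReal (μ.apply_ne_top σ)]
  simp only [h1]
  rw [← ENNReal.ofReal_sum_of_nonneg fun σ _ => mul_nonneg ENNReal.toReal_nonneg (hnn σ)]
  congr 1
  simp only [mul_add, Finset.sum_add_distrib]
  rw [← Finset.sum_mul, sum_toReal_eq_one, one_mul, sum_meanStep_mul]
  congr 1
  refine Finset.sum_congr rfl fun σ _ => ?_
  by_cases hσ : σ ∈ μ.support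
  · rw [sum_mul_gossipStep (hμ σ hσ)]
  · rw [PMF.mem_support_iff, not_not] at hσ
    simp [hσ]

/-- Duality: the last round is moved onto w by self-adjointness, so the induction runs over all w in
the unit ball, which the expected round preserves. -/
theorem pmfExp_gossipState_linear (μ : PMF (Equiv.Perm V))
    (hμ : ∀ σ ∈ μ.support, ∀ n, σ (σ n) = n) (z₀ : V → ℝ) (b : ℝ) (hb : 0 ≤ b)
    (hz : ∑ n, z₀ n ^ 2 ≤ b ^ 2) (t : ℕ) (w : V → ℝ) (hw : ∑ n, w n ^ 2 ≤ 1) :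
    pmfExp (gossipState μ z₀ t) (fun z => ENNReal.ofReal (b + ∑ n, w n * z n)) =
      ENNReal.ofReal (b + ∑ n, w n * ((meanStep μ)^[t] z₀) n) := by
  have hsupp := gossipState_support_induction μ z₀ (fun z => ∑ n, z n ^ 2 ≤ b ^ 2) hz
    (fun σ _ z h => (sum_gossipStep_sq_le σ z).trans h)
  induction t generalizing w with
  | zero => simp [gossipState, pmfExp_pure]
  | succ t ih =>
    rw [pmfExp_gossipState_succ]
    rw [pmfExp_congr _ fun z hz' => pmfExp_gossipStep_linear μ hμ w z b hb hw (hsupp t z hz'),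
      ih _ ((sum_meanStep_sq_le μ w).trans hw), Function.iterate_succ_apply',
      sum_mul_meanStep μ hμ]

/-- Log-convexity makes the successive ratios nondecreasing, and the first one is already at least
q. -/
theorem pow_mul_le_of_logConvex (b : ℕ → ℝ) (q : ℝ) (hq : 0 < q)
    (h₀ : 0 < b 0) (h₁ : q * b 0 ≤ b 1) (hconv : ∀ k, b (k + 1) ^ 2 ≤ b k * b (k + 2)) (k : ℕ) :
    q ^ k * b 0 ≤ b k := by
  have h : ∀ k, 0 < b k ∧ q * b k ≤ b (k + 1) := by
    intro k
    induction k with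
    | zero => exact ⟨h₀, h₁⟩
    | succ k ih =>
      have hpos : 0 < b (k + 1) := lt_of_lt_of_le (mul_pos hq ih.1) ih.2
      refine ⟨hpos, ?_⟩
      have h2 : b (k + 1) * (q * b k) ≤ b k * b (k + 2) := by
        calc _ ≤ b (k + 1) * b (k + 1) := by gcongr; exact ih.2
          _ ≤ _ := by rw [← sq]; exact hconv k
      have : b k * (q * b (k + 1)) ≤ b k * b (k + 2) := by linarith
      exact le_of_mul_le_mul_left this ih.1
  induction k with
  | zero => simp
  | succ k ih =>
    calc q ^ (k + 1) * b 0 = q * (q ^ k * b 0) := by ring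
      _ ≤ q * b k := by gcongr
      _ ≤ _ := (h k).2

/-- For the self-adjoint expected round A, ‖A^(k+1) z‖² = ⟨A^k z, A^(k+2) z⟩, so Cauchy–Schwarz
gives log-convexity of the squared norms without a spectral decomposition. The first ratio follows
from ⟨z, A z⟩ ≥ (1 - η) ‖z‖². -/
theorem pow_mul_le_sum_iterate_meanStep_sq (μ : PMF (Equiv.Perm V))
    (hμ : ∀ σ ∈ μ.support, ∀ n, σ (σ n) = n) (z : V → ℝ) (hz : 0 < ∑ n, z n ^ 2) (η : ℝ)
    (hη1 : η < 1)
    (hlip : ∀ σ ∈ μ.support, ∑ n, (z n - z (σ n)) ^ 2 ≤ 4 * η * ∑ n, z n ^ 2) (t : ℕ) :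
    ((1 - η) ^ t) ^ 2 * ∑ n, z n ^ 2 ≤ ∑ n, ((meanStep μ)^[t] z) n ^ 2 := by
  have key := pow_mul_le_of_logConvex (fun k => ∑ n, ((meanStep μ)^[k] z) n ^ 2)
    ((1 - η) ^ 2) (by
      have : 0 < 1 - η := by linarith
      positivity) (by simpa using hz) ?_ ?_ t
  · simpa [← pow_mul, mul_comm] using key
  · have hin : (1 - η) * ∑ n, z n ^ 2 ≤ ∑ n, z n * meanStep μ z n := by
      rw [sum_mul_meanStep μ hμ, sum_meanStep_mul]
      calc (1 - η) * ∑ n, z n ^ 2 = ∑ σ, (μ σ).toReal * ((1 - η) * ∑ n, z n ^ 2) := by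
            rw [← Finset.sum_mul, sum_toReal_eq_one, one_mul]
        _ ≤ _ := by
            refine Finset.sum_le_sum fun σ _ => ?_
            by_cases hσ : σ ∈ μ.support
            · gcongr
              have h1 := sum_gossipStep_sq σ z
              have h2 := hlip σ hσ
              -- A round ½(W + I) with W an involution is an orthogonal projection S, hence ⟨S z, z⟩
              -- = ‖S z‖².
              have h3 : ∑ n, gossipStep σ z n * z n = ∑ n, gossipStep σ z n ^ 2 := by
                have h4 := sum_mul_gossipStep (hμ σ hσ) z (gossipStep σ z)
                have h5 : ∀ n, gossipStep σ (gossipStep σ z) n = gossipStep σ z n := fun n => by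
                  simp only [gossipStep_apply, hμ σ hσ n]
                  ring
                simp only [h5] at h4
                rw [← Finset.sum_congr rfl fun n _ => mul_comm (z n) (gossipStep σ z n), h4]
                simp only [sq]
              rw [h3, h1]
              linarith
            · rw [PMF.mem_support_iff, not_not] at hσ
              simp [hσ]
    have hcs := Finset.sum_mul_sq_le_sq_mul_sq Finset.univ z (meanStep μ z)
    simp only [Function.iterate_zero, id_eq, Function.iterate_one]
    have h6 : ((1 - η) * ∑ n, z n ^ 2) ^ 2 ≤ (∑ n, z n ^ 2) * ∑ n, meanStep μ z n ^ 2 := by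
      refine le_trans ?_ hcs
      have : 0 ≤ (1 - η) * ∑ n, z n ^ 2 := mul_nonneg (by linarith) hz.le
      gcongr
    refine le_of_mul_le_mul_left ?_ hz
    linarith [h6, show ((1 - η) * ∑ n, z n ^ 2) ^ 2
      = (∑ n, z n ^ 2) * ((1 - η) ^ 2 * ∑ n, z n ^ 2) by ring]
  · intro k
    have h1 : ∑ n, ((meanStep μ)^[k + 1] z) n ^ 2 =
        ∑ n, ((meanStep μ)^[k] z) n * ((meanStep μ)^[k + 2] z) n := by
      simp only [sq]
      rw [Function.iterate_succ_apply' (meanStep μ) (k + 1), sum_mul_meanStep μ hμ,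
        ← Function.iterate_succ_apply' (meanStep μ) k]
    simp only [h1]
    exact Finset.sum_mul_sq_le_sq_mul_sq _ _ _

/-- Tests the state against the unit vector v/d along its expectation v, of norm d ≥ (1 - η)^t b.
The inner product is at most b always and at most εb off an event of probability at most ε, so d ≤
(ε + (1 - ε)ε) b. -/
theorem pow_le_of_toOuterMeasure_le (μ : PMF (Equiv.Perm V))
    (hμ : ∀ σ ∈ μ.support, ∀ n, σ (σ n) = n) (z : V → ℝ) (hz : 0 < ∑ n, z n ^ 2)
    (havg : average z = 0) (η : ℝ) (hη1 : η < 1)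
    (hlip : ∀ σ ∈ μ.support, ∑ n, (z n - z (σ n)) ^ 2 ≤ 4 * η * ∑ n, z n ^ 2) (t : ℕ)
    (ε : ℝ) (hε : 0 < ε) (hε1 : ε < 1)
    (ht : (gossipState μ z t).toOuterMeasure
      {y | ε ≤ euclNorm (fun n => y n - average z) / euclNorm z} ≤ ENNReal.ofReal ε) :
    (1 - η) ^ t ≤ ε * (2 - ε) := by
  set b := Real.sqrt (∑ n, z n ^ 2) with hb
  have hbpos : 0 < b := Real.sqrt_pos.mpr hz
  have hb2 : b ^ 2 = ∑ n, z n ^ 2 := Real.sq_sqrt hz.le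
  set v := (meanStep μ)^[t] z with hv
  have hgrow := pow_mul_le_sum_iterate_meanStep_sq μ hμ z hz η hη1 hlip t
  rw [← hv, ← hb2] at hgrow
  have hp : 0 < (1 - η) ^ t := pow_pos (by linarith) t
  set d := Real.sqrt (∑ n, v n ^ 2) with hd
  have hsv : 0 ≤ ∑ n, v n ^ 2 := Finset.sum_nonneg fun _ _ => sq_nonneg _
  have hd2 : d ^ 2 = ∑ n, v n ^ 2 := Real.sq_sqrt hsv
  have hdge : (1 - η) ^ t * b ≤ d := by
    apply Real.le_sqrt_of_sq_le
    rw [mul_pow]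
    exact hgrow
  have hdpos : 0 < d := lt_of_lt_of_le (by positivity) hdge
  have hw : ∑ n, (v n / d) ^ 2 = 1 := by
    simp only [div_pow]
    rw [← Finset.sum_div, ← hd2]
    exact div_self (by positivity)
  have hexp := pmfExp_gossipState_linear μ hμ z b hbpos.le hb2.ge t (fun n => v n / d) hw.le
  have hin : ∑ n, v n / d * v n = d := by
    have : ∑ n, v n / d * v n = (∑ n, v n ^ 2) / d := by
      rw [Finset.sum_div]
      exact Finset.sum_congr rfl fun n _ => by ring
    rw [this, ← hd2]
    field_simp
  rw [← hv, hin] at hexp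
  have hsupp := gossipState_support_induction μ z (fun y => ∑ n, y n ^ 2 ≤ b ^ 2) hb2.ge
    (fun σ _ y h => (sum_gossipStep_sq_le σ y).trans h) t
  set S := {y : V → ℝ | ε ≤ euclNorm (fun n => y n - average z) / euclNorm z} with hS
  have hupper : pmfExp (gossipState μ z t)
      (fun y => ENNReal.ofReal (b + ∑ n, v n / d * y n)) ≤
      ENNReal.ofReal (b + ε * b) + ENNReal.ofReal ((1 - ε) * b) *
        (gossipState μ z t).toOuterMeasure S := by
    rw [← pmfExp_indicator, ← pmfExp_const_mul,
      ← pmfExp_const (gossipState μ z t) (ENNReal.ofReal (b + ε * b)), ← pmfExp_add]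
    refine pmfExp_mono _ fun y hy => ?_
    by_cases hyS : y ∈ S
    · rw [Set.indicator_of_mem hyS, Pi.one_apply, mul_one,
        ← ENNReal.ofReal_add (by positivity) (mul_nonneg (by linarith) hbpos.le)]
      apply ENNReal.ofReal_le_ofReal
      have := (abs_le.mp (abs_sum_mul_le hbpos.le hw.le (hsupp y hy))).2
      linarith
    · rw [Set.indicator_of_notMem hyS, mul_zero, add_zero]
      apply ENNReal.ofReal_le_ofReal
      rw [hS, Set.mem_ofPred_eq, not_le, havg, euclNorm_eq_sqrt, euclNorm_eq_sqrt, ← hb,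
        div_lt_iff₀ hbpos] at hyS
      simp only [sub_zero] at hyS
      have h2 : ∑ n, y n ^ 2 ≤ (ε * b) ^ 2 := (Real.sqrt_le_left (by positivity)).mp hyS.le
      have := (abs_le.mp (abs_sum_mul_le (by positivity) hw.le h2)).2
      linarith
  rw [hexp] at hupper
  have hfin : ENNReal.ofReal (b + d) ≤ ENNReal.ofReal (b + ε * b + (1 - ε) * b * ε) := by
    have h1 : 0 ≤ (1 - ε) * b := mul_nonneg (by linarith) hbpos.le
    rw [ENNReal.ofReal_add (p := b + ε * b) (by positivity) (by positivity),
      ENNReal.ofReal_mul h1]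
    exact hupper.trans (by gcongr)
  have h0 : 0 ≤ (1 - ε) * b * ε := mul_nonneg (mul_nonneg (by linarith) hbpos.le) hε.le
  rw [ENNReal.ofReal_le_ofReal_iff (by positivity)] at hfin
  have : (1 - η) ^ t * b ≤ (ε * (2 - ε)) * b := by linarith
  exact le_of_mul_le_mul_right this hbpos

theorem le_averagingTime (μ : PMF (Equiv.Perm V))
    (hμ : ∀ σ ∈ μ.support, ∀ n, σ (σ n) = n) (z : V → ℝ) (hz : 0 < ∑ n, z n ^ 2)
    (havg : average z = 0) (η : ℝ) (hη1 : η < 1)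
    (hlip : ∀ σ ∈ μ.support, ∑ n, (z n - z (σ n)) ^ 2 ≤ 4 * η * ∑ n, z n ^ 2)
    (ε : ℝ) (hε : 0 < ε) (hε1 : ε < 1) (T : ℝ≥0∞)
    (hT : ∀ t : ℕ, (1 - η) ^ t ≤ ε * (2 - ε) → T ≤ t) :
    T ≤ gossipTime μ ε := by
  have hz0 : z ≠ 0 := by
    rintro rfl
    simp at hz
  unfold gossipTime
  rcases h : averagingTime μ ε with _ | a
  · exact le_top
  have ha : averagingTime μ ε ≤ (a : ℕ∞) := h.le
  have h1 := (le_iSup₂ (f := fun (z₀ : V → ℝ) (_ : z₀ ≠ 0) =>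
    ⨅ (t : ℕ) (_ : (gossipState μ z₀ t).toOuterMeasure
        {z | ε ≤ euclNorm (fun n => z n - average z₀) / euclNorm z₀} ≤ ENNReal.ofReal ε),
      (t : ℕ∞)) z hz0).trans ha
  -- An infimum of times that is at most the finite `a` is witnessed by some admissible t ≤ a;
  -- otherwise it would be at least a + 1.
  have h2 : ∃ t : ℕ, (gossipState μ z t).toOuterMeasure
      {y | ε ≤ euclNorm (fun n => y n - average z) / euclNorm z} ≤ ENNReal.ofReal ε ∧ t ≤ a := by
    by_contra! hcon
    have h3 : ((a + 1 : ℕ) : ℕ∞) ≤ a := by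
      refine le_trans (le_iInf₂ fun t ht => ?_) h1
      exact_mod_cast hcon t ht
    have : a + 1 ≤ a := by exact_mod_cast h3
    omega
  obtain ⟨t, ht, hta⟩ := h2
  calc T ≤ t := hT t (pow_le_of_toOuterMeasure_le μ hμ z hz havg η hη1 hlip t ε hε hε1 ht)
    _ ≤ a := by exact_mod_cast hta
    _ = _ := rfl

end Gossip

end

noncomputable section

/-! ### A Poincaré inequality on a square grid -/

theorem sq_sub_le_sum_range (f : ℕ → ℝ) (M i j : ℕ) (hi : i < M) (hj : j < M) :
    (f i - f j) ^ 2 ≤ M * ∑ k ∈ Finset.range (M - 1), (f (k + 1) - f k) ^ 2 := by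
  wlog hij : j ≤ i generalizing i j
  · rw [show (f i - f j) ^ 2 = (f j - f i) ^ 2 by ring]
    exact this j i hj hi (by omega)
  have h1 : f i - f j = ∑ k ∈ Finset.Ico j i, (f (k + 1) - f k) :=
    (Finset.sum_Ico_sub f hij).symm
  rw [h1]
  calc _ ≤ ((Finset.Ico j i).card : ℝ) * ∑ k ∈ Finset.Ico j i, (f (k + 1) - f k) ^ 2 :=
        sq_sum_le_card_mul_sum_sq
    _ ≤ _ := by
        apply mul_le_mul
        · rw [Nat.card_Ico]
          exact_mod_cast (by omega : i - j ≤ M)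
        · apply Finset.sum_le_sum_of_subset_of_nonneg
          · intro k hk
            simp only [Finset.mem_Ico, Finset.mem_range] at hk ⊢
            omega
          · exact fun _ _ _ => sq_nonneg _
        · exact Finset.sum_nonneg fun _ _ => sq_nonneg _
        · positivity

/-- Every point is joined to (a₀, 0) by its column down or up to row a₀, then along that row. -/
theorem exists_sum_sq_sub_le_grid (y : ℕ → ℕ → ℝ) (M : ℕ) :
    ∃ c : ℝ, ∑ a ∈ Finset.range M, ∑ b ∈ Finset.range M, (y a b - c) ^ 2 ≤
      2 * (M : ℝ) ^ 2 *
        (∑ a ∈ Finset.range M, ∑ b ∈ Finset.range (M - 1), (y a (b + 1) - y a b) ^ 2 +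
          ∑ b ∈ Finset.range M, ∑ a ∈ Finset.range (M - 1), (y (a + 1) b - y a b) ^ 2) := by
  rcases Nat.eq_zero_or_pos M with rfl | hM
  · exact ⟨0, by simp⟩
  set rowE : ℕ → ℝ := fun a => ∑ b ∈ Finset.range (M - 1), (y a (b + 1) - y a b) ^ 2 with hrow
  set colE : ℕ → ℝ := fun b => ∑ a ∈ Finset.range (M - 1), (y (a + 1) b - y a b) ^ 2 with hcol
  -- The row of least energy: it serves all M² points, and having at most the average row energy
  -- compensates for this multiplicity. An arbitrary row would cost an extra factor M.
  obtain ⟨a₀, ha₀, hmin⟩ := Finset.exists_min_image (Finset.range M) rowE ⟨0, by simpa using hM⟩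
  have ha₀' := Finset.mem_range.mp ha₀
  have hmean : (M : ℝ) * rowE a₀ ≤ ∑ a ∈ Finset.range M, rowE a := by
    have := Finset.card_nsmul_le_sum (Finset.range M) rowE _ hmin
    simpa using this
  refine ⟨y a₀ 0, ?_⟩
  have hpt : ∀ a ∈ Finset.range M, ∀ b ∈ Finset.range M,
      (y a b - y a₀ 0) ^ 2 ≤ 2 * (M * colE b) + 2 * (M * rowE a₀) := by
    intro a ha b hb
    have h1 := sq_sub_le_sum_range (fun k => y k b) M a a₀ (Finset.mem_range.mp ha) ha₀'
    have h2 := sq_sub_le_sum_range (fun k => y a₀ k) M b 0 (Finset.mem_range.mp hb) hM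
    have h3 : (y a b - y a₀ 0) ^ 2 ≤ 2 * (y a b - y a₀ b) ^ 2 + 2 * (y a₀ b - y a₀ 0) ^ 2 := by
      nlinarith [sq_nonneg ((y a b - y a₀ b) - (y a₀ b - y a₀ 0))]
    simp only [hrow, hcol]
    linarith
  calc _ ≤ ∑ a ∈ Finset.range M, ∑ b ∈ Finset.range M, (2 * (M * colE b) + 2 * (M * rowE a₀)) :=
        Finset.sum_le_sum fun a ha => Finset.sum_le_sum fun b hb => hpt a ha b hb
    _ = 2 * (M : ℝ) ^ 2 * (M * rowE a₀ + ∑ b ∈ Finset.range M, colE b) := by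
        simp only [Finset.sum_add_distrib, Finset.sum_const, Finset.card_range, nsmul_eq_mul,
          ← Finset.mul_sum]
        ring
    _ ≤ _ := by gcongr

/-! ### Dirichlet energy of a graph -/

section Energy

variable {V : Type*} [Fintype V]

open Classical in
/-- The Dirichlet energy of a function on a graph; every edge is counted in both directions. -/
def dirichletEnergy (H : SimpleGraph V) (z : V → ℝ) : ℝ :=
  ∑ u, ∑ w, if H.Adj u w then (z u - z w) ^ 2 else 0

theorem dirichletEnergy_nonneg (H : SimpleGraph V) (z : V → ℝ) : 0 ≤ dirichletEnergy H z :=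
  Finset.sum_nonneg fun _ _ => Finset.sum_nonneg fun _ _ => by split_ifs <;> positivity

theorem sum_sum_sq_sub_le_dirichletEnergy (H : SimpleGraph V) (z : V → ℝ) (A B : Finset V)
    (h : ∀ u ∈ A, ∀ w ∈ B, H.Adj u w) :
    ∑ u ∈ A, ∑ w ∈ B, (z u - z w) ^ 2 ≤ dirichletEnergy H z := by
  classical
  have hnn : ∀ u w, 0 ≤ if H.Adj u w then (z u - z w) ^ 2 else 0 := fun u w => by
    split_ifs <;> positivity
  calc _ = ∑ u ∈ A, ∑ w ∈ B, if H.Adj u w then (z u - z w) ^ 2 else 0 :=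
        Finset.sum_congr rfl fun u hu => Finset.sum_congr rfl fun w hw => by
          rw [if_pos (h u hu w hw)]
    _ ≤ ∑ u ∈ A, ∑ w, if H.Adj u w then (z u - z w) ^ 2 else 0 :=
        Finset.sum_le_sum fun u _ =>
          Finset.sum_le_sum_of_subset_of_nonneg (Finset.subset_univ _) fun w _ _ => hnn u w
    _ ≤ ∑ u, ∑ w, if H.Adj u w then (z u - z w) ^ 2 else 0 :=
        Finset.sum_le_sum_of_subset_of_nonneg (Finset.subset_univ _)
          fun u _ _ => Finset.sum_nonneg fun w _ => hnn u w
    _ = dirichletEnergy H z := by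
        unfold dirichletEnergy
        congr! 5

theorem abs_sub_le_sqrt_dirichletEnergy {H : SimpleGraph V} (z : V → ℝ) {u w : V}
    (h : H.Adj u w) : |z u - z w| ≤ Real.sqrt (dirichletEnergy H z) := by
  apply Real.abs_le_sqrt
  simpa using sum_sum_sq_sub_le_dirichletEnergy H z {u} {w} (by simpa using h)

/-- A deliberately crude bound, with the whole energy charged for every edge; it is used only inside
single windows. -/
theorem abs_sub_le_length_mul {H : SimpleGraph V} (z : V → ℝ) {u w : V} (p : H.Walk u w) :
    |z u - z w| ≤ p.length * Real.sqrt (dirichletEnergy H z) := by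
  induction p with
  | nil => simp
  | @cons a b c hab q ih =>
    have h1 := abs_sub_le_sqrt_dirichletEnergy z hab
    have h2 := abs_sub_le (z a) (z b) (z c)
    rw [SimpleGraph.Walk.length_cons]
    push_cast
    linarith

end Energy

/-! ### Graphs with a cell structure -/

/-- The cells of the window of three by three blocks of side `L` whose central block has its lower
corner at `(x, y)`. -/
def windowCells (L x y : ℤ) : Finset (ℤ × ℤ) :=
  Finset.Ico (x - L) (x + 2 * L) ×ˢ Finset.Ico (y - L) (y + 2 * L)

theorem mem_windowCells {L x y : ℤ} {c : ℤ × ℤ} : c ∈ windowCells L x y ↔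
    (x - L ≤ c.1 ∧ c.1 < x + 2 * L) ∧ (y - L ≤ c.2 ∧ c.2 < y + 2 * L) := by
  simp [windowCells]

/-- The cells of a square grid of side `m`. -/
def gridCells (m : ℤ) : Finset (ℤ × ℤ) := Finset.Ico 0 m ×ˢ Finset.Ico 0 m

theorem mem_gridCells {m : ℤ} {c : ℤ × ℤ} :
    c ∈ gridCells m ↔ (0 ≤ c.1 ∧ c.1 < m) ∧ (0 ≤ c.2 ∧ c.2 < m) := by
  simp [gridCells]

section Cells

variable {V : Type*} [Fintype V] (H : SimpleGraph V) (cell : V → ℤ × ℤ)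

open Classical in
/-- The nodes in a cell. -/
def cellNodes (c : ℤ × ℤ) : Finset V := {v | cell v = c}

/-- The subgraph of the edges between nodes in the given cells. -/
def cellGraph (W : Finset (ℤ × ℤ)) : SimpleGraph V where
  Adj u w := H.Adj u w ∧ cell u ∈ W ∧ cell w ∈ W
  symm := ⟨fun _ _ h => ⟨h.1.symm, h.2.2, h.2.1⟩⟩
  loopless := ⟨fun _ h => H.loopless.irrefl _ h.1⟩

/-- The mean of a function over the nodes in a cell. -/
def cellMean (z : V → ℝ) (c : ℤ × ℤ) : ℝ :=
  (∑ v ∈ cellNodes cell c, z v) / (cellNodes cell c).card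

variable {H cell}

@[simp]
theorem mem_cellNodes {c : ℤ × ℤ} {v : V} : v ∈ cellNodes cell c ↔ cell v = c := by
  simp [cellNodes]

open Classical in
theorem card_filter_cell_mem_le (S : Finset (ℤ × ℤ)) (U : ℝ)
    (hU : ∀ c, ((cellNodes cell c).card : ℝ) ≤ U) :
    ((Finset.univ.filter fun v => cell v ∈ S).card : ℝ) ≤ S.card * U := by
  have h := Finset.card_eq_sum_card_fiberwise (f := cell)
    (s := Finset.univ.filter fun v => cell v ∈ S) (t := S) (fun v hv => by simpa using hv)
  rw [h]
  push_cast
  calc _ ≤ ∑ c ∈ S, U := by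
        refine Finset.sum_le_sum fun c _ => le_trans ?_ (hU c)
        exact_mod_cast Finset.card_le_card fun v hv => by
          simp only [Finset.mem_filter] at hv
          simpa using hv.2
    _ = _ := by simp

theorem abs_sub_cellMean_le (z : V → ℝ) (c : ℤ × ℤ) (x D : ℝ) (hne : (cellNodes cell c).Nonempty)
    (h : ∀ u, cell u = c → |x - z u| ≤ D) : |x - cellMean cell z c| ≤ D := by
  have hc : (0 : ℝ) < (cellNodes cell c).card := by exact_mod_cast hne.card_pos
  have h1 : x - cellMean cell z c =
      (∑ v ∈ cellNodes cell c, (x - z v)) / (cellNodes cell c).card := by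
    rw [cellMean, Finset.sum_sub_distrib, Finset.sum_const, nsmul_eq_mul]
    field_simp
  rw [h1, abs_div, abs_of_pos hc, div_le_iff₀ hc]
  calc _ ≤ ∑ v ∈ cellNodes cell c, |x - z v| := Finset.abs_sum_le_sum_abs _ _
    _ ≤ ∑ v ∈ cellNodes cell c, D := Finset.sum_le_sum fun v hv => h v (mem_cellNodes.mp hv)
    _ = _ := by rw [Finset.sum_const, nsmul_eq_mul, mul_comm]

/-- Two cells that coincide or share a side. -/
def CellsTouch (c d : ℤ × ℤ) : Prop := |c.1 - d.1| + |c.2 - d.2| ≤ 1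

/-- All pairs between the two cells are edges, at least h² of them. Averaging over the pairs by
Cauchy–Schwarz gains the factor h², which sets the order of the Poincaré constant. -/
theorem abs_cellMean_sub_le
    (hadj : ∀ u w, u ≠ w → CellsTouch (cell u) (cell w) → H.Adj u w)
    (z : V → ℝ) {h : ℝ} (hh : 0 < h) {W : Finset (ℤ × ℤ)} {c d : ℤ × ℤ} (hcd : c ≠ d)
    (htouch : CellsTouch c d) (hc : h ≤ (cellNodes cell c).card)
    (hd : h ≤ (cellNodes cell d).card) (hcW : c ∈ W) (hdW : d ∈ W) :
    |cellMean cell z c - cellMean cell z d| ≤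
      Real.sqrt (dirichletEnergy (cellGraph H cell W) z) / h := by
  set A := cellNodes cell c
  set B := cellNodes cell d
  have hA : (0 : ℝ) < A.card := hh.trans_le hc
  have hB : (0 : ℝ) < B.card := hh.trans_le hd
  have hE := sum_sum_sq_sub_le_dirichletEnergy (cellGraph H cell W) z A B (by
    intro u hu w hw
    rw [mem_cellNodes] at hu hw
    refine ⟨hadj u w ?_ (by rwa [hu, hw]), by rwa [hu], by rwa [hw]⟩
    rintro rfl
    exact hcd (hu.symm.trans hw))
  have hsum : ∑ u ∈ A, ∑ w ∈ B, (z u - z w) =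
      (A.card * B.card) * (cellMean cell z c - cellMean cell z d) := by
    rw [show cellMean cell z c = (∑ v ∈ A, z v) / A.card from rfl,
      show cellMean cell z d = (∑ v ∈ B, z v) / B.card from rfl]
    simp only [Finset.sum_sub_distrib, Finset.sum_const, nsmul_eq_mul, ← Finset.mul_sum]
    field_simp
  have hcs : (∑ u ∈ A, ∑ w ∈ B, (z u - z w)) ^ 2 ≤
      (A.card * B.card) * ∑ u ∈ A, ∑ w ∈ B, (z u - z w) ^ 2 := by
    rw [← Finset.sum_product', ← Finset.sum_product']
    have := sq_sum_le_card_mul_sum_sq (s := A ×ˢ B) (f := fun p => z p.1 - z p.2)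
    rwa [Finset.card_product, Nat.cast_mul] at this
  rw [hsum] at hcs
  have h1 : (A.card * B.card : ℝ) * (cellMean cell z c - cellMean cell z d) ^ 2 ≤
      dirichletEnergy (cellGraph H cell W) z := by
    have hAB : (0 : ℝ) < A.card * B.card := by positivity
    have : (A.card * B.card : ℝ) * ((A.card * B.card : ℝ) *
        (cellMean cell z c - cellMean cell z d) ^ 2) ≤
        (A.card * B.card) * ∑ u ∈ A, ∑ w ∈ B, (z u - z w) ^ 2 := by
      linarith [hcs, show ((A.card * B.card : ℝ) *
        (cellMean cell z c - cellMean cell z d)) ^ 2 = (A.card * B.card : ℝ) *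
        ((A.card * B.card : ℝ) * (cellMean cell z c - cellMean cell z d) ^ 2) by ring]
    exact (le_of_mul_le_mul_left this hAB).trans hE
  rw [le_div_iff₀ hh]
  apply Real.le_sqrt_of_sq_le
  rw [mul_pow, sq_abs, mul_comm]
  refine le_trans ?_ h1
  gcongr
  rw [sq]
  gcongr

theorem abs_sub_le_of_abs_succ_sub_le (g : ℤ → ℝ) (D : ℝ) (p q : ℤ)
    (h : ∀ k ∈ Set.uIcc p q, k + 1 ∈ Set.uIcc p q → |g k - g (k + 1)| ≤ D) :
    |g p - g q| ≤ |(p - q : ℝ)| * D := by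
  wlog hpq : p ≤ q generalizing p q
  · rw [abs_sub_comm (g p), abs_sub_comm (p : ℝ)]
    exact this q p (by rwa [Set.uIcc_comm]) (by omega)
  rw [Set.uIcc_of_le hpq] at h
  have key : ∀ k, p ≤ k → k ≤ q → |g p - g k| ≤ (k - p) * D := by
    intro k hk
    induction k, hk using Int.leInduction with
    | base => simp
    | succ k hk ih =>
      intro hkq
      have h1 := ih (by omega)
      have h2 := h k ⟨hk, by omega⟩ ⟨by omega, hkq⟩
      have h3 := abs_sub_le (g p) (g k) (g (k + 1))
      push_cast
      linarith
  have h4 : |(p - q : ℝ)| = q - p := by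
    rw [abs_sub_comm, abs_of_nonneg]
    exact sub_nonneg.mpr (by exact_mod_cast hpq)
  rw [h4]
  exact key q hpq le_rfl

/-- A sequence of cells in which neighboring cells share a side. -/
def IsCellLine (c : ℤ → ℤ × ℤ) : Prop := ∀ k, c k ≠ c (k + 1) ∧ CellsTouch (c k) (c (k + 1))

theorem isCellLine_row (i : ℤ) : IsCellLine fun k => (i, k) := fun k =>
  ⟨fun h => by simp at h, by simp [CellsTouch]⟩

theorem isCellLine_col (j : ℤ) : IsCellLine fun k => (k, j) := fun k =>
  ⟨fun h => by simp at h, by simp [CellsTouch]⟩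

theorem abs_cellMean_sub_le_of_line
    (hadj : ∀ u w, u ≠ w → CellsTouch (cell u) (cell w) → H.Adj u w)
    (z : V → ℝ) {h : ℝ} (hh : 0 < h) {W : Finset (ℤ × ℤ)} {c : ℤ → ℤ × ℤ} (hc : IsCellLine c)
    (p q : ℤ) (hgood : ∀ k ∈ Set.uIcc p q, c k ∈ W ∧ h ≤ (cellNodes cell (c k)).card) :
    |cellMean cell z (c p) - cellMean cell z (c q)| ≤
      |(p - q : ℝ)| * (Real.sqrt (dirichletEnergy (cellGraph H cell W) z) / h) :=
  abs_sub_le_of_abs_succ_sub_le (fun k => cellMean cell z (c k)) _ p q fun k hk hk' =>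
    abs_cellMean_sub_le hadj z hh (hc k).1 (hc k).2 (hgood k hk).2 (hgood _ hk').2
      (hgood k hk).1 (hgood _ hk').1

theorem reachable_of_line
    (hadj : ∀ u w, u ≠ w → CellsTouch (cell u) (cell w) → H.Adj u w)
    {W : Finset (ℤ × ℤ)} {c : ℤ → ℤ × ℤ} (hc : IsCellLine c)
    (p q : ℤ) (hgood : ∀ k ∈ Set.uIcc p q, c k ∈ W ∧ (cellNodes cell (c k)).Nonempty)
    {u w : V} (hu : cell u = c p) (hw : cell w = c q) :
    (cellGraph H cell W).Reachable u w := by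
  wlog hpq : p ≤ q generalizing p q u w
  · exact (this q p (by rwa [Set.uIcc_comm]) hw hu (by omega)).symm
  rw [Set.uIcc_of_le hpq] at hgood
  have hstep : ∀ a b : V, CellsTouch (cell a) (cell b) → cell a ∈ W → cell b ∈ W →
      (cellGraph H cell W).Reachable a b := by
    intro a b hab ha hb
    rcases eq_or_ne a b with rfl | hne
    · exact .refl _
    · exact SimpleGraph.Adj.reachable ⟨hadj a b hne hab, ha, hb⟩
  have key : ∀ k, p ≤ k → k ≤ q → ∀ w, cell w = c k → (cellGraph H cell W).Reachable u w := by
    intro k hk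
    induction k, hk using Int.leInduction with
    | base =>
      intro _ w hw
      have := (hgood p ⟨le_rfl, hpq⟩).1
      exact hstep u w (by simp [hu, hw, CellsTouch]) (by rwa [hu]) (by rwa [hw])
    | succ k hk ih =>
      intro hkq w hw
      have h1 := hgood k ⟨hk, by omega⟩
      obtain ⟨a, ha⟩ := h1.2
      rw [mem_cellNodes] at ha
      refine (ih (by omega) a ha).trans (hstep a w ?_ (by rw [ha]; exact h1.1) ?_)
      · rw [ha, hw]
        exact (hc k).2
      · rw [hw]
        exact (hgood _ ⟨by omega, hkq⟩).1
  exact key q hpq le_rfl w hw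

-- A path has no repeated vertex and stays in the cells of W, so its length is at most the number of
-- nodes there.
open Classical in
theorem abs_sub_le_of_reachable_cellGraph (z : V → ℝ) {W : Finset (ℤ × ℤ)} {u w : V}
    (hu : cell u ∈ W) (huw : (cellGraph H cell W).Reachable u w) :
    |z u - z w| ≤ (Finset.univ.filter fun v => cell v ∈ W).card *
      Real.sqrt (dirichletEnergy (cellGraph H cell W) z) := by
  obtain ⟨p, hp⟩ := huw.exists_isPath
  refine (abs_sub_le_length_mul z p).trans ?_
  gcongr
  have hsub : ∀ {a b : V} (p : (cellGraph H cell W).Walk a b), cell a ∈ W →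
      ∀ v ∈ p.support, cell v ∈ W := by
    intro a b p
    induction p with
    | nil => simp
    | cons hab q ih =>
      intro ha v hv
      rw [SimpleGraph.Walk.support_cons, List.mem_cons] at hv
      rcases hv with rfl | hv
      · exact ha
      · exact ih hab.2.2 v hv
  calc p.length ≤ p.support.length := by rw [SimpleGraph.Walk.length_support]; omega
    _ = p.support.toFinset.card := (List.toFinset_card_of_nodup hp.support_nodup).symm
    _ ≤ _ := Finset.card_le_card fun v hv => by
        simpa using hsub p hu v (List.mem_toFinset.mp hv)

/-- Pigeonhole: k disjoint strips of width R and fewer than k bad elements leave one strip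
untouched. -/
theorem exists_int_Ico_avoiding {α : Type*} (bad : Finset α) (f : α → ℤ) (R k : ℕ) (hR : 0 < R)
    (hbad : bad.card < k) (x : ℤ) :
    ∃ ρ, x ≤ ρ ∧ ρ + R ≤ x + (k * R : ℕ) ∧ ∀ c ∈ bad, ¬ (ρ ≤ f c ∧ f c < ρ + R) := by
  classical
  have hcard : (bad.image fun c => (f c - x) / R).card < (Finset.Ico (0 : ℤ) k).card := by
    refine (Finset.card_image_le).trans_lt ?_
    simpa using hbad
  obtain ⟨g, hg, hg'⟩ := Finset.exists_mem_notMem_of_card_lt_card hcard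
  rw [Finset.mem_Ico] at hg
  have hR' : (0 : ℤ) < R := by exact_mod_cast hR
  refine ⟨x + g * R, ?_, ?_, ?_⟩
  · have := mul_nonneg hg.1 hR'.le
    omega
  · have : (g + 1) * R ≤ k * R := by
      apply mul_le_mul_of_nonneg_right _ hR'.le
      omega
    push_cast
    linarith
  · rintro c hc ⟨h1, h2⟩
    apply hg'
    rw [Finset.mem_image]
    refine ⟨c, hc, ?_⟩
    apply le_antisymm
    · apply Int.lt_add_one_iff.mp
      apply Int.ediv_lt_of_lt_mul hR'
      linarith
    · apply Int.le_ediv_of_mul_le hR'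
      linarith

end Cells

end

noncomputable section

/-! ### The spectral gap of a well occupied graph -/

/-- Nodes in an `M * L` by `M * L` grid of cells, with all pairs of nodes in touching cells joined,
no edge spanning more than `R` rows or columns, at most `U` nodes in each cell, and fewer than `k`
cells with less than `h` nodes in each window of three by three blocks of side `L = k * R`. -/
structure WellOccupied {V : Type*} [Fintype V] (H : SimpleGraph V) (cell : V → ℤ × ℤ)
    (M k R : ℕ) (U h : ℝ) : Prop where
  cell_mem : ∀ v, cell v ∈ gridCells (M * (k * R : ℕ))
  adj_of_touch : ∀ u w, u ≠ w → CellsTouch (cell u) (cell w) → H.Adj u w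
  near_of_adj : ∀ u w, H.Adj u w → |(cell u).1 - (cell w).1| ≤ R ∧ |(cell u).2 - (cell w).2| ≤ R
  preconnected : H.Preconnected
  pos_range : 0 < R
  pos_threshold : 0 < h
  card_le : ∀ c, ((cellNodes cell c).card : ℝ) ≤ U
  few_bad : ∀ a b : ℕ, a < M → b < M → ((windowCells (k * R : ℕ) (a * (k * R : ℕ))
    (b * (k * R : ℕ)) ∩ gridCells (M * (k * R : ℕ))).filter
      fun c => ((cellNodes cell c).card : ℝ) < h).card < k

namespace WellOccupied

variable {V : Type*} [Fintype V] {H : SimpleGraph V} {cell : V → ℤ × ℤ} {M k R : ℕ} {U h : ℝ}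

/-- The row `i` has no sparse cell in the window. -/
def GoodRow (cell : V → ℤ × ℤ) (h : ℝ) (m L x y i : ℤ) : Prop :=
  ∀ j, (i, j) ∈ windowCells L x y → (i, j) ∈ gridCells m → h ≤ (cellNodes cell (i, j)).card

/-- The column `j` has no sparse cell in the window. -/
def GoodCol (cell : V → ℤ × ℤ) (h : ℝ) (m L x y j : ℤ) : Prop :=
  ∀ i, (i, j) ∈ windowCells L x y → (i, j) ∈ gridCells m → h ≤ (cellNodes cell (i, j)).card

/-- Yields R consecutive good rows, a strip wide enough that no edge of the graph can jump over it.
-/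
theorem exists_goodRows (hW : WellOccupied H cell M k R U h) {a b : ℕ} (ha : a < M) (hb : b < M)
    (x : ℤ) : ∃ ρ, x ≤ ρ ∧ ρ + R ≤ x + (k * R : ℕ) ∧ ∀ i, ρ ≤ i → i < ρ + R →
      GoodRow cell h (M * (k * R : ℕ)) (k * R : ℕ) (a * (k * R : ℕ)) (b * (k * R : ℕ)) i := by
  obtain ⟨ρ, h1, h2, h3⟩ := exists_int_Ico_avoiding _ Prod.fst R k hW.pos_range
    (hW.few_bad a b ha hb) x
  refine ⟨ρ, h1, h2, fun i hi hi' j hj hj' => ?_⟩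
  by_contra hlt
  exact h3 (i, j) (Finset.mem_filter.mpr ⟨Finset.mem_inter.mpr ⟨hj, hj'⟩, not_le.mp hlt⟩) ⟨hi, hi'⟩

theorem exists_goodCols (hW : WellOccupied H cell M k R U h) {a b : ℕ} (ha : a < M) (hb : b < M)
    (x : ℤ) : ∃ ρ, x ≤ ρ ∧ ρ + R ≤ x + (k * R : ℕ) ∧ ∀ j, ρ ≤ j → j < ρ + R →
      GoodCol cell h (M * (k * R : ℕ)) (k * R : ℕ) (a * (k * R : ℕ)) (b * (k * R : ℕ)) j := by
  obtain ⟨ρ, h1, h2, h3⟩ := exists_int_Ico_avoiding _ Prod.snd R k hW.pos_range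
    (hW.few_bad a b ha hb) x
  refine ⟨ρ, h1, h2, fun j hi hi' i hj hj' => ?_⟩
  by_contra hlt
  exact h3 (i, j) (Finset.mem_filter.mpr ⟨Finset.mem_inter.mpr ⟨hj, hj'⟩, not_le.mp hlt⟩) ⟨hi, hi'⟩

theorem block_bounds {a M : ℕ} (L : ℕ) (ha : a < M) :
    (0 : ℤ) ≤ a * (L : ℤ) ∧ (a : ℤ) * L + L ≤ M * L := by
  constructor
  · positivity
  · have : ((a : ℤ) + 1) * L ≤ M * L := by
      gcongr
      exact_mod_cast ha
    linarith

/-- The row and the column of a representative cell of a block. -/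
theorem exists_rep (hW : WellOccupied H cell M k R U h) {a b : ℕ} (ha : a < M) (hb : b < M) :
    ∃ c : ℤ × ℤ, ((a * (k * R : ℕ) : ℤ) ≤ c.1 ∧ c.1 < a * (k * R : ℕ) + (k * R : ℕ)) ∧
      ((b * (k * R : ℕ) : ℤ) ≤ c.2 ∧ c.2 < b * (k * R : ℕ) + (k * R : ℕ)) ∧
      GoodRow cell h (M * (k * R : ℕ)) (k * R : ℕ) (a * (k * R : ℕ)) (b * (k * R : ℕ)) c.1 ∧
      GoodCol cell h (M * (k * R : ℕ)) (k * R : ℕ) (a * (k * R : ℕ)) (b * (k * R : ℕ)) c.2 := by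
  have hR := hW.pos_range
  obtain ⟨i, h1, h2, h3⟩ := hW.exists_goodRows ha hb (a * (k * R : ℕ))
  obtain ⟨j, h4, h5, h6⟩ := hW.exists_goodCols ha hb (b * (k * R : ℕ))
  exact ⟨(i, j), ⟨h1, by dsimp only; omega⟩, ⟨h4, by dsimp only; omega⟩,
    h3 i le_rfl (by omega), h6 j le_rfl (by omega)⟩

open Classical in
/-- A representative cell of the block `(a, b)`. -/
def rep (hW : WellOccupied H cell M k R U h) (a b : ℕ) : ℤ × ℤ :=
  if hab : a < M ∧ b < M then (hW.exists_rep hab.1 hab.2).choose else 0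

theorem rep_spec (hW : WellOccupied H cell M k R U h) {a b : ℕ} (ha : a < M) (hb : b < M) :
    ((a * (k * R : ℕ) : ℤ) ≤ (hW.rep a b).1 ∧
      (hW.rep a b).1 < a * (k * R : ℕ) + (k * R : ℕ)) ∧
      ((b * (k * R : ℕ) : ℤ) ≤ (hW.rep a b).2 ∧
        (hW.rep a b).2 < b * (k * R : ℕ) + (k * R : ℕ)) ∧
      GoodRow cell h (M * (k * R : ℕ)) (k * R : ℕ) (a * (k * R : ℕ)) (b * (k * R : ℕ))
        (hW.rep a b).1 ∧
      GoodCol cell h (M * (k * R : ℕ)) (k * R : ℕ) (a * (k * R : ℕ)) (b * (k * R : ℕ))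
        (hW.rep a b).2 := by
  have := (hW.exists_rep ha hb).choose_spec
  rw [rep, dif_pos ⟨ha, hb⟩]
  exact this

/-- The energy of the edges in the window around the block `(a, b)`. -/
def windowEnergy (H : SimpleGraph V) (cell : V → ℤ × ℤ) (L : ℕ) (z : V → ℝ) (a b : ℕ) : ℝ :=
  dirichletEnergy (cellGraph H cell (windowCells L (a * L) (b * L))) z

theorem le_card_rep (hW : WellOccupied H cell M k R U h) {a b : ℕ} (ha : a < M) (hb : b < M) :
    h ≤ (cellNodes cell (hW.rep a b)).card := by
  obtain ⟨h1, h2, h3, -⟩ := hW.rep_spec ha hb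
  have hx := block_bounds (k * R) ha
  have hy := block_bounds (k * R) hb
  refine h3 (hW.rep a b).2 ?_ ?_
  · rw [mem_windowCells]
    dsimp only
    omega
  · rw [mem_gridCells]
    dsimp only
    omega

theorem nonempty_of_le_card (hW : WellOccupied H cell M k R U h) {c : ℤ × ℤ}
    (hc : h ≤ (cellNodes cell c).card) : (cellNodes cell c).Nonempty := by
  rw [← Finset.card_pos]
  exact_mod_cast hW.pos_threshold.trans_le hc

/-- Follow the good row to the good column of the representative cell, then that column. The two
lines cross in a cell that is not sparse and so contains a node. -/
theorem reachable_rep_of_goodRow (hW : WellOccupied H cell M k R U h) {a b : ℕ} (ha : a < M)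
    (hb : b < M) {u w : V} (hu : cell u = hW.rep a b)
    (hwW : cell w ∈ windowCells (k * R : ℕ) (a * (k * R : ℕ)) (b * (k * R : ℕ)))
    (hrow : GoodRow cell h (M * (k * R : ℕ)) (k * R : ℕ) (a * (k * R : ℕ)) (b * (k * R : ℕ))
      (cell w).1) :
    (cellGraph H cell (windowCells (k * R : ℕ) (a * (k * R : ℕ)) (b * (k * R : ℕ)))).Reachable
      w u := by
  obtain ⟨h1, h2, h3, h4⟩ := hW.rep_spec ha hb
  have hx := block_bounds (k * R) ha
  have hy := block_bounds (k * R) hb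
  have hg := hW.cell_mem w
  rw [mem_windowCells] at hwW
  rw [mem_gridCells] at hg
  have hrow' : ∀ j ∈ Set.uIcc (cell w).2 (hW.rep a b).2,
      ((cell w).1, j) ∈ windowCells (k * R : ℕ) (a * (k * R : ℕ)) (b * (k * R : ℕ)) ∧
        h ≤ (cellNodes cell ((cell w).1, j)).card := by
    intro j hj
    rw [Set.mem_uIcc] at hj
    have hjW : ((cell w).1, j) ∈ windowCells (k * R : ℕ) (a * (k * R : ℕ)) (b * (k * R : ℕ)) := by
      rw [mem_windowCells]
      dsimp only
      omega
    refine ⟨hjW, hrow j hjW ?_⟩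
    rw [mem_gridCells]
    dsimp only
    omega
  have hcol' : ∀ i ∈ Set.uIcc (cell w).1 (hW.rep a b).1,
      (i, (hW.rep a b).2) ∈ windowCells (k * R : ℕ) (a * (k * R : ℕ)) (b * (k * R : ℕ)) ∧
        h ≤ (cellNodes cell (i, (hW.rep a b).2)).card := by
    intro i hi
    rw [Set.mem_uIcc] at hi
    have hiW : (i, (hW.rep a b).2) ∈
        windowCells (k * R : ℕ) (a * (k * R : ℕ)) (b * (k * R : ℕ)) := by
      rw [mem_windowCells]
      dsimp only
      omega
    refine ⟨hiW, h4 i hiW ?_⟩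
    rw [mem_gridCells]
    dsimp only
    omega
  obtain ⟨v, hv⟩ := hW.nonempty_of_le_card (hrow' _ Set.right_mem_uIcc).2
  rw [mem_cellNodes] at hv
  have r1 := reachable_of_line hW.adj_of_touch (isCellLine_row (cell w).1) (cell w).2
    (hW.rep a b).2 (fun j hj => ⟨(hrow' j hj).1, hW.nonempty_of_le_card (hrow' j hj).2⟩)
    (u := w) (w := v) rfl hv
  have r2 := reachable_of_line hW.adj_of_touch (isCellLine_col (hW.rep a b).2) (cell w).1
    (hW.rep a b).1 (fun j hj => ⟨(hcol' j hj).1, hW.nonempty_of_le_card (hcol' j hj).2⟩)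
    (u := v) (w := u) hv hu
  exact r1.trans r2

theorem reachable_rep_of_goodCol (hW : WellOccupied H cell M k R U h) {a b : ℕ} (ha : a < M)
    (hb : b < M) {u w : V} (hu : cell u = hW.rep a b)
    (hwW : cell w ∈ windowCells (k * R : ℕ) (a * (k * R : ℕ)) (b * (k * R : ℕ)))
    (hcol : GoodCol cell h (M * (k * R : ℕ)) (k * R : ℕ) (a * (k * R : ℕ)) (b * (k * R : ℕ))
      (cell w).2) :
    (cellGraph H cell (windowCells (k * R : ℕ) (a * (k * R : ℕ)) (b * (k * R : ℕ)))).Reachable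
      w u := by
  obtain ⟨h1, h2, h3, h4⟩ := hW.rep_spec ha hb
  have hx := block_bounds (k * R) ha
  have hy := block_bounds (k * R) hb
  have hg := hW.cell_mem w
  rw [mem_windowCells] at hwW
  rw [mem_gridCells] at hg
  have hcol' : ∀ i ∈ Set.uIcc (cell w).1 (hW.rep a b).1,
      (i, (cell w).2) ∈ windowCells (k * R : ℕ) (a * (k * R : ℕ)) (b * (k * R : ℕ)) ∧
        h ≤ (cellNodes cell (i, (cell w).2)).card := by
    intro i hi
    rw [Set.mem_uIcc] at hi
    have hiW : (i, (cell w).2) ∈ windowCells (k * R : ℕ) (a * (k * R : ℕ)) (b * (k * R : ℕ)) := by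
      rw [mem_windowCells]
      dsimp only
      omega
    refine ⟨hiW, hcol i hiW ?_⟩
    rw [mem_gridCells]
    dsimp only
    omega
  obtain ⟨v, hv⟩ := hW.nonempty_of_le_card (hcol' _ Set.right_mem_uIcc).2
  rw [mem_cellNodes] at hv
  have r1 := reachable_of_line hW.adj_of_touch (isCellLine_col (cell w).2) (cell w).1
    (hW.rep a b).1 (fun j hj => ⟨(hcol' j hj).1, hW.nonempty_of_le_card (hcol' j hj).2⟩)
    (u := w) (w := v) rfl hv
  exact r1.trans (hW.reachable_rep_of_goodRow ha hb hu (by rw [hv]; exact (hcol' _ Set.right_mem_uIcc).1) (by rw [hv]; exact h3))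

/-- Every node of a block is joined inside the window to every node of the representative cell. -/
theorem reachable_rep (hW : WellOccupied H cell M k R U h) {a b : ℕ} (ha : a < M) (hb : b < M)
    {v u : V} (hv1 : (a * (k * R : ℕ) : ℤ) ≤ (cell v).1 ∧
      (cell v).1 < a * (k * R : ℕ) + (k * R : ℕ))
    (hv2 : (b * (k * R : ℕ) : ℤ) ≤ (cell v).2 ∧ (cell v).2 < b * (k * R : ℕ) + (k * R : ℕ))
    (hu : cell u = hW.rep a b) :
    (cellGraph H cell (windowCells (k * R : ℕ) (a * (k * R : ℕ)) (b * (k * R : ℕ)))).Reachable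
      v u := by
  set L : ℕ := k * R with hL
  set x : ℤ := a * L with hx
  set y : ℤ := b * L with hy
  -- Four good strips, one on each side of the block and all inside the window, form a frame around
  -- it.
  obtain ⟨lo, hlo1, hlo2, hlo⟩ := hW.exists_goodRows ha hb (x - L)
  obtain ⟨hi, hhi1, hhi2, hhi⟩ := hW.exists_goodRows ha hb (x + L)
  obtain ⟨lo', hlo1', hlo2', hlo'⟩ := hW.exists_goodCols ha hb (y - L)
  obtain ⟨hi', hhi1', hhi2', hhi'⟩ := hW.exists_goodCols ha hb (y + L)
  have hrep := hW.rep_spec ha hb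
  rw [← hL, ← hx, ← hy] at hlo hhi hlo' hhi' hrep
  rw [← hL] at hlo2 hhi2 hlo2' hhi2'
  obtain ⟨hq1, hq2, hq3, -⟩ := hrep
  have hrow := fun w => hW.reachable_rep_of_goodRow ha hb hu (w := w)
  have hcol := fun w => hW.reachable_rep_of_goodCol ha hb hu (w := w)
  rw [← hL, ← hx, ← hy] at hrow hcol
  obtain ⟨p⟩ := hW.preconnected v u
  -- Follow a walk of the whole graph towards the representative cell. While it stays inside the
  -- frame its edges lie in the window; the first step out covers at most R cells and so lands on a
  -- good strip, from which the representative cell is reached along good lines.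
  have key : ∀ {s e : V} (p : H.Walk s e), cell e = hW.rep a b →
      (lo + R ≤ (cell s).1 ∧ (cell s).1 < hi) → (lo' + R ≤ (cell s).2 ∧ (cell s).2 < hi') →
      (cellGraph H cell (windowCells L x y)).Reachable s u := by
    intro s e p
    induction p with
    | @nil s =>
      intro he h1 h2
      refine hrow s ?_ (by rw [he]; exact hq3)
      rw [mem_windowCells]
      omega
    | @cons s w e hsw q ih =>
      intro he h1 h2
      have hsW : cell s ∈ windowCells L x y := by
        rw [mem_windowCells]
        omega
      obtain ⟨hn1, hn2⟩ := hW.near_of_adj s w hsw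
      rw [abs_le] at hn1 hn2
      have hwW : cell w ∈ windowCells L x y := by
        rw [mem_windowCells]
        omega
      have hstep : (cellGraph H cell (windowCells L x y)).Reachable s w :=
        SimpleGraph.Adj.reachable ⟨hsw, hsW, hwW⟩
      refine hstep.trans ?_
      by_cases c1 : (cell w).1 < lo + R
      · exact hrow w hwW (hlo _ (by omega) c1)
      by_cases c2 : hi ≤ (cell w).1
      · exact hrow w hwW (hhi _ c2 (by omega))
      by_cases c3 : (cell w).2 < lo' + R
      · exact hcol w hwW (hlo' _ (by omega) c3)
      by_cases c4 : hi' ≤ (cell w).2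
      · exact hcol w hwW (hhi' _ c4 (by omega))
      exact ih he (by omega) (by omega)
  exact key p hu (by omega) (by omega)

-- The windows overlap at most ninefold: a given row lies in the row range of at most three windows,
-- and likewise for columns.
open Classical in
theorem sum_windowEnergy_le (H : SimpleGraph V) (cell : V → ℤ × ℤ) (L M : ℕ) (hL : 0 < L)
    (z : V → ℝ) : ∑ a ∈ Finset.range M, ∑ b ∈ Finset.range M, windowEnergy H cell L z a b ≤
      9 * dirichletEnergy H z := by
  have hL' : (0 : ℤ) < L := by exact_mod_cast hL
  have hcount : ∀ i : ℤ, ((Finset.range M).filter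
      fun a : ℕ => (a * L - L : ℤ) ≤ i ∧ i < a * L + 2 * L).card ≤ 3 := by
    intro i
    have h3 : (Finset.Icc (i / L - 1) (i / L + 1)).card = 3 := by simp; omega
    rw [← h3]
    refine Finset.card_le_card_of_injOn (fun a : ℕ => (a : ℤ)) ?_ (Nat.cast_injective.injOn)
    intro a ha
    simp only [Finset.coe_filter, Finset.mem_range, Set.mem_ofPred_eq] at ha
    obtain ⟨-, h1, h2⟩ := ha
    have h4 : i / L < a + 2 := Int.ediv_lt_of_lt_mul hL' (by linarith)
    have h5 : (a : ℤ) - 1 ≤ i / L := Int.le_ediv_of_mul_le hL' (by linarith)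
    simp only [Finset.coe_Icc, Set.mem_Icc]
    omega
  have hterm : ∀ u w : V, ∑ a ∈ Finset.range M, ∑ b ∈ Finset.range M,
      (if (cellGraph H cell (windowCells L (a * L) (b * L))).Adj u w then (z u - z w) ^ 2 else 0)
      ≤ 9 * if H.Adj u w then (z u - z w) ^ 2 else 0 := by
    intro u w
    by_cases huw : H.Adj u w
    · rw [if_pos huw]
      calc _ ≤ ∑ a ∈ Finset.range M, ∑ b ∈ Finset.range M,
            (if (a * L - L : ℤ) ≤ (cell u).1 ∧ (cell u).1 < a * L + 2 * L then (1 : ℝ) else 0) *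
            (if (b * L - L : ℤ) ≤ (cell u).2 ∧ (cell u).2 < b * L + 2 * L then (1 : ℝ) else 0) *
              (z u - z w) ^ 2 := by
            refine Finset.sum_le_sum fun a _ => Finset.sum_le_sum fun b _ => ?_
            split_ifs with h1 h2 h3 h4 h5 h6 <;> first | nlinarith [sq_nonneg (z u - z w)] | skip
            all_goals
              obtain ⟨-, h1, -⟩ := h1
              rw [mem_windowCells] at h1
              tauto
        _ = (((Finset.range M).filter fun a : ℕ => (a * L - L : ℤ) ≤ (cell u).1 ∧
              (cell u).1 < a * L + 2 * L).card : ℝ) *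
            ((Finset.range M).filter fun a : ℕ => (a * L - L : ℤ) ≤ (cell u).2 ∧
              (cell u).2 < a * L + 2 * L).card * (z u - z w) ^ 2 := by
            rw [Finset.card_filter, Finset.card_filter]
            push_cast
            rw [Finset.sum_mul_sum, Finset.sum_mul]
            exact Finset.sum_congr rfl fun a _ => by rw [Finset.sum_mul]
        _ ≤ 3 * 3 * (z u - z w) ^ 2 := by
            gcongr
            · exact_mod_cast hcount _
            · exact_mod_cast hcount _
        _ = _ := by ring
    · rw [if_neg huw, mul_zero]
      refine (Finset.sum_eq_zero fun a _ => Finset.sum_eq_zero fun b _ => ?_).le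
      rw [if_neg fun h => huw h.1]
  have hcomm : ∑ a ∈ Finset.range M, ∑ b ∈ Finset.range M, windowEnergy H cell L z a b =
      ∑ u, ∑ w, ∑ a ∈ Finset.range M, ∑ b ∈ Finset.range M,
      (if (cellGraph H cell (windowCells L (a * L) (b * L))).Adj u w then (z u - z w) ^ 2
        else 0) := by
    unfold windowEnergy dirichletEnergy
    rw [Finset.sum_congr rfl fun a _ => Finset.sum_comm, Finset.sum_comm]
    refine Finset.sum_congr rfl fun u _ => ?_
    rw [Finset.sum_congr rfl fun a _ => Finset.sum_comm, Finset.sum_comm]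
  rw [hcomm]
  unfold dirichletEnergy
  rw [Finset.mul_sum]
  refine Finset.sum_le_sum fun u _ => ?_
  rw [Finset.mul_sum]
  exact Finset.sum_le_sum fun w _ => hterm u w

/-- The mean over the representative cell of a block. -/
def blockMean (hW : WellOccupied H cell M k R U h) (z : V → ℝ) (a b : ℕ) : ℝ :=
  cellMean cell z (hW.rep a b)

/-- The factor 9 L² U bounds the number of nodes in a window, hence the length of a path inside it.
-/
theorem abs_sub_blockMean_le (hW : WellOccupied H cell M k R U h) (z : V → ℝ) {a b : ℕ}
    (ha : a < M) (hb : b < M) {v : V} (hv1 : (a * (k * R : ℕ) : ℤ) ≤ (cell v).1 ∧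
      (cell v).1 < a * (k * R : ℕ) + (k * R : ℕ))
    (hv2 : (b * (k * R : ℕ) : ℤ) ≤ (cell v).2 ∧ (cell v).2 < b * (k * R : ℕ) + (k * R : ℕ)) :
    |z v - hW.blockMean z a b| ≤
      9 * ((k * R : ℕ) : ℝ) ^ 2 * U * Real.sqrt (windowEnergy H cell (k * R) z a b) := by
  classical
  refine abs_sub_cellMean_le z _ _ _ (hW.nonempty_of_le_card (hW.le_card_rep ha hb)) ?_
  intro u hu
  have hvW : cell v ∈ windowCells (k * R : ℕ) (a * (k * R : ℕ)) (b * (k * R : ℕ)) := by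
    rw [mem_windowCells]
    omega
  refine (abs_sub_le_of_reachable_cellGraph z hvW
    (hW.reachable_rep ha hb hv1 hv2 hu)).trans ?_
  unfold windowEnergy
  gcongr
  refine (card_filter_cell_mem_le _ U hW.card_le).trans (le_of_eq ?_)
  congr 1
  have h1 : (windowCells (k * R : ℕ) (a * (k * R : ℕ)) (b * (k * R : ℕ))).card =
      (3 * (k * R)) * (3 * (k * R)) := by
    rw [windowCells, Finset.card_product, Int.card_Ico, Int.card_Ico]
    congr 1 <;> omega
  rw [h1]
  push_cast
  ring

/-- The route is the good row of the first representative cell up to the column of the second, then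
that good column. Each leg stays in one window and so has at most 3L steps. -/
theorem abs_blockMean_sub_right_le (hW : WellOccupied H cell M k R U h) (z : V → ℝ) {a b : ℕ}
    (ha : a < M) (hb : b + 1 < M) :
    |hW.blockMean z a b - hW.blockMean z a (b + 1)| ≤
      3 * ((k * R : ℕ) : ℝ) * (Real.sqrt (windowEnergy H cell (k * R) z a b) / h) +
      3 * ((k * R : ℕ) : ℝ) * (Real.sqrt (windowEnergy H cell (k * R) z a (b + 1)) / h) := by
  have hb0 : b < M := by omega
  obtain ⟨h1, h2, h3, -⟩ := hW.rep_spec ha hb0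
  obtain ⟨h1', h2', -, h4'⟩ := hW.rep_spec ha hb
  have hx := block_bounds (k * R) ha
  have hy := block_bounds (k * R) hb0
  have hy' := block_bounds (k * R) hb
  have hyy : ((b + 1 : ℕ) : ℤ) * (k * R : ℕ) = b * (k * R : ℕ) + (k * R : ℕ) := by
    push_cast
    ring
  rw [hyy] at h2' h4' hy'
  have l1 := abs_cellMean_sub_le_of_line hW.adj_of_touch z hW.pos_threshold
    (isCellLine_row (hW.rep a b).1) (hW.rep a b).2 (hW.rep a (b + 1)).2
    (W := windowCells (k * R : ℕ) (a * (k * R : ℕ)) (b * (k * R : ℕ))) (by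
      intro j hj
      rw [Set.mem_uIcc] at hj
      have hjW : ((hW.rep a b).1, j) ∈
          windowCells (k * R : ℕ) (a * (k * R : ℕ)) (b * (k * R : ℕ)) := by
        rw [mem_windowCells]
        dsimp only
        omega
      refine ⟨hjW, h3 j hjW ?_⟩
      rw [mem_gridCells]
      dsimp only
      omega)
  have l2 := abs_cellMean_sub_le_of_line hW.adj_of_touch z hW.pos_threshold
    (isCellLine_col (hW.rep a (b + 1)).2) (hW.rep a b).1 (hW.rep a (b + 1)).1
    (W := windowCells (k * R : ℕ) (a * (k * R : ℕ)) ((b + 1 : ℕ) * (k * R : ℕ))) (by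
      rw [hyy]
      intro i hi
      rw [Set.mem_uIcc] at hi
      have hiW : (i, (hW.rep a (b + 1)).2) ∈ windowCells (k * R : ℕ) (a * (k * R : ℕ))
          (b * (k * R : ℕ) + (k * R : ℕ)) := by
        rw [mem_windowCells]
        dsimp only
        omega
      refine ⟨hiW, h4' i hiW ?_⟩
      rw [mem_gridCells]
      dsimp only
      omega)
  have d1 : |((hW.rep a b).2 - (hW.rep a (b + 1)).2 : ℝ)| ≤ 3 * ((k * R : ℕ) : ℝ) := by
    rw [abs_le]
    constructor
    · exact_mod_cast (by omega : -(3 * ((k * R : ℕ) : ℤ)) ≤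
        (hW.rep a b).2 - (hW.rep a (b + 1)).2)
    · exact_mod_cast (by omega : (hW.rep a b).2 - (hW.rep a (b + 1)).2 ≤ 3 * ((k * R : ℕ) : ℤ))
  have d2 : |((hW.rep a b).1 - (hW.rep a (b + 1)).1 : ℝ)| ≤ 3 * ((k * R : ℕ) : ℝ) := by
    rw [abs_le]
    constructor
    · exact_mod_cast (by omega : -(3 * ((k * R : ℕ) : ℤ)) ≤
        (hW.rep a b).1 - (hW.rep a (b + 1)).1)
    · exact_mod_cast (by omega : (hW.rep a b).1 - (hW.rep a (b + 1)).1 ≤ 3 * ((k * R : ℕ) : ℤ))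
  have hh := hW.pos_threshold
  refine (abs_sub_le _ (cellMean cell z ((hW.rep a b).1, (hW.rep a (b + 1)).2)) _).trans ?_
  refine add_le_add (l1.trans ?_) (l2.trans ?_)
  · exact mul_le_mul_of_nonneg_right d1 (by positivity)
  · exact mul_le_mul_of_nonneg_right d2 (by positivity)

end WellOccupied

end

noncomputable section

namespace WellOccupied

variable {V : Type*} [Fintype V] {H : SimpleGraph V} {cell : V → ℤ × ℤ} {M k R : ℕ} {U h : ℝ}

/-- Same route with the roles exchanged: the good column of the first representative cell, then the
good row of the second. -/
theorem abs_blockMean_sub_up_le (hW : WellOccupied H cell M k R U h) (z : V → ℝ) {a b : ℕ}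
    (ha : a + 1 < M) (hb : b < M) :
    |hW.blockMean z a b - hW.blockMean z (a + 1) b| ≤
      3 * ((k * R : ℕ) : ℝ) * (Real.sqrt (windowEnergy H cell (k * R) z a b) / h) +
      3 * ((k * R : ℕ) : ℝ) * (Real.sqrt (windowEnergy H cell (k * R) z (a + 1) b) / h) := by
  have ha0 : a < M := by omega
  obtain ⟨h1, h2, -, h4⟩ := hW.rep_spec ha0 hb
  obtain ⟨h1', h2', h3', -⟩ := hW.rep_spec ha hb
  have hx := block_bounds (k * R) ha0
  have hx' := block_bounds (k * R) ha
  have hy := block_bounds (k * R) hb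
  have hxx : ((a + 1 : ℕ) : ℤ) * (k * R : ℕ) = a * (k * R : ℕ) + (k * R : ℕ) := by
    push_cast
    ring
  rw [hxx] at h1' h3' hx'
  have l1 := abs_cellMean_sub_le_of_line hW.adj_of_touch z hW.pos_threshold
    (isCellLine_col (hW.rep a b).2) (hW.rep a b).1 (hW.rep (a + 1) b).1
    (W := windowCells (k * R : ℕ) (a * (k * R : ℕ)) (b * (k * R : ℕ))) (by
      intro i hi
      rw [Set.mem_uIcc] at hi
      have hiW : (i, (hW.rep a b).2) ∈
          windowCells (k * R : ℕ) (a * (k * R : ℕ)) (b * (k * R : ℕ)) := by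
        rw [mem_windowCells]
        dsimp only
        omega
      refine ⟨hiW, h4 i hiW ?_⟩
      rw [mem_gridCells]
      dsimp only
      omega)
  have l2 := abs_cellMean_sub_le_of_line hW.adj_of_touch z hW.pos_threshold
    (isCellLine_row (hW.rep (a + 1) b).1) (hW.rep a b).2 (hW.rep (a + 1) b).2
    (W := windowCells (k * R : ℕ) ((a + 1 : ℕ) * (k * R : ℕ)) (b * (k * R : ℕ))) (by
      rw [hxx]
      intro j hj
      rw [Set.mem_uIcc] at hj
      have hjW : ((hW.rep (a + 1) b).1, j) ∈ windowCells (k * R : ℕ)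
          (a * (k * R : ℕ) + (k * R : ℕ)) (b * (k * R : ℕ)) := by
        rw [mem_windowCells]
        dsimp only
        omega
      refine ⟨hjW, h3' j hjW ?_⟩
      rw [mem_gridCells]
      dsimp only
      omega)
  have d1 : |((hW.rep a b).1 - (hW.rep (a + 1) b).1 : ℝ)| ≤ 3 * ((k * R : ℕ) : ℝ) := by
    rw [abs_le]
    constructor
    · exact_mod_cast (by omega : -(3 * ((k * R : ℕ) : ℤ)) ≤
        (hW.rep a b).1 - (hW.rep (a + 1) b).1)
    · exact_mod_cast (by omega : (hW.rep a b).1 - (hW.rep (a + 1) b).1 ≤ 3 * ((k * R : ℕ) : ℤ))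
  have d2 : |((hW.rep a b).2 - (hW.rep (a + 1) b).2 : ℝ)| ≤ 3 * ((k * R : ℕ) : ℝ) := by
    rw [abs_le]
    constructor
    · exact_mod_cast (by omega : -(3 * ((k * R : ℕ) : ℤ)) ≤
        (hW.rep a b).2 - (hW.rep (a + 1) b).2)
    · exact_mod_cast (by omega : (hW.rep a b).2 - (hW.rep (a + 1) b).2 ≤ 3 * ((k * R : ℕ) : ℤ))
  have hh := hW.pos_threshold
  refine (abs_sub_le _ (cellMean cell z ((hW.rep (a + 1) b).1, (hW.rep a b).2)) _).trans ?_
  refine add_le_add (l1.trans ?_) (l2.trans ?_)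
  · exact mul_le_mul_of_nonneg_right d1 (by positivity)
  · exact mul_le_mul_of_nonneg_right d2 (by positivity)

theorem sq_sub_le_of_abs_le {x y L E₁ E₂ h : ℝ} (hh : 0 < h) (hE₁ : 0 ≤ E₁) (hE₂ : 0 ≤ E₂)
    (hxy : |x - y| ≤ 3 * L * (Real.sqrt E₁ / h) + 3 * L * (Real.sqrt E₂ / h)) :
    (y - x) ^ 2 ≤ 18 * L ^ 2 / h ^ 2 * (E₁ + E₂) := by
  have h1 := pow_le_pow_left₀ (abs_nonneg _) hxy 2
  rw [sq_abs] at h1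
  have h2 := Real.sq_sqrt hE₁
  have h3 := Real.sq_sqrt hE₂
  have h4 : (3 * L * (Real.sqrt E₁ / h) + 3 * L * (Real.sqrt E₂ / h)) ^ 2 ≤
      18 * L ^ 2 / h ^ 2 * (Real.sqrt E₁ ^ 2 + Real.sqrt E₂ ^ 2) := by
    have : 18 * L ^ 2 / h ^ 2 * (Real.sqrt E₁ ^ 2 + Real.sqrt E₂ ^ 2) -
        (3 * L * (Real.sqrt E₁ / h) + 3 * L * (Real.sqrt E₂ / h)) ^ 2 =
        (3 * L * (Real.sqrt E₁ / h) - 3 * L * (Real.sqrt E₂ / h)) ^ 2 := by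
      field_simp
      ring
    linarith [sq_nonneg (3 * L * (Real.sqrt E₁ / h) - 3 * L * (Real.sqrt E₂ / h))]
  rw [h2, h3] at h4
  linarith [show (y - x) ^ 2 = (x - y) ^ 2 by ring]

theorem windowEnergy_nonneg (L : ℕ) (z : V → ℝ) (a b : ℕ) : 0 ≤ windowEnergy H cell L z a b :=
  dirichletEnergy_nonneg _ _

theorem sum_add_succ_le (f : ℕ → ℝ) (hf : ∀ n, 0 ≤ f n) (M : ℕ) :
    ∑ n ∈ Finset.range (M - 1), (f n + f (n + 1)) ≤ 2 * ∑ n ∈ Finset.range M, f n := by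
  rcases M with _ | M
  · simp
  rw [Nat.add_sub_cancel, Finset.sum_add_distrib]
  have h1 := Finset.sum_range_succ f M
  have h2 := Finset.sum_range_succ' f M
  linarith [hf M, hf 0]

/-- The grid inequality for block means. In each of the two directions a window is used at most
twice, and the windows overlap ninefold: 1296 = 2 · 2 · 18 · 2 · 9. -/
theorem exists_sum_blockMean_sq_le (hW : WellOccupied H cell M k R U h) (hk : 0 < k) (z : V → ℝ) :
    ∃ c : ℝ, ∑ a ∈ Finset.range M, ∑ b ∈ Finset.range M, (hW.blockMean z a b - c) ^ 2 ≤
      1296 * ((k * R : ℕ) : ℝ) ^ 2 * (M : ℝ) ^ 2 / h ^ 2 * dirichletEnergy H z := by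
  obtain ⟨c, hc⟩ := exists_sum_sq_sub_le_grid (hW.blockMean z) M
  refine ⟨c, hc.trans ?_⟩
  have hh := hW.pos_threshold
  set E := windowEnergy H cell (k * R) z with hE
  have hEnn : ∀ a b, 0 ≤ E a b := windowEnergy_nonneg _ z
  have hsum := sum_windowEnergy_le H cell (k * R) M (Nat.mul_pos hk hW.pos_range) z
  rw [← hE] at hsum
  set D := 18 * ((k * R : ℕ) : ℝ) ^ 2 / h ^ 2 with hD
  have hDnn : 0 ≤ D := by positivity
  have h1 : ∑ a ∈ Finset.range M, ∑ b ∈ Finset.range (M - 1),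
      (hW.blockMean z a (b + 1) - hW.blockMean z a b) ^ 2 ≤ D * (2 * (9 * dirichletEnergy H z)) := by
    calc _ ≤ ∑ a ∈ Finset.range M, ∑ b ∈ Finset.range (M - 1), D * (E a b + E a (b + 1)) := by
          refine Finset.sum_le_sum fun a ha => Finset.sum_le_sum fun b hb => ?_
          rw [Finset.mem_range] at ha hb
          exact sq_sub_le_of_abs_le hh (hEnn _ _) (hEnn _ _)
            (hW.abs_blockMean_sub_right_le z ha (by omega))
      _ ≤ ∑ a ∈ Finset.range M, D * (2 * ∑ b ∈ Finset.range M, E a b) := by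
          refine Finset.sum_le_sum fun a _ => ?_
          rw [← Finset.mul_sum]
          gcongr
          exact sum_add_succ_le (E a) (hEnn a) M
      _ = D * (2 * ∑ a ∈ Finset.range M, ∑ b ∈ Finset.range M, E a b) := by
          simp only [Finset.mul_sum]
      _ ≤ _ := by gcongr
  have h2 : ∑ b ∈ Finset.range M, ∑ a ∈ Finset.range (M - 1),
      (hW.blockMean z (a + 1) b - hW.blockMean z a b) ^ 2 ≤ D * (2 * (9 * dirichletEnergy H z)) := by
    calc _ ≤ ∑ b ∈ Finset.range M, ∑ a ∈ Finset.range (M - 1), D * (E a b + E (a + 1) b) := by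
          refine Finset.sum_le_sum fun b hb => Finset.sum_le_sum fun a ha => ?_
          rw [Finset.mem_range] at ha hb
          exact sq_sub_le_of_abs_le hh (hEnn _ _) (hEnn _ _)
            (hW.abs_blockMean_sub_up_le z (by omega) hb)
      _ ≤ ∑ b ∈ Finset.range M, D * (2 * ∑ a ∈ Finset.range M, E a b) := by
          refine Finset.sum_le_sum fun b _ => ?_
          rw [← Finset.mul_sum]
          gcongr
          exact sum_add_succ_le (fun a => E a b) (fun a => hEnn a b) M
      _ = D * (2 * ∑ a ∈ Finset.range M, ∑ b ∈ Finset.range M, E a b) := by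
          rw [Finset.sum_comm (s := Finset.range M) (t := Finset.range M) (f := fun a b => E a b)]
          simp only [Finset.mul_sum]
      _ ≤ _ := by gcongr
  calc _ ≤ 2 * (M : ℝ) ^ 2 * (D * (2 * (9 * dirichletEnergy H z)) +
        D * (2 * (9 * dirichletEnergy H z))) := by gcongr
    _ = _ := by
        rw [hD]
        ring

/-- A Poincaré inequality for well occupied graphs. -/
theorem sum_sub_average_sq_le_dirichletEnergy (hW : WellOccupied H cell M k R U h) (hk : 0 < k)
    (z : V → ℝ) : ∑ v, (z v - _root_.average z) ^ 2 ≤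
      (1458 * ((k * R : ℕ) : ℝ) ^ 6 * U ^ 3 +
        2592 * ((k * R : ℕ) : ℝ) ^ 4 * U * (M : ℝ) ^ 2 / h ^ 2) * dirichletEnergy H z := by
  classical
  obtain ⟨c, hc⟩ := hW.exists_sum_blockMean_sq_le hk z
  refine (sum_sub_average_sq_le z c).trans ?_
  have hLpos : 0 < k * R := Nat.mul_pos hk hW.pos_range
  have hsum := sum_windowEnergy_le H cell (k * R) M hLpos z
  set E := windowEnergy H cell (k * R) z with hE
  have hEnn : ∀ a b, 0 ≤ E a b := windowEnergy_nonneg _ z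
  have hUnn : 0 ≤ U := (Nat.cast_nonneg _).trans (hW.card_le 0)
  set L : ℕ := k * R with hL
  have hLz : (0 : ℤ) < L := by exact_mod_cast hLpos
  let blk : ℕ → ℕ → Finset (ℤ × ℤ) := fun a b =>
    Finset.Ico (a * L : ℤ) (a * L + L) ×ˢ Finset.Ico (b * L : ℤ) (b * L + L)
  have hblk : ∀ v, ∃ a < M, ∃ b < M, cell v ∈ blk a b := by
    intro v
    have hg := mem_gridCells.mp (hW.cell_mem v)
    rw [← hL] at hg
    have hdiv : ∀ i : ℤ, 0 ≤ i → i < M * L → ∃ a : ℕ, a < M ∧ (a * L : ℤ) ≤ i ∧ i < a * L + L := by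
      intro i h0 h1
      have h2 : 0 ≤ i / L := Int.ediv_nonneg h0 hLz.le
      obtain ⟨a, ha⟩ := Int.eq_ofNat_of_zero_le h2
      have h3 : i / L < M := Int.ediv_lt_of_lt_mul hLz h1
      have h4 := Int.mul_ediv_add_emod i L
      have h5 := Int.emod_nonneg i hLz.ne'
      have h6 := Int.emod_lt_of_pos i hLz
      rw [ha] at h3 h4
      rw [mul_comm] at h4
      exact ⟨a, by exact_mod_cast h3, by linarith, by linarith⟩
    obtain ⟨a, ha, ha1, ha2⟩ := hdiv _ hg.1.1 hg.1.2
    obtain ⟨b, hb, hb1, hb2⟩ := hdiv _ hg.2.1 hg.2.2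
    refine ⟨a, ha, b, hb, ?_⟩
    simp only [blk, Finset.mem_product, Finset.mem_Ico]
    exact ⟨⟨ha1, ha2⟩, hb1, hb2⟩
  have hpt : ∀ v, (z v - c) ^ 2 ≤ ∑ a ∈ Finset.range M, ∑ b ∈ Finset.range M,
      if cell v ∈ blk a b then (z v - c) ^ 2 else 0 := by
    intro v
    have hnn : ∀ a b, 0 ≤ if cell v ∈ blk a b then (z v - c) ^ 2 else 0 := fun a b => by
      split_ifs <;> positivity
    obtain ⟨a, ha, b, hb, hab⟩ := hblk v
    calc (z v - c) ^ 2 = if cell v ∈ blk a b then (z v - c) ^ 2 else 0 := by rw [if_pos hab]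
      _ ≤ ∑ b ∈ Finset.range M, if cell v ∈ blk a b then (z v - c) ^ 2 else 0 :=
          Finset.single_le_sum (f := fun b => if cell v ∈ blk a b then (z v - c) ^ 2 else 0)
            (fun b _ => hnn a b) (Finset.mem_range.mpr hb)
      _ ≤ _ := Finset.single_le_sum (f := fun a => ∑ b ∈ Finset.range M,
            if cell v ∈ blk a b then (z v - c) ^ 2 else 0)
            (fun a _ => Finset.sum_nonneg fun b _ => hnn a b) (Finset.mem_range.mpr ha)
  -- Split z v - c at the block mean: the first part is paid by the crude path bound, the second by
  -- the grid inequality. The factor L² U bounds the number of nodes in a block.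
  have hblock : ∀ a ∈ Finset.range M, ∀ b ∈ Finset.range M,
      (∑ v, if cell v ∈ blk a b then (z v - c) ^ 2 else 0) ≤ ((L : ℝ) ^ 2 * U) *
        (2 * (81 * (L : ℝ) ^ 4 * U ^ 2 * E a b) + 2 * (hW.blockMean z a b - c) ^ 2) := by
    intro a ha b hb
    rw [Finset.mem_range] at ha hb
    rw [← Finset.sum_filter]
    have hnn : 0 ≤ 2 * (81 * (L : ℝ) ^ 4 * U ^ 2 * E a b) + 2 * (hW.blockMean z a b - c) ^ 2 := by
      have := hEnn a b
      positivity
    calc _ ≤ ∑ v ∈ Finset.univ.filter (fun v => cell v ∈ blk a b),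
          (2 * (81 * (L : ℝ) ^ 4 * U ^ 2 * E a b) + 2 * (hW.blockMean z a b - c) ^ 2) := by
          refine Finset.sum_le_sum fun v hv => ?_
          simp only [blk, Finset.mem_filter, Finset.mem_product, Finset.mem_Ico] at hv
          have h1 := pow_le_pow_left₀ (abs_nonneg _) (hW.abs_sub_blockMean_le z ha hb hv.2.1 hv.2.2) 2
          rw [sq_abs, mul_pow, Real.sq_sqrt (windowEnergy_nonneg _ _ _ _), ← hE, ← hL] at h1
          have h2 : (9 * (L : ℝ) ^ 2 * U) ^ 2 = 81 * (L : ℝ) ^ 4 * U ^ 2 := by ring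
          rw [h2] at h1
          linarith [sq_nonneg ((z v - hW.blockMean z a b) - (hW.blockMean z a b - c)),
            show (z v - c) ^ 2 = 2 * (z v - hW.blockMean z a b) ^ 2 +
              2 * (hW.blockMean z a b - c) ^ 2 -
              ((z v - hW.blockMean z a b) - (hW.blockMean z a b - c)) ^ 2 by ring]
      _ ≤ _ := by
          rw [Finset.sum_const, nsmul_eq_mul]
          apply mul_le_mul_of_nonneg_right _ hnn
          refine (card_filter_cell_mem_le (blk a b) U hW.card_le).trans (le_of_eq ?_)
          congr 1
          simp only [blk, Finset.card_product, Int.card_Ico, add_sub_cancel_left, Int.toNat_natCast]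
          push_cast
          ring
  calc ∑ v, (z v - c) ^ 2
      ≤ ∑ v, ∑ a ∈ Finset.range M, ∑ b ∈ Finset.range M,
        if cell v ∈ blk a b then (z v - c) ^ 2 else 0 := Finset.sum_le_sum fun v _ => hpt v
    _ = ∑ a ∈ Finset.range M, ∑ b ∈ Finset.range M, ∑ v,
        if cell v ∈ blk a b then (z v - c) ^ 2 else 0 := by
        rw [Finset.sum_comm]
        exact Finset.sum_congr rfl fun a _ => Finset.sum_comm
    _ ≤ ∑ a ∈ Finset.range M, ∑ b ∈ Finset.range M, ((L : ℝ) ^ 2 * U) *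
        (2 * (81 * (L : ℝ) ^ 4 * U ^ 2 * E a b) + 2 * (hW.blockMean z a b - c) ^ 2) :=
        Finset.sum_le_sum fun a ha => Finset.sum_le_sum fun b hb => hblock a ha b hb
    _ = ((L : ℝ) ^ 2 * U) * (2 * (81 * (L : ℝ) ^ 4 * U ^ 2 *
          ∑ a ∈ Finset.range M, ∑ b ∈ Finset.range M, E a b) +
          2 * ∑ a ∈ Finset.range M, ∑ b ∈ Finset.range M, (hW.blockMean z a b - c) ^ 2) := by
        simp only [Finset.mul_sum, Finset.sum_add_distrib, mul_add]
    _ ≤ ((L : ℝ) ^ 2 * U) * (2 * (81 * (L : ℝ) ^ 4 * U ^ 2 * (9 * dirichletEnergy H z)) +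
          2 * (1296 * (L : ℝ) ^ 2 * (M : ℝ) ^ 2 / h ^ 2 * dirichletEnergy H z)) := by gcongr
    _ = _ := by ring

end WellOccupied

end

noncomputable section

/-! ### Uniform placement and cell counts -/

/-- The uniform law on the unit square. -/
def squareLaw : Measure Plane := (volume : Measure Plane).restrict unitSquare

theorem volume_plane_box (a b : Fin 2 → ℝ) :
    (volume : Measure Plane) {p | ∀ i, p i ∈ Set.Ico (a i) (b i)} =
      ENNReal.ofReal (b 0 - a 0) * ENNReal.ofReal (b 1 - a 1) := by
  have h := (PiLp.volume_preserving_ofLp (Fin 2)).measure_preimage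
    (s := Set.pi Set.univ fun i => Set.Ico (a i) (b i))
    (MeasurableSet.univ_pi fun _ => measurableSet_Ico).nullMeasurableSet
  rw [Real.volume_pi_Ico, Fin.prod_univ_two] at h
  rw [← h]
  congr 1
  ext p
  simp

theorem volume_unitSquare : (volume : Measure Plane) unitSquare = 1 := by
  have h := (PiLp.volume_preserving_ofLp (Fin 2)).measure_preimage
    (s := Set.pi Set.univ fun _ => Set.Icc (0 : ℝ) 1)
    (MeasurableSet.univ_pi fun _ => measurableSet_Icc).nullMeasurableSet
  rw [volume_pi_pi, Fin.prod_univ_two, Real.volume_Icc] at h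
  simp only [sub_zero, ENNReal.ofReal_one, mul_one] at h
  rw [← h]
  congr 1
  ext p
  simp only [unitSquare, Set.mem_ofPred_eq, Set.mem_preimage, Set.mem_univ_pi]

instance : IsProbabilityMeasure squareLaw :=
  ⟨by rw [squareLaw, Measure.restrict_apply_univ, volume_unitSquare]⟩

theorem placementLaw_eq (N : ℕ) : placementLaw N = Measure.pi fun _ => squareLaw := rfl

instance (N : ℕ) : IsProbabilityMeasure (placementLaw N) := by
  rw [placementLaw_eq]
  infer_instance

/-- The cell of a point in the grid of cells of side `1 / m`. -/
def cellOf (m : ℕ) (p : Plane) : ℤ × ℤ := (⌊p 0 * m⌋, ⌊p 1 * m⌋)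

theorem measurable_cellOf (m : ℕ) : Measurable (cellOf m) := by
  unfold cellOf
  have h : ∀ i : Fin 2, Measurable fun p : Plane => p i := fun i => by fun_prop
  exact ((h 0).mul_const _).floor.prodMk ((h 1).mul_const _).floor

theorem cellOf_eq_iff {m : ℕ} (hm : 0 < m) (p : Plane) (c : ℤ × ℤ) : cellOf m p = c ↔
    ∀ i, p i ∈ Set.Ico ((![(c.1 : ℝ), c.2] i) / m) ((![(c.1 : ℝ), c.2] i + 1) / m) := by
  have hm' : (0 : ℝ) < m := by exact_mod_cast hm
  simp only [cellOf, Prod.ext_iff, Int.floor_eq_iff, Fin.forall_fin_two, Set.mem_Ico,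
    div_le_iff₀ hm', lt_div_iff₀ hm']
  simp

theorem squareLaw_cell {m : ℕ} (hm : 0 < m) {c : ℤ × ℤ} (hc : c ∈ gridCells m) :
    squareLaw {p | cellOf m p = c} = ENNReal.ofReal (1 / (m : ℝ) ^ 2) := by
  have hm' : (0 : ℝ) < m := by exact_mod_cast hm
  have hsub : {p : Plane | cellOf m p = c} ⊆ unitSquare := by
    intro p hp i
    have h := (cellOf_eq_iff hm p c).mp hp i
    obtain ⟨⟨h1, h2⟩, h3, h4⟩ := mem_gridCells.mp hc
    have h1' : (0 : ℝ) ≤ c.1 := by exact_mod_cast h1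
    have h2' : (c.1 : ℝ) + 1 ≤ m := by exact_mod_cast h2
    have h3' : (0 : ℝ) ≤ c.2 := by exact_mod_cast h3
    have h4' : (c.2 : ℝ) + 1 ≤ m := by exact_mod_cast h4
    rw [Set.mem_Ico, div_le_iff₀ hm', lt_div_iff₀ hm'] at h
    have h0 : 0 ≤ p i * m ∧ p i * m ≤ 1 * m := by
      fin_cases i <;> simp at h ⊢ <;> constructor <;> linarith
    exact ⟨nonneg_of_mul_nonneg_left h0.1 hm', le_of_mul_le_mul_right h0.2 hm'⟩
  have hmeas : MeasurableSet {p | cellOf m p = c} :=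
    measurable_cellOf m (measurableSet_singleton c)
  rw [squareLaw, Measure.restrict_apply hmeas, Set.inter_eq_left.mpr hsub]
  simp only [cellOf_eq_iff hm]
  have hside : ∀ y : ℝ, (y + 1) / m - y / m = 1 / m := fun y => by ring
  rw [volume_plane_box, hside, hside, ← ENNReal.ofReal_mul (by positivity)]
  congr 1
  field_simp

theorem squareLaw_real_cells {m : ℕ} (hm : 0 < m) {F : Finset (ℤ × ℤ)} (hF : F ⊆ gridCells m) :
    squareLaw.real {p | cellOf m p ∈ F} = F.card / (m : ℝ) ^ 2 := by
  have h1 : {p : Plane | cellOf m p ∈ F} = ⋃ c ∈ F, {p | cellOf m p = c} := by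
    ext p
    simp
  rw [measureReal_def, h1, measure_biUnion_finset]
  · rw [Finset.sum_congr rfl fun c hc => squareLaw_cell hm (hF hc), Finset.sum_const, nsmul_eq_mul,
      ENNReal.toReal_mul, ENNReal.toReal_ofReal (by positivity)]
    simp
    ring
  · intro c _ d _ hcd
    rw [Function.onFun, Set.disjoint_left]
    intro p hp hp'
    exact hcd (hp.symm.trans hp')
  · exact fun c _ => measurable_cellOf m (measurableSet_singleton c)

theorem ae_cellOf_mem_gridCells (N : ℕ) {m : ℕ} (hm : 0 < m) :
    ∀ᵐ x ∂placementLaw N, ∀ n, cellOf m (x n) ∈ gridCells m := by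
  have h1 : ∀ᵐ p ∂squareLaw, cellOf m p ∈ gridCells m := by
    have hreal := squareLaw_real_cells hm (F := gridCells m) subset_rfl
    have hm' : (m : ℝ) ≠ 0 := by exact_mod_cast hm.ne'
    rw [show (gridCells (m : ℤ)).card = m * m by simp [gridCells], Nat.cast_mul, ← sq,
      div_self (pow_ne_zero 2 hm')] at hreal
    rw [measureReal_def, ENNReal.toReal_eq_one_iff] at hreal
    have hmeas : MeasurableSet {p : Plane | cellOf m p ∈ gridCells m} :=
      measurable_cellOf m (gridCells m).measurableSet
    exact (prob_compl_eq_zero_iff hmeas).mpr hreal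
  rw [ae_all_iff]
  intro n
  exact (measurePreserving_eval (fun _ : Fin N => squareLaw) n).quasiMeasurePreserving.ae h1

/-- The moment generating function of the number of points in a set. -/
theorem mgf_count_le (N : ℕ) {S : Set Plane} (hS : MeasurableSet S) (t : ℝ) :
    ProbabilityTheory.mgf (fun x : Fin N → Plane => ∑ n, S.indicator 1 (x n)) (placementLaw N) t ≤
      Real.exp (N * squareLaw.real S * (Real.exp t - 1)) := by
  have h1 : ∀ p : Plane, Real.exp (t * S.indicator 1 p) =
      1 + S.indicator (fun _ => Real.exp t - 1) p := by
    intro p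
    by_cases hp : p ∈ S <;> simp [hp]
  have h2 : ∫ p, Real.exp (t * S.indicator 1 p) ∂squareLaw =
      1 + squareLaw.real S * (Real.exp t - 1) := by
    simp only [h1]
    rw [integral_add (integrable_const _) ((integrable_const _).indicator hS),
      integral_indicator_const _ hS]
    simp
  unfold ProbabilityTheory.mgf
  rw [placementLaw_eq]
  simp only [Finset.mul_sum, Real.exp_sum]
  rw [integral_fintype_prod_eq_prod (f := fun _ p => Real.exp (t * S.indicator 1 p))]
  rw [h2, Finset.prod_const, Finset.card_univ, Fintype.card_fin, mul_assoc, Real.exp_nat_mul]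
  have h3 : 0 ≤ 1 + squareLaw.real S * (Real.exp t - 1) := by
    rw [← h2]
    exact integral_nonneg fun _ => (Real.exp_pos _).le
  gcongr
  linarith [Real.add_one_le_exp (squareLaw.real S * (Real.exp t - 1))]

theorem integrable_exp_count (N : ℕ) {S : Set Plane} (hS : MeasurableSet S) (t : ℝ) :
    Integrable (fun x : Fin N → Plane => Real.exp (t * ∑ n, S.indicator 1 (x n)))
      (placementLaw N) := by
  have hmeas : Measurable fun x : Fin N → Plane => ∑ n, S.indicator (1 : Plane → ℝ) (x n) :=
    Finset.measurable_sum _ fun n _ =>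
      (measurable_const.indicator hS).comp (measurable_pi_apply n)
  refine Integrable.of_bound (C := Real.exp (|t| * N))
    (Real.measurable_exp.comp (hmeas.const_mul t)).aestronglyMeasurable
    (Eventually.of_forall fun x => ?_)
  rw [Real.norm_eq_abs, Real.abs_exp]
  apply Real.exp_le_exp.mpr
  have h1 : 0 ≤ ∑ n, S.indicator (1 : Plane → ℝ) (x n) :=
    Finset.sum_nonneg fun n _ => Set.indicator_nonneg (fun _ _ => zero_le_one) _
  have h2 : ∑ n, S.indicator (1 : Plane → ℝ) (x n) ≤ N := by
    calc _ ≤ ∑ n : Fin N, (1 : ℝ) := Finset.sum_le_sum fun n _ =>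
          Set.indicator_le_self' (fun _ _ => zero_le_one) _
      _ = N := by simp
  calc _ ≤ |t| * ∑ n, S.indicator (1 : Plane → ℝ) (x n) := by
        gcongr
        exact le_abs_self t
    _ ≤ _ := by gcongr

theorem sum_card_cellNodes {N m : ℕ} (x : Fin N → Plane) (F : Finset (ℤ × ℤ)) :
    ∑ c ∈ F, ((cellNodes (fun n => cellOf m (x n)) c).card : ℝ) =
      ∑ n, {p | cellOf m p ∈ F}.indicator (1 : Plane → ℝ) (x n) := by
  classical
  simp only [cellNodes, Finset.card_filter, Nat.cast_sum]
  rw [Finset.sum_comm]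
  refine Finset.sum_congr rfl fun n _ => ?_
  by_cases hn : cellOf m (x n) ∈ F
  · rw [Set.indicator_of_mem (by exact hn)]
    simp [hn]
  · rw [Set.indicator_of_notMem (by exact hn)]
    simp [hn]

/-- Chernoff bound at t = -1, with 1 - e⁻¹ ≥ 3/5. -/
theorem placementLaw_count_le (N : ℕ) {m : ℕ} (hm : 0 < m) {F : Finset (ℤ × ℤ)}
    (hF : F ⊆ gridCells m) (s : ℝ) :
    (placementLaw N).real {x | ∑ c ∈ F, ((cellNodes (fun n => cellOf m (x n)) c).card : ℝ) ≤ s} ≤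
      Real.exp (s - 3 / 5 * (N * F.card / (m : ℝ) ^ 2)) := by
  have hS : MeasurableSet {p : Plane | cellOf m p ∈ F} :=
    measurable_cellOf m F.measurableSet
  simp only [sum_card_cellNodes]
  refine (ProbabilityTheory.measure_le_le_exp_mul_mgf (t := -1) s (by norm_num)
    (integrable_exp_count N hS _)).trans ?_
  refine (mul_le_mul_of_nonneg_left (mgf_count_le N hS _) (Real.exp_pos _).le).trans ?_
  rw [← Real.exp_add, squareLaw_real_cells hm hF]
  apply Real.exp_le_exp.mpr
  have h1 := Real.exp_neg_one_lt_d9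
  have h2 : 0 ≤ (N : ℝ) * (F.card / (m : ℝ) ^ 2) := by positivity
  have h3 : (N : ℝ) * F.card / (m : ℝ) ^ 2 = N * (F.card / (m : ℝ) ^ 2) := by ring
  rw [h3]
  nlinarith

/-- Chernoff bound at t = 1, with e - 1 ≤ 2. -/
theorem placementLaw_le_count (N : ℕ) {m : ℕ} (hm : 0 < m) {F : Finset (ℤ × ℤ)}
    (hF : F ⊆ gridCells m) (s : ℝ) :
    (placementLaw N).real {x | s ≤ ∑ c ∈ F, ((cellNodes (fun n => cellOf m (x n)) c).card : ℝ)} ≤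
      Real.exp (2 * (N * F.card / (m : ℝ) ^ 2) - s) := by
  have hS : MeasurableSet {p : Plane | cellOf m p ∈ F} :=
    measurable_cellOf m F.measurableSet
  simp only [sum_card_cellNodes]
  refine (ProbabilityTheory.measure_ge_le_exp_mul_mgf (t := 1) s (by norm_num)
    (integrable_exp_count N hS _)).trans ?_
  refine (mul_le_mul_of_nonneg_left (mgf_count_le N hS _) (Real.exp_pos _).le).trans ?_
  rw [← Real.exp_add, squareLaw_real_cells hm hF]
  apply Real.exp_le_exp.mpr
  have h1 := Real.exp_one_lt_d9
  have h2 : 0 ≤ (N : ℝ) * (F.card / (m : ℝ) ^ 2) := by positivity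
  have h3 : (N : ℝ) * F.card / (m : ℝ) ^ 2 = N * (F.card / (m : ℝ) ^ 2) := by ring
  rw [h3]
  nlinarith

end

noncomputable section

/-! ### Geometry of the radius graph -/

section Geometry

variable {V : Type*} {α γ G r : ℝ} {x : V → Plane}

theorem radiusGraph_adj_iff (hα : 0 < α) (hγ : 0 < γ) (hG : 0 < G) (hr : 0 ≤ r) {u w : V} :
    (radiusGraph α γ G r x).Adj u w ↔ u ≠ w ∧ dist (x u) (x w) ≤ r := by
  have hc : 0 < γ / G := by positivity
  have key : ∀ p q : Plane, γ / G * dist p q ^ α ≤ γ / G * r ^ α ↔ dist p q ≤ r := fun p q => by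
    rw [mul_le_mul_iff_right₀ hc, Real.rpow_le_rpow_iff dist_nonneg hr hα]
  simp only [radiusGraph, linkGraph, neighborhood, transmitPower, Set.mem_ofPred_eq, key,
    dist_comm (x w), and_self]

theorem abs_coord_sub_le_dist (p q : Plane) (i : Fin 2) : |p i - q i| ≤ dist p q := by
  have := PiLp.norm_apply_le (p - q) i
  rwa [dist_eq_norm]

theorem abs_floor_sub_floor_lt (y y' : ℝ) : |((⌊y⌋ - ⌊y'⌋ : ℤ) : ℝ)| < |y - y'| + 1 := by
  have h1 := Int.floor_le y
  have h2 := Int.lt_floor_add_one y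
  have h3 := Int.floor_le y'
  have h4 := Int.lt_floor_add_one y'
  have h5 := le_abs_self (y - y')
  have h6 := neg_le_abs (y - y')
  rw [abs_lt]
  push_cast
  constructor <;> linarith

theorem abs_sub_lt_floor_add_one (y y' : ℝ) : |y - y'| < |((⌊y⌋ - ⌊y'⌋ : ℤ) : ℝ)| + 1 := by
  have h1 := Int.floor_le y
  have h2 := Int.lt_floor_add_one y
  have h3 := Int.floor_le y'
  have h4 := Int.lt_floor_add_one y'
  have h5 := le_abs_self ((⌊y⌋ - ⌊y'⌋ : ℤ) : ℝ)
  have h6 := neg_le_abs ((⌊y⌋ - ⌊y'⌋ : ℤ) : ℝ)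
  push_cast at h5 h6 ⊢
  rw [abs_lt]
  constructor <;> linarith

/-- Measured in cell sides, each coordinate difference exceeds that of the floors by less than 1, so
the ℓ¹ distance is below 1 + 2 = 3, and it dominates the Euclidean distance. -/
theorem dist_le_of_cellsTouch {m : ℕ} (hm : 0 < m) {p q : Plane} (hr : 3 ≤ r * m)
    (h : CellsTouch (cellOf m p) (cellOf m q)) : dist p q ≤ r := by
  have hm' : (0 : ℝ) < m := by exact_mod_cast hm
  have hr0 : 0 ≤ r := nonneg_of_mul_nonneg_left (by linarith) hm'
  unfold CellsTouch cellOf at h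
  dsimp only at h
  have h' : |((⌊p 0 * m⌋ - ⌊q 0 * m⌋ : ℤ) : ℝ)| + |((⌊p 1 * m⌋ - ⌊q 1 * m⌋ : ℤ) : ℝ)| ≤ 1 := by
    exact_mod_cast h
  have h0 := abs_sub_lt_floor_add_one (p 0 * m) (q 0 * m)
  have h1 := abs_sub_lt_floor_add_one (p 1 * m) (q 1 * m)
  rw [← sub_mul, abs_mul, abs_of_pos hm'] at h0 h1
  rw [EuclideanSpace.dist_eq, Fin.sum_univ_two]
  apply Real.sqrt_le_iff.mpr ⟨hr0, ?_⟩
  rw [Real.dist_eq, Real.dist_eq]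
  have hs : |p 0 - q 0| + |p 1 - q 1| ≤ r := by
    refine le_of_mul_le_mul_right (le_trans ?_ hr) hm'
    linarith
  nlinarith [abs_nonneg (p 0 - q 0), abs_nonneg (p 1 - q 1)]

theorem cellOf_near_of_dist_le {m R : ℕ} {p q : Plane} (hR : r * m + 1 ≤ R)
    (h : dist p q ≤ r) : |(cellOf m p).1 - (cellOf m q).1| ≤ R ∧
      |(cellOf m p).2 - (cellOf m q).2| ≤ R := by
  have key : ∀ i : Fin 2, |⌊p i * m⌋ - ⌊q i * m⌋| ≤ (R : ℤ) := by
    intro i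
    have h1 := abs_floor_sub_floor_lt (p i * m) (q i * m)
    rw [← sub_mul, abs_mul, Nat.abs_cast] at h1
    have h2 : |p i - q i| * m ≤ r * m := by
      gcongr
      exact (abs_coord_sub_le_dist p q i).trans h
    have h3 : |((⌊p i * m⌋ - ⌊q i * m⌋ : ℤ) : ℝ)| ≤ R := by linarith
    exact_mod_cast h3
  exact ⟨key 0, key 1⟩

end Geometry

/-! ### Degrees, cliques and the spectral gap of random pairings -/

section Consequences

variable {V : Type*} [Fintype V] {H : SimpleGraph V} {cell : V → ℤ × ℤ} {M k R : ℕ} {U h : ℝ}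

theorem WellOccupied.maxDegree_le (hW : WellOccupied H cell M k R U h) [DecidableRel H.Adj] :
    (H.maxDegree : ℝ) ≤ (2 * R + 1) ^ 2 * U := by
  classical
  have hUnn : 0 ≤ U := (Nat.cast_nonneg _).trans (hW.card_le 0)
  have hdeg : ∀ v, (H.degree v : ℝ) ≤ (2 * R + 1) ^ 2 * U := by
    intro v
    have hcount := card_filter_cell_mem_le (Finset.Icc ((cell v).1 - R) ((cell v).1 + R) ×ˢ
      Finset.Icc ((cell v).2 - R) ((cell v).2 + R)) U hW.card_le
    have h1 : (Finset.Icc ((cell v).1 - R) ((cell v).1 + R) ×ˢ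
        Finset.Icc ((cell v).2 - R) ((cell v).2 + R)).card = (2 * R + 1) ^ 2 := by
      rw [Finset.card_product, Int.card_Icc, Int.card_Icc, sq]
      congr 1 <;> omega
    rw [h1] at hcount
    push_cast at hcount
    refine le_trans ?_ hcount
    rw [← SimpleGraph.card_neighborFinset_eq_degree]
    exact_mod_cast Finset.card_le_card fun w hw => by
      rw [SimpleGraph.mem_neighborFinset] at hw
      have h2 := hW.near_of_adj v w hw
      rw [abs_le, abs_le] at h2
      simp only [Finset.mem_filter, Finset.mem_univ, true_and, Finset.mem_product, Finset.mem_Icc]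
      omega
  rcases isEmpty_or_nonempty V with hV | hV
  · have : H.maxDegree ≤ 0 := SimpleGraph.maxDegree_le_of_forall_degree_le _ _ fun v => hV.elim v
    rw [Nat.le_zero.mp this, Nat.cast_zero]
    positivity
  · obtain ⟨v, hv⟩ := H.exists_maximal_degree_vertex
    rw [hv]
    exact hdeg v

/-- The nodes of one cell are pairwise adjacent, so the representative cell of block (0, 0) is a
clique with at least h nodes. -/
theorem WellOccupied.threshold_le_bandwidth (hW : WellOccupied H cell M k R U h) (hM : 0 < M) :
    ENNReal.ofReal h ≤ (bandwidth H : ℝ≥0∞) := by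
  have hcard := hW.le_card_rep hM hM
  set A := cellNodes cell (hW.rep 0 0)
  have hclique : (twoHopGraph H).IsClique A := by
    intro u hu w hw huw
    rw [Finset.mem_coe, mem_cellNodes] at hu hw
    exact ⟨huw, Or.inl (hW.adj_of_touch u w huw (by simp [CellsTouch, hu, hw]))⟩
  have h1 : (A.card : ℕ∞) ≤ bandwidth H := hclique.card_le_chromaticNumber
  calc ENNReal.ofReal h ≤ ENNReal.ofReal A.card := ENNReal.ofReal_le_ofReal hcard
    _ = ((A.card : ℕ∞) : ℝ≥0∞) := by simp
    _ ≤ _ := by exact_mod_cast h1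

variable [DecidableEq V]

theorem pmfExp_ofReal {α : Type*} [Fintype α] (p : PMF α) (F : α → ℝ) (hF : ∀ a, 0 ≤ F a) :
    pmfExp p (fun a => ENNReal.ofReal (F a)) = ENNReal.ofReal (∑ a, (p a).toReal * F a) := by
  unfold pmfExp
  rw [tsum_fintype, ENNReal.ofReal_sum_of_nonneg
    fun a _ => mul_nonneg ENNReal.toReal_nonneg (hF a)]
  exact Finset.sum_congr rfl fun a _ => by
    rw [ENNReal.ofReal_mul ENNReal.toReal_nonneg, ENNReal.ofReal_toReal (p.apply_ne_top a)]

/-- Group the pairings by the partner w of n: if w is a neighbor, the term (z n - z w)² has weight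
at least κ/D. -/
theorem IsRandomPairing.mul_dirichletEnergy_le {κ : ℝ} {μ : PMF (Equiv.Perm V)}
    (hμ : IsRandomPairing H κ μ) (hκ : 0 < κ) {D : ℝ}
    (hD : ∀ [DecidableRel H.Adj], (H.maxDegree : ℝ) ≤ D) (z : V → ℝ) :
    κ / D * dirichletEnergy H z ≤ ∑ σ, (μ σ).toReal * ∑ n, (z n - z (σ n)) ^ 2 := by
  classical
  have hswap : ∑ σ, (μ σ).toReal * ∑ n, (z n - z (σ n)) ^ 2 =
      ∑ n, ∑ w, (∑ σ, if σ n = w then (μ σ).toReal else 0) * (z n - z w) ^ 2 := by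
    simp only [Finset.mul_sum, Finset.sum_mul]
    rw [Finset.sum_comm]
    refine Finset.sum_congr rfl fun n _ => ?_
    rw [Finset.sum_comm]
    refine Finset.sum_congr rfl fun σ _ => ?_
    simp [ite_mul]
  rw [hswap, dirichletEnergy, Finset.mul_sum]
  refine Finset.sum_le_sum fun n _ => ?_
  rw [Finset.mul_sum]
  refine Finset.sum_le_sum fun w _ => ?_
  have hnn : 0 ≤ ∑ σ, if σ n = w then (μ σ).toReal else 0 :=
    Finset.sum_nonneg fun σ _ => by split_ifs <;> simp
  by_cases hnw : H.Adj n w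
  · rw [if_pos hnw]
    gcongr
    have h1 := hμ.balanced n w hnw
    have hpos : 0 < H.maxDegree := by
      refine lt_of_lt_of_le ?_ (H.degree_le_maxDegree n)
      rw [SimpleGraph.degree_pos_iff_exists_adj]
      exact ⟨w, hnw⟩
    have hpos' : (0 : ℝ) < H.maxDegree := by exact_mod_cast hpos
    have h2 : μ.toOuterMeasure {σ | σ n = w} =
        ENNReal.ofReal (∑ σ, if σ n = w then (μ σ).toReal else 0) := by
      rw [PMF.toOuterMeasure_apply_fintype,
        ENNReal.ofReal_sum_of_nonneg fun σ _ => by split_ifs <;> simp]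
      refine Finset.sum_congr rfl fun σ _ => ?_
      by_cases hσ : σ n = w
      · simp [hσ, ENNReal.ofReal_toReal (μ.apply_ne_top σ)]
      · simp [hσ]
    rw [h2] at h1
    have h3 := (ENNReal.ofReal_le_ofReal_iff hnn).mp h1
    refine le_trans ?_ h3
    have h4 := hD
    gcongr
  · rw [if_neg hnw, mul_zero]
    positivity

theorem IsRandomPairing.pmfExp_gossipStep_sq_le {κ : ℝ} {μ : PMF (Equiv.Perm V)}
    (hμ : IsRandomPairing H κ μ) (hκ : 0 < κ) {D C : ℝ} (hD0 : 0 < D) (hC0 : 0 < C)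
    (hD : ∀ [DecidableRel H.Adj], (H.maxDegree : ℝ) ≤ D)
    (hC : ∀ z : V → ℝ, ∑ n, (z n - _root_.average z) ^ 2 ≤ C * dirichletEnergy H z)
    (z : V → ℝ) (hz : ∑ n, z n = 0) :
    pmfExp μ (fun σ => ENNReal.ofReal (∑ n, gossipStep σ z n ^ 2)) ≤
      ENNReal.ofReal (1 - κ / (4 * D * C)) * ENNReal.ofReal (∑ n, z n ^ 2) := by
  rw [pmfExp_ofReal _ _ fun σ => Finset.sum_nonneg fun _ _ => sq_nonneg _,
    ← ENNReal.ofReal_mul' (Finset.sum_nonneg fun _ _ => sq_nonneg _)]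
  apply ENNReal.ofReal_le_ofReal
  have h1 := hμ.mul_dirichletEnergy_le hκ hD z
  have h2 := hC z
  simp only [_root_.average, hz, zero_div, sub_zero] at h2
  have h3 : ∑ σ, (μ σ).toReal * ∑ n, gossipStep σ z n ^ 2 =
      ∑ n, z n ^ 2 - 1 / 4 * ∑ σ, (μ σ).toReal * ∑ n, (z n - z (σ n)) ^ 2 := by
    simp only [sum_gossipStep_sq, mul_sub, Finset.sum_sub_distrib]
    rw [← Finset.sum_mul, sum_toReal_eq_one, one_mul, Finset.mul_sum]
    congr 1
    exact Finset.sum_congr rfl fun σ _ => by ring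
  rw [h3]
  have h4 : κ / (4 * D * C) * ∑ n, z n ^ 2 ≤ 1 / 4 * (κ / D * dirichletEnergy H z) := by
    calc _ ≤ κ / (4 * D * C) * (C * dirichletEnergy H z) := by gcongr
      _ = _ := by field_simp
  linarith

/-! ### Bounds on the averaging time in terms of the spectral gap and of the variance -/

/-- With gap ℓ = κ/(4DC), exp(-ℓt) ≤ ε³ holds from t = 3 ℓ⁻¹ log ε⁻¹ on, whence 12 = 3 · 4; the
summand 1 pays for rounding up. -/
theorem IsRandomPairing.gossipTime_le {κ : ℝ} {μ : PMF (Equiv.Perm V)}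
    (hμ : IsRandomPairing H κ μ) (hκ : 0 < κ) {D C : ℝ} (hD0 : 0 < D) (hC0 : 0 < C)
    (hD : ∀ [DecidableRel H.Adj], (H.maxDegree : ℝ) ≤ D)
    (hC : ∀ z : V → ℝ, ∑ n, (z n - _root_.average z) ^ 2 ≤ C * dirichletEnergy H z)
    {ε : ℝ} (hε : 0 < ε) (hε1 : ε < 1) :
    gossipTime μ ε ≤ ENNReal.ofReal (12 * D * C / κ * Real.log ε⁻¹ + 1) := by
  have hlog : 0 < Real.log ε⁻¹ := Real.log_pos ((one_lt_inv₀ hε).mpr hε1)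
  set s := 12 * D * C / κ * Real.log ε⁻¹ with hs
  have hs0 : 0 ≤ s := by positivity
  have hle := averagingTime_le μ _ (hμ.pmfExp_gossipStep_sq_le hκ hD0 hC0 hD hC) ε hε ⌈s⌉₊ (by
    rw [← Real.le_log_iff_exp_le (by positivity), Real.log_pow]
    have h1 := Nat.le_ceil s
    have h2 : κ / (4 * D * C) * s ≤ κ / (4 * D * C) * ⌈s⌉₊ := by gcongr
    have h3 : κ / (4 * D * C) * s = 3 * Real.log ε⁻¹ := by
      rw [hs]
      field_simp
      ring
    rw [Real.log_inv] at h3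
    push_cast
    linarith)
  calc gossipTime μ ε ≤ ((⌈s⌉₊ : ℕ∞) : ℝ≥0∞) := by
        unfold gossipTime
        exact_mod_cast hle
    _ = ENNReal.ofReal ⌈s⌉₊ := by simp
    _ ≤ _ := ENNReal.ofReal_le_ofReal (Nat.ceil_lt_add_one hs0).le

/-- Bounds ε(2 - ε) = 1 - (1 - ε)² by a fixed power of ε, uniformly for ε ≤ ε₀, so that the lower
bound on time is proportional to log ε⁻¹. -/
theorem mul_two_sub_le_exp {ε₀ ε : ℝ} (hε₀ : ε₀ < 1) (hε : 0 < ε) (hεε : ε ≤ ε₀) :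
    ε * (2 - ε) ≤ Real.exp (-((1 - ε₀) ^ 2 / 3 * Real.log ε⁻¹)) := by
  rw [Real.log_inv]
  have hlog : Real.log ε ≤ 0 := Real.log_nonpos hε.le (by linarith)
  set δ := (1 - ε₀) ^ 2 / 3 with hδ
  have hδ1 : δ ≤ 1 / 2 := by
    rw [hδ]
    nlinarith
  have hδ0 : 0 ≤ δ := by positivity
  rcases le_or_gt ε (1 / 4) with h | h
  -- For small ε, ε(2 - ε) ≤ 2ε ≤ √ε, and the exponent δ is at most 1/2.
  · have h1 : Real.sqrt ε = Real.exp (Real.log ε / 2) := by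
      rw [Real.exp_half, Real.exp_log hε]
    have h2 : Real.exp (Real.log ε / 2) ≤ Real.exp (-(δ * -Real.log ε)) :=
      Real.exp_le_exp.mpr (by nlinarith)
    rw [← h1] at h2
    refine le_trans ?_ h2
    apply Real.le_sqrt_of_sq_le
    have h3 : ε * (2 - ε) ≤ 2 * ε := by nlinarith
    have h4 : 0 ≤ ε * (2 - ε) := by
      have : 0 ≤ 2 - ε := by linarith
      positivity
    calc (ε * (2 - ε)) ^ 2 ≤ (2 * ε) ^ 2 := by gcongr
      _ ≤ ε := by nlinarith
  -- For ε > 1/4, log ε⁻¹ ≤ 3, so δ log ε⁻¹ ≤ (1 - ε₀)² ≤ (1 - ε)², and 1 + y ≤ exp y finishes.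
  · have h1 := Real.add_one_le_exp (-(δ * -Real.log ε))
    have h2 := Real.one_sub_inv_le_log_of_pos hε
    have h3 : ε⁻¹ ≤ 4 := by
      rw [inv_le_comm₀ hε (by norm_num)]
      linarith
    have h4 : δ * (-3) ≤ δ * Real.log ε := by
      gcongr
      linarith
    refine le_trans ?_ h1
    have h5 : (1 - ε₀) ^ 2 ≤ (1 - ε) ^ 2 := by
      have : 0 ≤ 1 - ε₀ := by linarith
      gcongr
    rw [hδ] at h4 ⊢
    nlinarith

/-- The centered f is the test vector: a pairing moves each node along an edge or not at all, so ∑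
(f n - f (σ n))² is at most |V| r², a small fraction of the variance. -/
theorem le_gossipTime_of_lipschitz {κ : ℝ} {μ : PMF (Equiv.Perm V)}
    (hμ : IsRandomPairing H κ μ) (f : V → ℝ) {r η : ℝ} (hη0 : 0 < η) (hη : η ≤ 1 / 2)
    (hlip : ∀ u w, H.Adj u w → |f u - f w| ≤ r)
    (hvar : Fintype.card V * r ^ 2 ≤ 4 * η * ∑ n, (f n - _root_.average f) ^ 2)
    (hpos : 0 < ∑ n, (f n - _root_.average f) ^ 2)
    {ε₀ ε : ℝ} (hε₀ : ε₀ < 1) (hε : 0 < ε) (hεε : ε ≤ ε₀) :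
    ENNReal.ofReal ((1 - ε₀) ^ 2 / 3 * Real.log ε⁻¹ / (2 * η)) ≤ gossipTime μ ε := by
  have hV : Nonempty V := by
    by_contra hV
    rw [not_nonempty_iff] at hV
    simp at hpos
  have hc : (Fintype.card V : ℝ) ≠ 0 := by exact_mod_cast Fintype.card_ne_zero
  refine le_averagingTime μ (fun σ hσ => (hμ.isPairing σ hσ).1)
    (fun n => f n - _root_.average f) hpos ?_ η (by linarith) ?_ ε hε (by linarith) _ ?_
  · simp only [_root_.average, Finset.sum_sub_distrib, Finset.sum_const, Finset.card_univ,
      nsmul_eq_mul]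
    field_simp
    ring
  · intro σ hσ
    refine le_trans ?_ hvar
    calc _ ≤ ∑ _n : V, r ^ 2 := by
          refine Finset.sum_le_sum fun n _ => ?_
          rw [sub_sub_sub_cancel_right]
          rcases eq_or_ne (σ n) n with h | h
          · rw [h, sub_self]
            nlinarith [sq_nonneg r]
          · exact sq_le_sq' (by linarith [(abs_le.mp (hlip _ _ ((hμ.isPairing σ hσ).2 n h))).1])
              (abs_le.mp (hlip _ _ ((hμ.isPairing σ hσ).2 n h))).2
      _ = _ := by rw [Finset.sum_const, Finset.card_univ, nsmul_eq_mul]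
  · intro t ht
    rw [← ENNReal.ofReal_natCast]
    apply ENNReal.ofReal_le_ofReal
    by_contra! hlt
    rw [lt_div_iff₀ (by positivity)] at hlt
    -- Uses (1 - η)(1 + 2η) ≥ 1, which is where η ≤ 1/2 enters.
    have h1 : Real.exp (-(2 * η)) ≤ 1 - η := by
      have h2 : Real.exp (-(2 * η)) * Real.exp (2 * η) = 1 := by rw [← Real.exp_add]; simp
      have h3 := Real.add_one_le_exp (2 * η)
      have h4 : 1 ≤ (1 - η) * Real.exp (2 * η) := by
        calc 1 ≤ (1 - η) * (2 * η + 1) := by nlinarith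
          _ ≤ _ := by
              gcongr
              linarith
      exact le_of_mul_le_mul_right (h2.trans_le h4) (Real.exp_pos _)
    have h2 : Real.exp (-(t * (2 * η))) ≤ (1 - η) ^ t := by
      calc _ = Real.exp (-(2 * η)) ^ t := by
            rw [← Real.exp_nat_mul]
            congr 1
            ring
        _ ≤ _ := by gcongr
    have h3 := mul_two_sub_le_exp hε₀ hε hεε
    have h4 : Real.exp (-((1 - ε₀) ^ 2 / 3 * Real.log ε⁻¹)) < Real.exp (-(t * (2 * η))) :=
      Real.exp_lt_exp.mpr (by linarith)
    linarith

end Consequences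

/-! ### Resource metrics in terms of the averaging time -/

theorem tsum_slots (n : ℕ) (c : ℝ≥0∞) :
    ∑' _t : {t : ℕ // 1 ≤ t ∧ (t : ℕ∞) ≤ (n : ℕ∞)}, c = n * c := by
  have e : ∀ t : ℕ, (1 ≤ t ∧ (t : ℕ∞) ≤ (n : ℕ∞)) ↔ t ∈ Finset.Icc 1 n := fun t => by simp
  rw [← (Equiv.subtypeEquivRight e).symm.tsum_eq fun _ => c,
    Finset.tsum_subtype (Finset.Icc 1 n) fun _ => c]
  simp

theorem totalEnergy_const {V : Type*} [Fintype V] (K n : ℕ) (P : ℝ) :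
    totalEnergy (V := V) K n (fun _ _ => P) = ENNReal.ofReal (K * (n * (Fintype.card V * P))) := by
  unfold totalEnergy
  rw [tsum_slots, Finset.sum_const, Finset.card_univ, nsmul_eq_mul,
    ENNReal.ofReal_mul (by positivity), ENNReal.ofReal_mul (by positivity),
    ENNReal.ofReal_mul (by positivity)]
  simp

theorem exists_averagingTime_eq {V : Type*} [Fintype V] [DecidableEq V]
    {μ : PMF (Equiv.Perm V)} {ε b : ℝ} (h : gossipTime μ ε ≤ ENNReal.ofReal b) :
    ∃ n : ℕ, averagingTime μ ε = n := by
  rcases hT : averagingTime μ ε with _ | n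
  · unfold gossipTime at h
    rw [hT] at h
    exact absurd h (not_le.mpr ENNReal.ofReal_lt_top)
  · exact ⟨n, rfl⟩

theorem gossip_resources {V : Type*} [Fintype V] [DecidableEq V] {α γ G r : ℝ} {K : ℕ}
    (hK : 1 ≤ K) {x : V → Plane} {μ : PMF (Equiv.Perm V)} {ε T₁ T₂ h : ℝ} (hT₁ : 0 ≤ T₁)
    (hT₂ : 0 ≤ T₂)
    (h₁ : ENNReal.ofReal T₁ ≤ gossipTime μ ε) (h₂ : gossipTime μ ε ≤ ENNReal.ofReal T₂)
    (hB : ENNReal.ofReal h ≤ (bandwidth (radiusGraph α γ G r x) : ℝ≥0∞))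
    (hP : 0 ≤ transmitPower α γ G r) :
    ENNReal.ofReal (T₁ * h) ≤ gossipBandwidth α γ G K r x μ ε ∧
      ENNReal.ofReal (T₁ * (Fintype.card V * transmitPower α γ G r)) ≤
        gossipEnergy α γ G K r μ ε ∧
      gossipEnergy α γ G K r μ ε ≤
        ENNReal.ofReal (K * (T₂ * (Fintype.card V * transmitPower α γ G r))) := by
  -- The upper bound excludes an infinite averaging time, so both resources are finite sums of equal
  -- slots.
  obtain ⟨n, hn⟩ := exists_averagingTime_eq h₂
  have hK' : (1 : ℝ) ≤ K := by exact_mod_cast hK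
  have hgt : gossipTime μ ε = ENNReal.ofReal n := by
    unfold gossipTime
    rw [hn]
    simp
  rw [hgt] at h₁ h₂
  have h₁' := (ENNReal.ofReal_le_ofReal_iff (Nat.cast_nonneg n)).mp h₁
  have h₂' := (ENNReal.ofReal_le_ofReal_iff hT₂).mp h₂
  refine ⟨?_, ?_, ?_⟩
  · unfold gossipBandwidth timeBandwidth
    rw [hn, tsum_slots, ENNReal.ofReal_mul hT₁]
    calc _ ≤ 1 * (ENNReal.ofReal n * (bandwidth (radiusGraph α γ G r x) : ℝ≥0∞)) := by
          rw [one_mul]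
          gcongr
      _ ≤ _ := by
          rw [ENNReal.ofReal_natCast]
          gcongr
          exact_mod_cast hK
  · unfold gossipEnergy
    rw [hn, totalEnergy_const]
    apply ENNReal.ofReal_le_ofReal
    calc _ ≤ 1 * ((n : ℝ) * (Fintype.card V * transmitPower α γ G r)) := by
          rw [one_mul]
          gcongr
      _ ≤ _ := by gcongr
  · unfold gossipEnergy
    rw [hn, totalEnergy_const]
    apply ENNReal.ofReal_le_ofReal
    gcongr

end

noncomputable section

/-! ### Typical placements -/

/-- The cells in the left third of the grid. -/
def leftCells (m : ℤ) : Finset (ℤ × ℤ) := Finset.Ico 0 (m / 3) ×ˢ Finset.Ico 0 m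

/-- The cells in the right third of the grid. -/
def rightCells (m : ℤ) : Finset (ℤ × ℤ) := Finset.Ico (m - m / 3) m ×ˢ Finset.Ico 0 m

theorem leftCells_subset {m : ℤ} : leftCells m ⊆ gridCells m := by
  intro c hc
  simp only [leftCells, Finset.mem_product, Finset.mem_Ico] at hc
  rw [mem_gridCells]
  omega

theorem rightCells_subset {m : ℤ} : rightCells m ⊆ gridCells m := by
  intro c hc
  simp only [rightCells, Finset.mem_product, Finset.mem_Ico] at hc
  rw [mem_gridCells]
  omega

theorem sq_le_card_leftCells {m : ℕ} (hm : 3 ≤ m) :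
    (m : ℝ) ^ 2 / 6 ≤ (leftCells m).card ∧ (m : ℝ) ^ 2 / 6 ≤ (rightCells m).card := by
  have h1 : (leftCells m).card = m / 3 * m := by
    simp only [leftCells, Finset.card_product, Int.card_Ico]
    congr 1
  have h2 : (rightCells m).card = m / 3 * m := by
    simp only [rightCells, Finset.card_product, Int.card_Ico]
    congr 1
    omega
  have h3 : m * m ≤ 6 * (m / 3 * m) := by
    rw [← mul_assoc]
    gcongr
    omega
  have h4 : (m : ℝ) ^ 2 / 6 ≤ (m / 3 * m : ℕ) := by
    rw [div_le_iff₀ (by norm_num), sq, mul_comm _ (6 : ℝ)]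
    exact_mod_cast h3
  rw [h1, h2]
  exact ⟨h4, h4⟩

/-- The placement is well occupied and both outer thirds of the square hold many nodes. -/
structure IsTypicalPlacement (α γ G r : ℝ) {N : ℕ} (M k R : ℕ) (U h : ℝ) (x : Fin N → Plane) :
    Prop where
  wellOccupied : WellOccupied (radiusGraph α γ G r x) (fun n => cellOf (M * (k * R)) (x n)) M k R U h
  left : (N : ℝ) / 12 ≤ ∑ c ∈ leftCells (M * (k * R) : ℕ),
    ((cellNodes (fun n => cellOf (M * (k * R)) (x n)) c).card : ℝ)
  right : (N : ℝ) / 12 ≤ ∑ c ∈ rightCells (M * (k * R) : ℕ),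
    ((cellNodes (fun n => cellOf (M * (k * R)) (x n)) c).card : ℝ)

/-- Whatever c is, one outer third of the square lies at horizontal distance at least 1/6 from it;
its N/12 nodes contribute 1/36 each, and 12 · 36 = 432. -/
theorem IsTypicalPlacement.variance_ge {α γ G r : ℝ} {N : ℕ} {M k R : ℕ} {U h : ℝ}
    {x : Fin N → Plane} (hx : IsTypicalPlacement α γ G r M k R U h x) (hm : 0 < M * (k * R))
    (c : ℝ) : (N : ℝ) / 432 ≤ ∑ n, (x n 0 - c) ^ 2 := by
  have hl := hx.left
  have hr := hx.right
  rw [sum_card_cellNodes] at hl hr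
  set m := M * (k * R)
  have hm' : (0 : ℝ) < m := by exact_mod_cast hm
  have key : ∀ S : Set Plane, (N : ℝ) / 12 ≤ ∑ n, S.indicator (1 : Plane → ℝ) (x n) →
      (∀ p ∈ S, (1 / 6 : ℝ) ^ 2 ≤ (p 0 - c) ^ 2) → (N : ℝ) / 432 ≤ ∑ n, (x n 0 - c) ^ 2 := by
    intro S hS hp
    calc (N : ℝ) / 432 ≤ (1 / 6 : ℝ) ^ 2 * ∑ n, S.indicator (1 : Plane → ℝ) (x n) := by linarith
      _ ≤ _ := by
          rw [Finset.mul_sum]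
          refine Finset.sum_le_sum fun n _ => ?_
          by_cases hn : x n ∈ S
          · simpa [hn] using hp _ hn
          · simp only [Set.indicator_of_notMem hn, mul_zero]
            positivity
  rcases le_or_gt c (1 / 2) with hc | hc
  · refine key _ hr fun p hp => ?_
    simp only [Set.mem_ofPred_eq, cellOf, rightCells, Finset.mem_product, Finset.mem_Ico] at hp
    have h1 := Int.floor_le (p 0 * m)
    have h2 : 2 * (m : ℤ) ≤ 3 * ⌊p 0 * m⌋ := by omega
    have h3 : 2 * (m : ℝ) ≤ 3 * ⌊p 0 * m⌋ := by exact_mod_cast h2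
    have h4 : 2 / 3 ≤ p 0 := le_of_mul_le_mul_right (by linarith) hm'
    gcongr
    linarith
  · refine key _ hl fun p hp => ?_
    simp only [Set.mem_ofPred_eq, cellOf, leftCells, Finset.mem_product, Finset.mem_Ico] at hp
    have h1 := Int.lt_floor_add_one (p 0 * m)
    have h2 : 3 * ⌊p 0 * m⌋ + 3 ≤ (m : ℤ) := by omega
    have h3 : 3 * (⌊p 0 * m⌋ : ℝ) + 3 ≤ m := by exact_mod_cast h2
    have h4 : p 0 ≤ 1 / 3 := le_of_mul_le_mul_right (by linarith) hm'
    nlinarith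

theorem isTypicalPlacement_of_counts {α γ G r : ℝ} (hα : 0 < α) (hγ : 0 < γ) (hG : 0 < G)
    {N M k R : ℕ} {U h : ℝ} (hm : 0 < M * (k * R)) (hrm : 3 ≤ r * (M * (k * R) : ℕ))
    (hrR : r * (M * (k * R) : ℕ) + 1 ≤ R) (hh : 0 < h) (hU : 0 ≤ U) {x : Fin N → Plane}
    (hconn : (radiusGraph α γ G r x).Connected)
    (hgrid : ∀ n, cellOf (M * (k * R)) (x n) ∈ gridCells (M * (k * R) : ℕ))
    (hupper : ∀ c ∈ gridCells (M * (k * R) : ℕ),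
      ((cellNodes (fun n => cellOf (M * (k * R)) (x n)) c).card : ℝ) < U)
    (hlower : ∀ a < M, ∀ b < M, ∀ F ∈ Finset.powersetCard k (windowCells (k * R : ℕ)
      (a * (k * R : ℕ)) (b * (k * R : ℕ)) ∩ gridCells (M * (k * R) : ℕ)),
      k * h < ∑ c ∈ F, ((cellNodes (fun n => cellOf (M * (k * R)) (x n)) c).card : ℝ))
    (hleft : (N : ℝ) / 12 < ∑ c ∈ leftCells (M * (k * R) : ℕ),
      ((cellNodes (fun n => cellOf (M * (k * R)) (x n)) c).card : ℝ))
    (hright : (N : ℝ) / 12 < ∑ c ∈ rightCells (M * (k * R) : ℕ),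
      ((cellNodes (fun n => cellOf (M * (k * R)) (x n)) c).card : ℝ)) :
    IsTypicalPlacement α γ G r M k R U h x := by
  have hm' : (0 : ℝ) < (M * (k * R) : ℕ) := by exact_mod_cast hm
  have hr0 : 0 ≤ r := nonneg_of_mul_nonneg_left (by linarith) hm'
  have hcast : ((M * (k * R) : ℕ) : ℤ) = M * (k * R : ℕ) := Nat.cast_mul _ _
  refine ⟨⟨?_, ?_, ?_, hconn.preconnected, ?_, hh, ?_, ?_⟩, hleft.le, hright.le⟩
  · intro n
    rw [← hcast]
    exact hgrid n
  · intro u w huw ht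
    exact (radiusGraph_adj_iff hα hγ hG hr0).mpr ⟨huw, dist_le_of_cellsTouch hm hrm ht⟩
  · intro u w huw
    exact cellOf_near_of_dist_le hrR ((radiusGraph_adj_iff hα hγ hG hr0).mp huw).2
  · have : (0 : ℝ) < R := by linarith
    exact_mod_cast this
  · intro c
    by_cases hc : c ∈ gridCells (M * (k * R) : ℕ)
    · exact (hupper c hc).le
    · have : cellNodes (fun n => cellOf (M * (k * R)) (x n)) c = ∅ := by
        ext n
        simp only [mem_cellNodes, Finset.notMem_empty, iff_false]
        rintro rfl
        exact hc (hgrid n)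
      rw [this]
      simpa using hU
  · intro a b ha hb
    by_contra! hcon
    -- If k sparse cells existed, any k of them would hold at most kh nodes together, against the
    -- lower bound on sums over k cells.
    obtain ⟨F, hF, hFk⟩ := Finset.exists_subset_card_eq hcon
    have hmem : F ∈ Finset.powersetCard k (windowCells (k * R : ℕ)
        (a * (k * R : ℕ)) (b * (k * R : ℕ)) ∩ gridCells (M * (k * R) : ℕ)) := by
      rw [Finset.mem_powersetCard, hcast]
      exact ⟨hF.trans (Finset.filter_subset _ _), hFk⟩
    have h1 := hlower a ha b hb F hmem
    have h2 : ∑ c ∈ F, ((cellNodes (fun n => cellOf (M * (k * R)) (x n)) c).card : ℝ) ≤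
        ∑ c ∈ F, h := Finset.sum_le_sum fun c hc => (Finset.mem_filter.mp (hF hc)).2.le
    rw [Finset.sum_const, hFk, nsmul_eq_mul] at h2
    linarith

/-- A union bound. Sparseness is tested on all k-subsets of each window; there are at most 2^(9L²)
of them, a constant because L will not depend on N. -/
theorem placementLaw_not_isTypicalPlacement_le {α γ G r : ℝ} (hα : 0 < α) (hγ : 0 < γ)
    (hG : 0 < G) {N M k R : ℕ} {U h : ℝ} (hm : 3 ≤ M * (k * R))
    (hrm : 3 ≤ r * (M * (k * R) : ℕ)) (hrR : r * (M * (k * R) : ℕ) + 1 ≤ R) (hh : 0 < h)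
    (hU : 0 ≤ U) :
    placementLaw N {x | ¬ IsTypicalPlacement α γ G r M k R U h x} ≤
      placementLaw N {x | ¬ (radiusGraph α γ G r x).Connected} +
      ENNReal.ofReal (((M * (k * R) : ℕ) : ℝ) ^ 2 *
          Real.exp (2 * (N / ((M * (k * R) : ℕ) : ℝ) ^ 2) - U) +
        (M : ℝ) ^ 2 * (2 ^ (3 * (k * R) * (3 * (k * R))) *
          Real.exp (k * h - 3 / 5 * (k * (N / ((M * (k * R) : ℕ) : ℝ) ^ 2)))) +
        2 * Real.exp (-(N / 60))) := by
  have hm0 : 0 < M * (k * R) := by omega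
  have hm' : (0 : ℝ) < (M * (k * R) : ℕ) := by exact_mod_cast hm0
  set m := M * (k * R) with hmdef
  set L := k * R with hL
  let cnt : (Fin N → Plane) → ℤ × ℤ → ℝ := fun x c =>
    ((cellNodes (fun n => cellOf m (x n)) c).card : ℝ)
  let W : ℕ → ℕ → Finset (ℤ × ℤ) := fun a b => windowCells L (a * L) (b * L) ∩ gridCells m
  have hsub : {x : Fin N → Plane | ¬ IsTypicalPlacement α γ G r M k R U h x} ⊆
      {x | ¬ (radiusGraph α γ G r x).Connected} ∪
      ({x | ¬ ∀ n, cellOf m (x n) ∈ gridCells m} ∪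
      ((⋃ c ∈ gridCells m, {x | U ≤ ∑ d ∈ {c}, cnt x d}) ∪
      ((⋃ a ∈ Finset.range M, ⋃ b ∈ Finset.range M, ⋃ F ∈ Finset.powersetCard k (W a b),
        {x | ∑ c ∈ F, cnt x c ≤ k * h}) ∪
      ({x | ∑ c ∈ leftCells m, cnt x c ≤ N / 12} ∪
        {x | ∑ c ∈ rightCells m, cnt x c ≤ N / 12})))) := by
    intro x hx
    by_contra hcon
    simp only [Set.mem_union, Set.mem_ofPred_eq, Set.mem_iUnion, not_or, not_not, not_exists,
      not_le, Finset.sum_singleton, Finset.mem_range] at hcon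
    obtain ⟨h1, h2, h3, h4, h5, h6⟩ := hcon
    exact hx (isTypicalPlacement_of_counts hα hγ hG hm0 hrm hrR hh hU h1 h2 h3 h4 h5 h6)
  have hreal : ∀ s : Set (Fin N → Plane), placementLaw N s =
      ENNReal.ofReal ((placementLaw N).real s) := fun s => (ofReal_measureReal).symm
  have hle : ∀ (s : Set (Fin N → Plane)) (b : ℝ), (placementLaw N).real s ≤ b →
      placementLaw N s ≤ ENNReal.ofReal b := fun s b hb => by
    rw [hreal]
    exact ENNReal.ofReal_le_ofReal hb
  set q := (N : ℝ) / (m : ℝ) ^ 2 with hq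
  have b2 : placementLaw N {x | ¬ ∀ n, cellOf m (x n) ∈ gridCells m} = 0 :=
    ae_iff.mp (ae_cellOf_mem_gridCells N hm0)
  have b3 : placementLaw N (⋃ c ∈ gridCells m, {x | U ≤ ∑ d ∈ {c}, cnt x d}) ≤
      ENNReal.ofReal ((m : ℝ) ^ 2 * Real.exp (2 * q - U)) := by
    refine (measure_biUnion_finset_le _ _).trans ?_
    calc _ ≤ ∑ c ∈ gridCells m, ENNReal.ofReal (Real.exp (2 * q - U)) := by
          refine Finset.sum_le_sum fun c hc => hle _ _ ?_
          refine (placementLaw_le_count N hm0 (Finset.singleton_subset_iff.mpr hc) U).trans ?_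
          rw [Finset.card_singleton, Nat.cast_one, mul_one]
      _ = _ := by
          rw [Finset.sum_const, nsmul_eq_mul, ENNReal.ofReal_mul (by positivity),
            show (gridCells (m : ℤ)).card = m ^ 2 by simp [gridCells, sq],
            ENNReal.ofReal_pow (Nat.cast_nonneg _)]
          simp
  have b4 : placementLaw N (⋃ a ∈ Finset.range M, ⋃ b ∈ Finset.range M,
      ⋃ F ∈ Finset.powersetCard k (W a b), {x | ∑ c ∈ F, cnt x c ≤ k * h}) ≤
      ENNReal.ofReal ((M : ℝ) ^ 2 * (2 ^ (3 * L * (3 * L)) *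
        Real.exp (k * h - 3 / 5 * (k * q)))) := by
    have hone : ∀ a b : ℕ, placementLaw N (⋃ F ∈ Finset.powersetCard k (W a b),
        {x | ∑ c ∈ F, cnt x c ≤ k * h}) ≤
        ENNReal.ofReal (2 ^ (3 * L * (3 * L)) * Real.exp (k * h - 3 / 5 * (k * q))) := by
      intro a b
      refine (measure_biUnion_finset_le _ _).trans ?_
      calc _ ≤ ∑ F ∈ Finset.powersetCard k (W a b),
            ENNReal.ofReal (Real.exp (k * h - 3 / 5 * (k * q))) := by
            refine Finset.sum_le_sum fun F hF => hle _ _ ?_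
            rw [Finset.mem_powersetCard] at hF
            refine (placementLaw_count_le N hm0 (hF.1.trans Finset.inter_subset_right) _).trans ?_
            rw [hF.2, hq]
            apply Real.exp_le_exp.mpr
            apply le_of_eq
            ring
        _ = ENNReal.ofReal ((Finset.powersetCard k (W a b)).card *
            Real.exp (k * h - 3 / 5 * (k * q))) := by
            rw [Finset.sum_const, nsmul_eq_mul, ENNReal.ofReal_mul (by positivity),
              ENNReal.ofReal_natCast]
        _ ≤ _ := by
            apply ENNReal.ofReal_le_ofReal
            gcongr
            have h1 : (Finset.powersetCard k (W a b)).card ≤ 2 ^ (W a b).card := by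
              rw [← Finset.card_powerset]
              exact Finset.card_le_card fun F hF =>
                Finset.mem_powerset.mpr (Finset.mem_powersetCard.mp hF).1
            have h2 : (W a b).card ≤ 3 * L * (3 * L) := by
              refine (Finset.card_le_card Finset.inter_subset_left).trans (le_of_eq ?_)
              rw [windowCells, Finset.card_product, Int.card_Ico, Int.card_Ico]
              congr 1 <;> omega
            have h3 : (Finset.powersetCard k (W a b)).card ≤ 2 ^ (3 * L * (3 * L)) :=
              h1.trans (Nat.pow_le_pow_right (by norm_num) h2)
            exact_mod_cast h3
    refine (measure_biUnion_finset_le _ _).trans ?_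
    calc _ ≤ ∑ a ∈ Finset.range M, ∑ b ∈ Finset.range M,
          ENNReal.ofReal (2 ^ (3 * L * (3 * L)) * Real.exp (k * h - 3 / 5 * (k * q))) :=
          Finset.sum_le_sum fun a _ => (measure_biUnion_finset_le _ _).trans
            (Finset.sum_le_sum fun b _ => hone a b)
      _ = _ := by
          rw [Finset.sum_const, Finset.sum_const, Finset.card_range, nsmul_eq_mul, nsmul_eq_mul,
            ENNReal.ofReal_mul (p := (M : ℝ) ^ 2) (by positivity),
            ENNReal.ofReal_pow (Nat.cast_nonneg _), ENNReal.ofReal_natCast, sq]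
          ring
  -- The expected count is at least N/6, and N/12 - (3/5)(N/6) = -N/60.
  have hthird : ∀ F : Finset (ℤ × ℤ), F ⊆ gridCells m → (m : ℝ) ^ 2 / 6 ≤ F.card →
      placementLaw N {x | ∑ c ∈ F, cnt x c ≤ N / 12} ≤ ENNReal.ofReal (Real.exp (-(N / 60))) := by
    intro F hF hcard
    refine hle _ _ ((placementLaw_count_le N hm0 hF _).trans ?_)
    apply Real.exp_le_exp.mpr
    have h1 : (N : ℝ) * ((m : ℝ) ^ 2 / 6) / (m : ℝ) ^ 2 ≤ N * F.card / (m : ℝ) ^ 2 := by gcongr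
    have h2 : (N : ℝ) * ((m : ℝ) ^ 2 / 6) / (m : ℝ) ^ 2 = N / 6 := by field_simp
    linarith
  have b5 := hthird _ leftCells_subset (sq_le_card_leftCells hm).1
  have b6 := hthird _ rightCells_subset (sq_le_card_leftCells hm).2
  refine (measure_mono hsub).trans ((measure_union_le _ _).trans (add_le_add le_rfl ?_))
  refine (measure_union_le _ _).trans ?_
  rw [b2, zero_add]
  refine (measure_union_le _ _).trans ?_
  rw [add_assoc, ENNReal.ofReal_add (by positivity) (by positivity)]
  refine add_le_add b3 ((measure_union_le _ _).trans ?_)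
  rw [ENNReal.ofReal_add (by positivity) (by positivity)]
  refine add_le_add b4 ((measure_union_le _ _).trans ?_)
  rw [two_mul, ENNReal.ofReal_add (by positivity) (by positivity)]
  exact add_le_add b5 b6

end

noncomputable section

/-! ### Resource bounds for typical placements -/

/-- Factors the energy scale into the time scale and the total power of n nodes. -/
theorem rpow_mul_rpow_log_eq {n l α E : ℝ} (hn : 0 < n) (hl : 0 < l) :
    n ^ (2 - α / 2) * l ^ (α / 2 - 1) * E = n * E / l * (n * (l / n) ^ (α / 2)) := by
  rw [Real.rpow_sub hn, Real.rpow_sub hl, Real.div_rpow hl.le hn.le, Real.rpow_one, Real.rpow_two]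
  have h1 : 0 < n ^ (α / 2) := Real.rpow_pos_of_pos hn _
  field_simp

/-- Collects the deterministic bounds with l = log N. The degree bound is of order l and the
Poincaré constant of order N/l², so their product is of order N/l. The lower bound uses η = 108 r²,
whose denominator 2η gives the 216 in cT. -/
theorem IsTypicalPlacement.gossip_bounds {α γ G κ ε₀ r c₁ c₂ a u l : ℝ} {K N M k R : ℕ}
    (hα : 2 ≤ α) (hγ : 0 < γ) (hG : 0 < G) (hK : 1 ≤ K) (hκ : 0 < κ) (hε₀ : ε₀ < 1)
    (hc₁ : 0 < c₁) (hc₂ : 0 < c₂) (ha : 0 < a) (hu : 0 < u) (hl : 1 ≤ l) (hlN : l ^ 5 ≤ N)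
    (hr0 : 0 ≤ r) (hr₁ : c₁ ^ 2 * (l / N) ≤ r ^ 2) (hr₂ : r ^ 2 ≤ c₂ ^ 2 * (l / N))
    (hη : 108 * r ^ 2 ≤ 1 / 2) (hM : 0 < M) (hk : 0 < k) (hMN : (M : ℝ) ^ 2 ≤ N / (a * l))
    {x : Fin N → Plane} (hx : IsTypicalPlacement α γ G r M k R (u * l) (a / 4 * l) x)
    {cT CT : ℝ} (hcT : cT = (1 - ε₀) ^ 2 / 3 / (216 * c₂ ^ 2))
    (hCT : CT = 12 * ((2 * R + 1) ^ 2 * u) * (1458 * ((k * R : ℕ) : ℝ) ^ 6 * u ^ 3 +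
      41472 * ((k * R : ℕ) : ℝ) ^ 4 * u / a ^ 3) / κ + 1 / Real.log ε₀⁻¹)
    {μ : PMF (Equiv.Perm (Fin N))} (hμ : IsRandomPairing (radiusGraph α γ G r x) κ μ)
    {ε : ℝ} (hε : 0 < ε) (hεε : ε ≤ ε₀) :
    (ENNReal.ofReal (cT * (N * Real.log ε⁻¹ / l)) ≤ gossipTime μ ε ∧
      gossipTime μ ε ≤ ENNReal.ofReal (CT * (N * Real.log ε⁻¹ / l))) ∧
    ENNReal.ofReal (cT * (a / 4) * (N * Real.log ε⁻¹)) ≤ gossipBandwidth α γ G K r x μ ε ∧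
    (ENNReal.ofReal (cT * (γ / G * c₁ ^ α) * ((N : ℝ) ^ (2 - α / 2) * l ^ (α / 2 - 1) *
        Real.log ε⁻¹)) ≤ gossipEnergy α γ G K r μ ε ∧
      gossipEnergy α γ G K r μ ε ≤ ENNReal.ofReal (K * CT * (γ / G * c₂ ^ α) *
        ((N : ℝ) ^ (2 - α / 2) * l ^ (α / 2 - 1) * Real.log ε⁻¹))) := by
  have hW := hx.wellOccupied
  have hl0 : 0 < l := by linarith
  have hlN1 : l ≤ N := (le_self_pow₀ hl (by norm_num : 5 ≠ 0)).trans hlN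
  have hN0 : (0 : ℝ) < N := by linarith
  have hlog : 0 < Real.log ε⁻¹ := Real.log_pos ((one_lt_inv₀ hε).mpr (by linarith))
  have hε₀0 : 0 < ε₀ := by linarith
  have hlog₀ : 0 < Real.log ε₀⁻¹ := Real.log_pos ((one_lt_inv₀ hε₀0).mpr hε₀)
  have hlogle : Real.log ε₀⁻¹ ≤ Real.log ε⁻¹ :=
    Real.log_le_log (by positivity) (inv_anti₀ hε hεε)
  have hε₀' : 0 < 1 - ε₀ := by linarith
  have hr2 : 0 < r ^ 2 := lt_of_lt_of_le (by positivity) hr₁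
  have hcT0 : 0 ≤ cT := by rw [hcT]; positivity
  have hCT0 : 0 ≤ CT := by rw [hCT]; positivity
  have hRpos := hW.pos_range
  have hlower : ENNReal.ofReal (cT * (N * Real.log ε⁻¹ / l)) ≤ gossipTime μ ε := by
    set f : Fin N → ℝ := fun n => x n 0 with hf
    have hvar := hx.variance_ge (Nat.mul_pos hM (Nat.mul_pos hk hRpos)) (_root_.average f)
    have h1 := le_gossipTime_of_lipschitz hμ f (r := r) (η := 108 * r ^ 2) (by positivity) hη
      (fun v w hvw => (abs_coord_sub_le_dist _ _ 0).trans
        ((radiusGraph_adj_iff (by linarith) hγ hG hr0).mp hvw).2)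
      (by
        rw [Fintype.card_fin]
        calc (N : ℝ) * r ^ 2 = 4 * (108 * r ^ 2) * (N / 432) := by ring
          _ ≤ _ := by gcongr)
      (lt_of_lt_of_le (by positivity) hvar) hε₀ hε hεε
    refine le_trans (ENNReal.ofReal_le_ofReal ?_) h1
    calc cT * (N * Real.log ε⁻¹ / l)
        = (1 - ε₀) ^ 2 / 3 * Real.log ε⁻¹ / (2 * (108 * (c₂ ^ 2 * (l / N)))) := by
          rw [hcT]
          field_simp
          ring
      _ ≤ _ := by gcongr
  have hupper : gossipTime μ ε ≤ ENNReal.ofReal (CT * (N * Real.log ε⁻¹ / l)) := by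
    set D₀ : ℝ := (2 * R + 1) ^ 2 * u with hD₀
    set P₀ : ℝ := 1458 * ((k * R : ℕ) : ℝ) ^ 6 * u ^ 3 + 41472 * ((k * R : ℕ) : ℝ) ^ 4 * u / a ^ 3
      with hP₀
    have hL : (0 : ℝ) < (k * R : ℕ) := by exact_mod_cast Nat.mul_pos hk hRpos
    have hD₀pos : 0 < D₀ := by positivity
    have hP₀pos : 0 < P₀ := by positivity
    have hpoin : 1458 * ((k * R : ℕ) : ℝ) ^ 6 * (u * l) ^ 3 + 2592 * ((k * R : ℕ) : ℝ) ^ 4 *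
        (u * l) * (M : ℝ) ^ 2 / (a / 4 * l) ^ 2 ≤ P₀ * (N / l ^ 2) := by
      -- The crude term of the Poincaré constant, of order l³, is absorbed here; this is what l⁵ ≤ N
      -- is for.
      have h1 : l ^ 3 ≤ N / l ^ 2 := by
        rw [le_div_iff₀ (by positivity), ← pow_add]
        exact hlN
      calc _ ≤ 1458 * ((k * R : ℕ) : ℝ) ^ 6 * u ^ 3 * l ^ 3 + 2592 * ((k * R : ℕ) : ℝ) ^ 4 *
            (u * l) * (N / (a * l)) / (a / 4 * l) ^ 2 := by
            rw [mul_pow, ← mul_assoc]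
            gcongr
        _ ≤ 1458 * ((k * R : ℕ) : ℝ) ^ 6 * u ^ 3 * (N / l ^ 2) + 2592 * ((k * R : ℕ) : ℝ) ^ 4 *
            (u * l) * (N / (a * l)) / (a / 4 * l) ^ 2 := by gcongr
        _ = _ := by
            rw [hP₀]
            field_simp
            ring
    have h1 := hμ.gossipTime_le hκ (D := D₀ * l) (C := P₀ * (N / l ^ 2)) (by positivity)
      (by positivity) (by
        intro _
        refine hW.maxDegree_le.trans (le_of_eq ?_)
        rw [hD₀]
        ring) (fun z => (hW.sum_sub_average_sq_le_dirichletEnergy hk z).trans (by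
        gcongr
        exact dirichletEnergy_nonneg _ _)) hε (by linarith)
    refine h1.trans (ENNReal.ofReal_le_ofReal ?_)
    -- The rounding term 1 is absorbed because ε stays below ε₀ < 1 and l ≤ N.
    have h2 : 1 ≤ 1 / Real.log ε₀⁻¹ * (N * Real.log ε⁻¹ / l) := by
      rw [one_div_mul_eq_div, div_div, one_le_div (by positivity), mul_comm (N : ℝ)]
      exact mul_le_mul hlogle hlN1 hl0.le hlog.le |>.trans_eq' (mul_comm _ _)
    have h3 : 12 * (D₀ * l) * (P₀ * (N / l ^ 2)) / κ * Real.log ε⁻¹ =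
        12 * D₀ * P₀ / κ * (N * Real.log ε⁻¹ / l) := by
      field_simp
    rw [hCT, h3, add_mul (12 * D₀ * P₀ / κ)]
    linarith
  have hPα : ∀ c : ℝ, 0 < c → (c ^ 2 * (l / N)) ^ (α / 2) = c ^ α * (l / N) ^ (α / 2) := by
    intro c hc
    rw [Real.mul_rpow (by positivity) (by positivity), ← Real.rpow_natCast c 2,
      ← Real.rpow_mul hc.le]
    congr 2
    push_cast
    ring
  have hrα : r ^ α = (r ^ 2) ^ (α / 2) := by
    rw [← Real.rpow_natCast r 2, ← Real.rpow_mul hr0]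
    congr 1
    push_cast
    ring
  have hP : 0 ≤ transmitPower α γ G r := by
    unfold transmitPower
    positivity
  have hP₁ : γ / G * c₁ ^ α * (l / N) ^ (α / 2) ≤ transmitPower α γ G r := by
    unfold transmitPower
    rw [mul_assoc, ← hPα c₁ hc₁, hrα]
    gcongr
  have hP₂ : transmitPower α γ G r ≤ γ / G * c₂ ^ α * (l / N) ^ (α / 2) := by
    unfold transmitPower
    rw [mul_assoc, ← hPα c₂ hc₂, hrα]
    gcongr
  obtain ⟨g1, g2, g3⟩ := gossip_resources hK (by positivity) (by positivity) hlower hupper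
    (hW.threshold_le_bandwidth hM) hP
  rw [Fintype.card_fin] at g2 g3
  refine ⟨⟨hlower, hupper⟩, ?_, ?_, ?_⟩
  · refine le_trans (ENNReal.ofReal_le_ofReal (le_of_eq ?_)) g1
    field_simp
  · refine le_trans (ENNReal.ofReal_le_ofReal ?_) g2
    rw [rpow_mul_rpow_log_eq hN0 hl0]
    calc _ = cT * (N * Real.log ε⁻¹ / l) * (N * (γ / G * c₁ ^ α * (l / N) ^ (α / 2))) := by ring
      _ ≤ _ := by gcongr
  · refine g3.trans (ENNReal.ofReal_le_ofReal ?_)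
    rw [rpow_mul_rpow_log_eq hN0 hl0]
    calc _ ≤ K * (CT * (N * Real.log ε⁻¹ / l) * (N * (γ / G * c₂ ^ α * (l / N) ^ (α / 2)))) := by
          gcongr
      _ = _ := by ring

/-! ### Choice of the grid and typicality with high probability -/

/-- M is 3/(c₁ρL) rounded up, which at most doubles it; cells then have side between c₁ρ/6 and
c₁ρ/3. -/
theorem exists_grid {c₁ ρ : ℝ} (hc₁ : 0 < c₁) (hρ : 0 < ρ) {L : ℕ} (hL : 0 < L)
    (hsmall : c₁ * ρ * L ≤ 1) : ∃ M : ℕ, 0 < M ∧ 3 ≤ M * L ∧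
      3 / (c₁ * ρ) ≤ (M * L : ℕ) ∧ ((M * L : ℕ) : ℝ) ≤ 6 / (c₁ * ρ) := by
  have hL' : (1 : ℝ) ≤ L := by exact_mod_cast hL
  have hd : 0 < c₁ * ρ * L := by positivity
  have hd1 : c₁ * ρ ≤ 1 := le_trans (le_mul_of_one_le_right (by positivity) hL') hsmall
  set s := 3 / (c₁ * ρ * L) with hs
  have hs0 : 0 < s := by positivity
  have hs3 : 3 ≤ s := by
    rw [hs, le_div_iff₀ hd]
    linarith
  have hsL : s * L = 3 / (c₁ * ρ) := by
    rw [hs]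
    field_simp
  have h1 := Nat.le_ceil s
  have h2 := (Nat.ceil_lt_add_one hs0.le).le
  have h3 : 3 / (c₁ * ρ) ≤ (⌈s⌉₊ * L : ℕ) := by
    rw [← hsL]
    push_cast
    gcongr
  refine ⟨⌈s⌉₊, Nat.ceil_pos.mpr hs0, ?_, h3, ?_⟩
  · have h4 : (3 : ℝ) ≤ 3 / (c₁ * ρ) := by
      rw [le_div_iff₀ (by positivity)]
      linarith
    exact_mod_cast h4.trans h3
  · push_cast
    calc (⌈s⌉₊ : ℝ) * L ≤ (s + s) * L := by
          gcongr
          linarith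
      _ = 6 / (c₁ * ρ) := by
          rw [add_mul, hsL]
          ring

/-- Each exponential is at most e^(-2l) = N⁻², and there are at most N cells or windows. For sparse
sets the exponent is at most (1/4 - 3/5) k a l ≤ -(7/20) · 8 l ≤ -2l. -/
theorem failure_bound {N M k R : ℕ} {a b l : ℝ} (hl : 0 < l)
    (hN : (N : ℝ) = Real.exp l) (hk : 8 ≤ k * a) (hM : M ≤ M * (k * R)) (hq₁ : a * l ≤ N / ((M * (k * R) : ℕ) : ℝ) ^ 2)
    (hq₂ : N / ((M * (k * R) : ℕ) : ℝ) ^ 2 ≤ b * l)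
    (hm : ((M * (k * R) : ℕ) : ℝ) ^ 2 ≤ N) :
    ((M * (k * R) : ℕ) : ℝ) ^ 2 *
          Real.exp (2 * (N / ((M * (k * R) : ℕ) : ℝ) ^ 2) - (2 * b + 2) * l) +
        (M : ℝ) ^ 2 * (2 ^ (3 * (k * R) * (3 * (k * R))) *
          Real.exp (k * (a / 4 * l) - 3 / 5 * (k * (N / ((M * (k * R) : ℕ) : ℝ) ^ 2)))) +
        2 * Real.exp (-(N / 60)) ≤
      (1 + 2 ^ (3 * (k * R) * (3 * (k * R)))) * (N : ℝ)⁻¹ + 2 * Real.exp (-(N / 60)) := by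
  have hM' : (M : ℝ) ≤ (M * (k * R) : ℕ) := by exact_mod_cast hM
  set q := (N : ℝ) / ((M * (k * R) : ℕ) : ℝ) ^ 2
  have hM2 : (M : ℝ) ^ 2 ≤ N := le_trans (by gcongr) hm
  have hinv : (N : ℝ) * Real.exp (-(2 * l)) = (N : ℝ)⁻¹ := by
    rw [hN, ← Real.exp_add, ← Real.exp_neg]
    congr 1
    ring
  have h1 : ((M * (k * R) : ℕ) : ℝ) ^ 2 * Real.exp (2 * q - (2 * b + 2) * l) ≤ (N : ℝ)⁻¹ := by
    rw [← hinv]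
    gcongr
    linarith
  have h2 : Real.exp (k * (a / 4 * l) - 3 / 5 * (k * q)) ≤ Real.exp (-(2 * l)) := by
    apply Real.exp_le_exp.mpr
    have h3 : (k : ℝ) * (a * l) ≤ k * q := by gcongr
    have h4 : 8 * l ≤ k * a * l := by gcongr
    linarith
  have h5 : (M : ℝ) ^ 2 * (2 ^ (3 * (k * R) * (3 * (k * R))) *
      Real.exp (k * (a / 4 * l) - 3 / 5 * (k * q))) ≤
      2 ^ (3 * (k * R) * (3 * (k * R))) * (N : ℝ)⁻¹ := by
    rw [← hinv]
    calc _ ≤ (N : ℝ) * (2 ^ (3 * (k * R) * (3 * (k * R))) * Real.exp (-(2 * l))) := by gcongr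
      _ = _ := by ring
  linarith

theorem tendsto_failure_bound (B : ℝ) :
    Tendsto (fun N : ℕ => ENNReal.ofReal (B * (N : ℝ)⁻¹ + 2 * Real.exp (-(N / 60)))) atTop
      (𝓝 0) := by
  have h1 : Tendsto (fun N : ℕ => (N : ℝ)⁻¹) atTop (𝓝 0) := tendsto_inv_atTop_nhds_zero_nat
  have h2 : Tendsto (fun N : ℕ => Real.exp (-((N : ℝ) / 60))) atTop (𝓝 0) :=
    Real.tendsto_exp_neg_atTop_nhds_zero.comp
      (tendsto_natCast_atTop_atTop.atTop_div_const (by norm_num))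
  have h3 := (h1.const_mul B).add (h2.const_mul 2)
  rw [mul_zero, mul_zero, add_zero] at h3
  have h4 := ENNReal.tendsto_ofReal h3
  rwa [ENNReal.ofReal_zero] at h4

end

/-! ### Choice of constants and proof of the theorem -/

theorem theorem3
    (α γ G : ℝ) (hα : 2 ≤ α) (hγ : 0 < γ) (hG : 0 < G) (K : ℕ) (hK : 1 ≤ K)
    (r : ℕ → ℝ) (hr_nonneg : ∀ N, 0 ≤ r N)
    (hr : r =Θ[atTop] fun N : ℕ => Real.sqrt (Real.log N / N))
    (hconn : Tendsto
      (fun N => placementLaw N {x | ¬ (radiusGraph α γ G (r N) x).Connected}) atTop (𝓝 0))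
    (κ : ℝ) (hκ : 0 < κ) (ε₀ : ℝ) (hε₀ : ε₀ < 1) :
    ∃ c C : ℝ, 0 < c ∧ 0 < C ∧
      Tendsto
        (fun N : ℕ => placementLaw N {x | ¬
          ∀ μ : PMF (Equiv.Perm (Fin N)), IsRandomPairing (radiusGraph α γ G (r N) x) κ μ →
          ∀ ε : ℝ, 0 < ε → ε ≤ ε₀ →
            (ENNReal.ofReal (c * (N * Real.log ε⁻¹ / Real.log N)) ≤ gossipTime μ ε ∧
              gossipTime μ ε ≤ ENNReal.ofReal (C * (N * Real.log ε⁻¹ / Real.log N))) ∧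
            ENNReal.ofReal (c * (N * Real.log ε⁻¹)) ≤ gossipBandwidth α γ G K (r N) x μ ε ∧
            (ENNReal.ofReal (c * ((N : ℝ) ^ (2 - α / 2) * Real.log N ^ (α / 2 - 1) *
                Real.log ε⁻¹)) ≤ gossipEnergy α γ G K (r N) μ ε ∧
              gossipEnergy α γ G K (r N) μ ε ≤
                ENNReal.ofReal (C * ((N : ℝ) ^ (2 - α / 2) * Real.log N ^ (α / 2 - 1) *
                  Real.log ε⁻¹)))})
        atTop (𝓝 0) := by
  -- For ε₀ ≤ 0 there is no admissible ε, so the exceptional set is empty.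
  rcases le_or_gt ε₀ 0 with hneg | hε₀0
  · refine ⟨1, 1, one_pos, one_pos, ?_⟩
    refine tendsto_const_nhds.congr fun N => ?_
    symm
    convert measure_empty (μ := placementLaw N)
    ext x
    simp only [Set.mem_ofPred_eq, Set.mem_empty_iff_false, iff_false, not_not]
    intro μ _ ε h1 h2
    linarith
  obtain ⟨c₂, hc₂, hO₂⟩ := hr.1.exists_pos
  obtain ⟨c₃, hc₃, hO₁⟩ := hr.2.exists_pos
  set c₁ : ℝ := c₃⁻¹ with hc₁def
  have hc₁ : 0 < c₁ := by positivity
  -- The mean occupancy N/m² of a cell will lie between a log N and b log N, since m is between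
  -- 3/(c₁ρ) and 6/(c₁ρ) with ρ² = log N / N.
  set a : ℝ := c₁ ^ 2 / 36 with ha_def
  set b : ℝ := c₁ ^ 2 / 9 with hb_def
  have ha : 0 < a := by positivity
  have hb : 0 < b := by positivity
  set u : ℝ := 2 * b + 2 with hu_def
  have hu : 0 < u := by positivity
  -- An edge has length at most c₂ρ, that is 6c₂/c₁ cell sides; the summand 1 accounts for taking
  -- floors.
  set R : ℕ := ⌈6 * c₂ / c₁⌉₊ + 1 with hR_def
  set k : ℕ := ⌈8 / a⌉₊ with hk_def
  have hk : 0 < k := Nat.ceil_pos.mpr (by positivity)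
  have hka : 8 ≤ k * a := (div_le_iff₀ ha).mp (Nat.le_ceil _)
  have hL : 0 < k * R := Nat.mul_pos hk (by omega)
  have hlog₀ : 0 < Real.log ε₀⁻¹ := Real.log_pos ((one_lt_inv₀ hε₀0).mpr hε₀)
  have hε₀' : 0 < 1 - ε₀ := by linarith
  set cT : ℝ := (1 - ε₀) ^ 2 / 3 / (216 * c₂ ^ 2) with hcT
  set CT : ℝ := 12 * ((2 * R + 1) ^ 2 * u) * (1458 * ((k * R : ℕ) : ℝ) ^ 6 * u ^ 3 +
      41472 * ((k * R : ℕ) : ℝ) ^ 4 * u / a ^ 3) / κ + 1 / Real.log ε₀⁻¹ with hCT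
  have hcT0 : 0 < cT := by positivity
  have hCT0 : 0 < CT := by positivity
  have hlogt : Tendsto (fun N : ℕ => Real.log N) atTop atTop :=
    Real.tendsto_log_atTop.comp tendsto_natCast_atTop_atTop
  have hratio : Tendsto (fun N : ℕ => Real.log N / N) atTop (𝓝 0) :=
    (Real.isLittleO_log_id_atTop.tendsto_div_nhds_zero).comp tendsto_natCast_atTop_atTop
  have hρ : Tendsto (fun N : ℕ => Real.sqrt (Real.log N / N)) atTop (𝓝 0) := by
    have h := (Real.continuous_sqrt.tendsto 0).comp hratio
    rwa [Real.sqrt_zero] at h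
  have e1 : ∀ᶠ N : ℕ in atTop, 1 ≤ Real.log N := hlogt.eventually_ge_atTop 1
  -- Ensures a log N ≥ 1, so that the number m² of cells is at most N.
  have e2 : ∀ᶠ N : ℕ in atTop, 1 / a ≤ Real.log N := hlogt.eventually_ge_atTop _
  have e3 : ∀ᶠ N : ℕ in atTop, Real.log N ^ 5 ≤ N := by
    have h := (Real.isLittleO_pow_log_id_atTop (n := 5)).bound (c := 1) one_pos
    filter_upwards [tendsto_natCast_atTop_atTop.eventually h, e1] with N h1 h2
    rw [Real.norm_eq_abs, Real.norm_eq_abs, one_mul, abs_of_nonneg (by positivity), id,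
      abs_of_nonneg (Nat.cast_nonneg _)] at h1
    exact h1
  have e4 : ∀ᶠ N : ℕ in atTop, c₁ * Real.sqrt (Real.log N / N) * (k * R : ℕ) ≤ 1 := by
    have h : Tendsto (fun N : ℕ => c₁ * Real.sqrt (Real.log N / N) * (k * R : ℕ)) atTop (𝓝 0) := by
      simpa using (hρ.const_mul c₁).mul_const ((k * R : ℕ) : ℝ)
    exact h.eventually_le_const one_pos
  have e5 : ∀ᶠ N : ℕ in atTop, 108 * (c₂ ^ 2 * (Real.log N / N)) ≤ 1 / 2 := by
    have h : Tendsto (fun N : ℕ => 108 * (c₂ ^ 2 * (Real.log N / N))) atTop (𝓝 0) := by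
      simpa using (hratio.const_mul (c₂ ^ 2)).const_mul 108
    exact h.eventually_le_const (by norm_num)
  refine ⟨min cT (min (cT * (a / 4)) (cT * (γ / G * c₁ ^ α))), max CT (K * CT * (γ / G * c₂ ^ α)),
    by positivity, by positivity, ?_⟩
  have hlim := hconn.add (tendsto_failure_bound (1 + 2 ^ (3 * (k * R) * (3 * (k * R)))))
  rw [add_zero] at hlim
  refine tendsto_of_tendsto_of_tendsto_of_le_of_le' tendsto_const_nhds hlim
    (Eventually.of_forall fun _ => bot_le) ?_
  filter_upwards [e1, e2, e3, e4, e5, hO₁.bound, hO₂.bound] with N h1 h2 h3 h4 h5 h6 h7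
  have hl0 : 0 < Real.log N := by linarith
  have hN0 : (0 : ℝ) < N := lt_of_lt_of_le (by positivity) h3
  set ρ := Real.sqrt (Real.log N / N) with hρdef
  have hρ0 : 0 < ρ := Real.sqrt_pos.mpr (by positivity)
  have hρ2 : ρ ^ 2 = Real.log N / N := Real.sq_sqrt (by positivity)
  rw [Real.norm_eq_abs, Real.norm_eq_abs, abs_of_nonneg (hr_nonneg N), abs_of_pos hρ0] at h6 h7
  have hr₁ : c₁ * ρ ≤ r N := by
    rw [hc₁def, inv_mul_le_iff₀ hc₃]
    exact h6
  obtain ⟨M, hM0, hM3, hMl, hMu⟩ := exists_grid hc₁ hρ0 hL h4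
  set m := M * (k * R) with hm_def
  have hm0 : (0 : ℝ) < m := lt_of_lt_of_le (by positivity) hMl
  have hm2u : (m : ℝ) ^ 2 ≤ N / (a * Real.log N) := by
    calc (m : ℝ) ^ 2 ≤ (6 / (c₁ * ρ)) ^ 2 := by gcongr
      _ = 36 / (c₁ ^ 2 * ρ ^ 2) := by ring
      _ = _ := by
          rw [hρ2, ha_def]
          field_simp
  have hm2l : N / (b * Real.log N) ≤ (m : ℝ) ^ 2 := by
    calc N / (b * Real.log N) = 9 / (c₁ ^ 2 * ρ ^ 2) := by
          rw [hρ2, hb_def]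
          field_simp
      _ = (3 / (c₁ * ρ)) ^ 2 := by ring
      _ ≤ _ := by gcongr
  have hal : 1 ≤ a * Real.log N := by
    rw [div_le_iff₀ ha] at h2
    linarith
  have hm2N : (m : ℝ) ^ 2 ≤ N := hm2u.trans (div_le_self hN0.le hal)
  have hMm : M ≤ m := Nat.le_mul_of_pos_right _ hL
  have hq₁ : a * Real.log N ≤ N / (m : ℝ) ^ 2 := by
    rw [le_div_iff₀ (by positivity), mul_comm]
    exact (le_div_iff₀ (by positivity)).mp hm2u
  have hq₂ : N / (m : ℝ) ^ 2 ≤ b * Real.log N := by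
    rw [div_le_iff₀ (by positivity), mul_comm]
    exact (div_le_iff₀ (by positivity)).mp hm2l
  have hr0 := hr_nonneg N
  have hrm : 3 ≤ r N * m := by
    calc (3 : ℝ) = c₁ * ρ * (3 / (c₁ * ρ)) := by field_simp
      _ ≤ _ := by gcongr
  have hrR : r N * m + 1 ≤ R := by
    have : r N * m ≤ 6 * c₂ / c₁ := by
      calc r N * m ≤ c₂ * ρ * (6 / (c₁ * ρ)) := by gcongr
        _ = _ := by field_simp
    rw [hR_def]
    push_cast
    linarith [Nat.le_ceil (6 * c₂ / c₁)]
  have hfail := placementLaw_not_isTypicalPlacement_le (N := N) (show 0 < α by linarith) hγ hG hM3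
    hrm hrR (show 0 < a / 4 * Real.log N by positivity) (show 0 ≤ u * Real.log N by positivity)
  refine le_trans (measure_mono ?_) (hfail.trans (add_le_add le_rfl (ENNReal.ofReal_le_ofReal
    (failure_bound hl0 (Real.exp_log hN0).symm hka hMm hq₁ hq₂ hm2N))))
  -- A placement violating the bounds cannot be typical, so the failure probability of typicality
  -- bounds the exceptional set for all pairing laws and all ε at once.
  intro x hx htyp
  refine hx fun μ hμ ε hε hεε => ?_
  have hlog : 0 < Real.log ε⁻¹ := Real.log_pos ((one_lt_inv₀ hε).mpr (by linarith))
  obtain ⟨⟨g1, g2⟩, g3, g4, g5⟩ := htyp.gossip_bounds hα hγ hG hK hκ hε₀ hc₁ hc₂ ha hu h1 h3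
    (hr_nonneg N) (by rw [← hρ2, ← mul_pow]; gcongr)
    (by rw [← hρ2, ← mul_pow]; exact pow_le_pow_left₀ (hr_nonneg N) h7 2)
    (le_trans (by
      gcongr
      rw [← hρ2, ← mul_pow]
      exact pow_le_pow_left₀ (hr_nonneg N) h7 2) h5) hM0 hk
    (le_trans (by gcongr) hm2u) hcT hCT hμ hε hεε
  refine ⟨⟨le_trans (ENNReal.ofReal_le_ofReal ?_) g1, g2.trans (ENNReal.ofReal_le_ofReal ?_)⟩,
    le_trans (ENNReal.ofReal_le_ofReal ?_) g3, le_trans (ENNReal.ofReal_le_ofReal ?_) g4,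
    g5.trans (ENNReal.ofReal_le_ofReal ?_)⟩
  · gcongr
    exact min_le_left _ _
  · gcongr
    exact le_max_left _ _
  · gcongr
    exact (min_le_right _ _).trans (min_le_left _ _)
  · gcongr
    exact (min_le_right _ _).trans (min_le_right _ _)
  · gcongr
    exact le_max_right _ _
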